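/- **Proposition (non-degeneracy condition for the 1-modes and the CH model).** For integers $\mu_1,\mu_2,n\ge 0$ let $\omega_n=2n+1+\mu_1+\mu_2$ and let $$e_n(x)=N_n\,(1-\cos 2x)^{\mu_1/2}(1+\cos 2x)^{\mu_2/2}P_n^{(\mu_1,\mu_2)}(\cos 2x),\qquad N_n=\sqrt{\frac{\omega_n}{2^{\mu_1+\mu_2}}\frac{n!\,(n+\mu_1+\mu_2)!}{(n+\mu_1)!\,(n+\mu_2)!}},$$ where $P_n^{(\mu_1,\mu_2)}$ are the Jacobi polynomials. These are the eigenfunctions, with eigenvalues $\omega_n^2$, of $Lu=-u''-(\cot x-\tan x)u'+\big(\tfrac{\mu_1^2}{\sin^2x}+\tfrac{\mu_2^2}{\cos^2x}+1\big)u$ on $(0,\pi/2)$, normalized in $L^2((0,\pi/2);\sin(2x)\,dx)$; the equation $(\partial_t^2+L)u=-u^3$ is the conformal cubic wave equation on $\mathbb R\times\mathbb S^3$ under the Hopf-coordinate ansatz. Put $$C_{ijkm}=\int_0^{\pi/2}e_ie_je_ke_m\,\sin(2x)\,dx .$$ For $r\in\mathbb N$ let $l^2_r$ be the space of real sequences $u=(u^j)_{j\ge0}$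 with $\sum_j(1+j)^{2r}|u^j|^2<\infty$. For a sequence $\xi$ let $\Phi^t(\xi)^n=\cos(\omega_nt)\,\xi^n$, $f(u)^m=-\sum_{i,j,k\ge0}C_{ijkm}u^iu^ju^k$, and $$\mathcal M(\xi)^m=\omega_m^2\,\xi^m+\frac1{2\pi}\int_0^{2\pi}\Phi^t\big[f(\Phi^t(\xi))\big]^m\,dt .$$ For $\gamma\ge0$ the rescaled 1-mode is $\xi_\gamma^m=\pm2\,\omega_\gamma\sqrt{\tfrac{2}{3C_{\gamma\gamma\gamma\gamma}}}\;\mathbf 1(m=\gamma)$, and for $0\le n<\gamma$ set $$D_{\gamma n}=\big[\omega_n^2C_{\gamma\gamma\gamma\gamma}-2\omega_\gamma^2C_{\gamma\gamma nn}\big]\big[\omega_{2\gamma-n}^2C_{\gamma\gamma\gamma\gamma}-2\omega_\gamma^2C_{\gamma,\gamma,2\gamma-n,2\gamma-n}\big]-\big[\omega_\gamma^2C_{\gamma,2\gamma-n,\gamma,n}\big]^2 .$$ There is an integer $\mu_0\ge 0$ such that, for every $\gamma\in\{0,1,2,3,4,5\}$ and every $\mu_1=\mu_2=\mu$ with either $\mu\in\{0,1,2,3,4,5\}$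 or $\mu\ge\mu_0$, the following hold. 1. $\omega_m^2C_{\gamma\gamma\gamma\gamma}-2\omega_\gamma^2C_{\gamma\gamma mm}\ne0$ for all $m\ge2\gamma+1$, and $D_{\gamma n}\neq0$ for all $n\in\{0,\dots,\gamma-1\}$. 2. Equivalently, for either choice of sign, the rescaled 1-mode $\xi_\gamma$ is a non-degenerate zero of $\mathcal M$: for every integer $s\ge2$, $\mathcal M$ is a well-defined map $l^2_{s+3}\to l^2_{s+1}$ (the series for $f$ converge absolutely along the flow $\Phi^t(u)$ of every $u\in l^2_{s+3}$, and the time averages exist), $\mathcal M(\xi_\gamma)=0$, $\mathcal M$ is Fréchet differentiable at $\xi_\gamma$, and $\ker d\mathcal M(\xi_\gamma)=\{0\}$. -/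

import Mathlib

namespace HopfCubicWave

/-- Jacobi polynomial `P_n^{(a,b)}` with natural parameters, as a function on `ℝ`. -/
noncomputable def jacobiP (a b n : ℕ) (y : ℝ) : ℝ :=
  ∑ k ∈ Finset.range (n + 1),
    ((n + a).choose (n - k) : ℝ) * ((n + b).choose k : ℝ)
      * ((y - 1) / 2) ^ k * ((y + 1) / 2) ^ (n - k)

/-- The frequency `ω_n = 2n + 1 + μ₁ + μ₂`. -/
def freq (μ₁ μ₂ n : ℕ) : ℝ := 2 * (n : ℝ) + 1 + (μ₁ : ℝ) + (μ₂ : ℝ)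

/-- The normalization constant of the `n`-th eigenfunction (`Γ(k + 1) = k!`). -/
noncomputable def normConst (μ₁ μ₂ n : ℕ) : ℝ :=
  Real.sqrt (freq μ₁ μ₂ n / 2 ^ (μ₁ + μ₂)
    * (((n.factorial : ℝ) * ((n + μ₁ + μ₂).factorial : ℝ))
      / (((n + μ₁).factorial : ℝ) * ((n + μ₂).factorial : ℝ))))

/-- The `n`-th eigenfunction of
`L u = -u'' - (cot x - tan x) u' + (μ₁² / sin² x + μ₂² / cos² x + 1) u` on `(0, π/2)`,
normalized in `L²((0, π/2); sin (2x) dx)`. -/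
noncomputable def eigenfn (μ₁ μ₂ n : ℕ) (x : ℝ) : ℝ :=
  normConst μ₁ μ₂ n * (1 - Real.cos (2 * x)) ^ ((μ₁ : ℝ) / 2)
    * (1 + Real.cos (2 * x)) ^ ((μ₂ : ℝ) / 2) * jacobiP μ₁ μ₂ n (Real.cos (2 * x))

/-- The Fourier coefficient `C_{ijkm}`, the inner product of `e_i e_j e_k` and `e_m`. -/
noncomputable def fourierC (μ₁ μ₂ i j k m : ℕ) : ℝ :=
  ∫ x in (0 : ℝ)..(Real.pi / 2),
    eigenfn μ₁ μ₂ i x * eigenfn μ₁ μ₂ j x * eigenfn μ₁ μ₂ k x * eigenfn μ₁ μ₂ m x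
      * Real.sin (2 * x)

/-- A term of the triple series that defines the `m`-th component of the nonlinearity. -/
noncomputable def cubicTerm (μ₁ μ₂ : ℕ) (u : ℕ → ℝ) (m : ℕ) (p : ℕ × ℕ × ℕ) : ℝ :=
  fourierC μ₁ μ₂ p.1 p.2.1 p.2.2 m * (u p.1 * u p.2.1 * u p.2.2)

/-- The nonlinearity `f(u)^m = - ∑_{i,j,k} C_{ijkm} u^i u^j u^k`. -/
noncomputable def nonlinearity (μ₁ μ₂ : ℕ) (u : ℕ → ℝ) (m : ℕ) : ℝ :=
  -∑' p : ℕ × ℕ × ℕ, cubicTerm μ₁ μ₂ u m p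

/-- The linear flow with zero initial velocity. -/
noncomputable def linFlow (μ₁ μ₂ : ℕ) (t : ℝ) (u : ℕ → ℝ) (n : ℕ) : ℝ :=
  Real.cos (freq μ₁ μ₂ n * t) * u n

/-- The average of the nonlinearity along the linear flow. -/
noncomputable def averagedNonlinearity (μ₁ μ₂ : ℕ) (u : ℕ → ℝ) (m : ℕ) : ℝ :=
  1 / (2 * Real.pi) * ∫ t in (0 : ℝ)..(2 * Real.pi),
    linFlow μ₁ μ₂ t (nonlinearity μ₁ μ₂ (linFlow μ₁ μ₂ t u)) m

/-- The operator `M(u) = A u + ⟨f⟩(u)`, where `(A u)^m = ω_m² u^m`. -/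
noncomputable def resonantOp (μ₁ μ₂ : ℕ) (u : ℕ → ℝ) (m : ℕ) : ℝ :=
  freq μ₁ μ₂ m ^ 2 * u m + averagedNonlinearity μ₁ μ₂ u m

/-- No convention for divergent series or non-integrable functions enters `M(u)`: along the whole
linear orbit of `u` the triple series converge absolutely, and the averages are integrals of
integrable functions. -/
def ResonantOpConverges (μ₁ μ₂ : ℕ) (u : ℕ → ℝ) : Prop :=
  ∀ m : ℕ,
    (∀ t : ℝ, Summable (cubicTerm μ₁ μ₂ (linFlow μ₁ μ₂ t u) m)) ∧
    IntervalIntegrable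
      (fun t => linFlow μ₁ μ₂ t (nonlinearity μ₁ μ₂ (linFlow μ₁ μ₂ t u)) m)
      MeasureTheory.volume 0 (2 * Real.pi)

/-- The rescaled 1-mode `ξ^m = ± 2 ω_γ √(2 / (3 C_{γγγγ})) 1(m = γ)`; `σ = ±1` is the sign. -/
noncomputable def oneMode (μ₁ μ₂ γ : ℕ) (σ : ℝ) (m : ℕ) : ℝ :=
  if m = γ then
    σ * (2 * freq μ₁ μ₂ γ * Real.sqrt (2 / (3 * fourierC μ₁ μ₂ γ γ γ γ)))
  else 0

/-- The determinant `D_{γn}`, used for `n < γ`. -/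
noncomputable def detD (μ₁ μ₂ γ n : ℕ) : ℝ :=
  (freq μ₁ μ₂ n ^ 2 * fourierC μ₁ μ₂ γ γ γ γ
      - 2 * freq μ₁ μ₂ γ ^ 2 * fourierC μ₁ μ₂ γ γ n n)
    * (freq μ₁ μ₂ (2 * γ - n) ^ 2 * fourierC μ₁ μ₂ γ γ γ γ
      - 2 * freq μ₁ μ₂ γ ^ 2 * fourierC μ₁ μ₂ γ γ (2 * γ - n) (2 * γ - n))
    - (freq μ₁ μ₂ γ ^ 2 * fourierC μ₁ μ₂ γ (2 * γ - n) γ n) ^ 2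

/-- The real sequences `u` with `∑_j (1 + j)^{2r} |u_j|² < ∞`, as a space of sequences. -/
def weightedSubmodule (r : ℕ) : Submodule ℝ (ℕ → ℝ) where
  carrier := {u | Memℓp (fun j : ℕ => (1 + (j : ℝ)) ^ r * u j) 2}
  add_mem' := by
    intro u v hu hv
    have h := hu.add hv
    refine (congrArg (fun w : ℕ → ℝ => Memℓp w 2) ?_).mp h
    funext j
    simp [mul_add]
  zero_mem' := by
    refine (congrArg (fun w : ℕ → ℝ => Memℓp w 2) ?_).mp
      (zero_memℓp : Memℓp (0 : ℕ → ℝ) 2)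
    funext j
    simp
  smul_mem' := by
    intro c u hu
    have h := hu.const_smul c
    refine (congrArg (fun w : ℕ → ℝ => Memℓp w 2) ?_).mp h
    funext j
    simp [mul_left_comm]

/-- The Hilbert space `l²_r` of sequences with `|u|_r² = ∑_j (1 + j)^{2r} |u_j|² < ∞`. It is a type
of its own so that its topology is the one of this norm, not that of pointwise convergence. -/
def SeqSpace (r : ℕ) : Type := weightedSubmodule r

instance (r : ℕ) : AddCommGroup (SeqSpace r) :=
  inferInstanceAs (AddCommGroup (weightedSubmodule r))

instance (r : ℕ) : Module ℝ (SeqSpace r) :=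
  inferInstanceAs (Module ℝ (weightedSubmodule r))

/-- The sequence underlying an element of `l²_r`. -/
def SeqSpace.seq {r : ℕ} (u : SeqSpace r) : ℕ → ℝ := u.1

/-- The weighting map `u ↦ ((1 + j)^r u_j)_j` into `ℓ²`. -/
noncomputable def SeqSpace.toLp (r : ℕ) : SeqSpace r →ₗ[ℝ] lp (fun _ : ℕ => ℝ) 2 where
  toFun u := ⟨fun j => (1 + (j : ℝ)) ^ r * u.seq j, u.2⟩
  map_add' u v := by
    ext j
    exact mul_add _ _ _
  map_smul' c u := by
    ext j
    exact mul_left_comm _ _ _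

theorem SeqSpace.toLp_injective (r : ℕ) : Function.Injective (SeqSpace.toLp r) := by
  intro u v h
  apply Subtype.ext
  funext j
  have hj : (1 + (j : ℝ)) ^ r * u.seq j = (1 + (j : ℝ)) ^ r * v.seq j :=
    congrFun (congrArg Subtype.val h) j
  have hpos : (1 + (j : ℝ)) ^ r ≠ 0 := by positivity
  exact mul_left_cancel₀ hpos hj

noncomputable instance (r : ℕ) : NormedAddCommGroup (SeqSpace r) :=
  NormedAddCommGroup.induced (SeqSpace r) (lp (fun _ : ℕ => ℝ) 2) (SeqSpace.toLp r)
    (SeqSpace.toLp_injective r)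

noncomputable instance (r : ℕ) : NormedSpace ℝ (SeqSpace r) :=
  NormedSpace.induced ℝ (SeqSpace r) (lp (fun _ : ℕ => ℝ) 2) (SeqSpace.toLp r)

/-- `F` maps `l²_a` into `l²_b`, and `ξ ∈ l²_a` is a non-degenerate zero of this map `N`:
`N(ξ) = 0`, `N` is Fréchet differentiable at `ξ`, and `ker dN(ξ) = {0}`.
The map `N` and the point `x` are determined by `F` and `ξ`. -/
def IsNondegenerateZero (F : (ℕ → ℝ) → (ℕ → ℝ)) (a b : ℕ) (ξ : ℕ → ℝ) : Prop :=
  ∃ (N : SeqSpace a → SeqSpace b) (x : SeqSpace a),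
    (∀ u : SeqSpace a, (N u).seq = F u.seq) ∧ x.seq = ξ ∧
    N x = 0 ∧ DifferentiableAt ℝ N x ∧
    LinearMap.ker (fderiv ℝ N x : SeqSpace a →ₗ[ℝ] SeqSpace b) = ⊥

end HopfCubicWave

/-! For equal parameters the substitution y = cos 2x turns every Fourier coefficient into an
integral of (1-y²)^(2μ) against a product of four Gegenbauer polynomials g_n of parameter μ + 1/2.
Everything else rests on integration by parts for such integrals.

Linearization. The frequencies are integers, so averaging over a period keeps only resonant terms.
At a single mode γ the possible resonances linking k and m are k = m, k + m = 2γ and |k - m| = 2γ +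
2μ + 1; the last is killed by orthogonality, since (1-y²)^μ g_i g_j g_k has degree at most i + j + k
+ 2μ (`fourierC_eq_zero`, `meanKernel_eq`). The derivative therefore splits into scalars for m > 2γ,
the scalar -2ω_γ² at m = γ, and 2×2 blocks on {n, 2γ-n} whose determinants are multiples of D_{γn}.
Triviality of the kernel is thus reduced to the algebraic conditions
(`isNondegenerateZero_oneMode`). The analytic framework needs only |e_n| ≤ K(1+n) and the degree
bound, which make the averaged cubic term a bounded trilinear map (`exists_kernelBound`,
`exists_resonantMap`).

Scalars m > 2γ. The integral of (1-y²)^(2μ) g_m² satisfies a first-order recursion in m, and raising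
the exponent of the weight multiplies it by a rational function of ω_m² with poles at 4(μ+j)².
Writing C_{γγmm} in the basis of the products ∏ (ω_m² - 4(μ+j)²)⁻¹ gives nonnegative coefficients
for γ ≤ 5, so C_{γγmm} decreases in m on m ≥ 2γ+1 while ω_m² increases. Only m = 2γ+1 remains, where
the condition is a rational function of μ with positive coefficients
(`diag_condition_of_expansion`). This works for every μ.

Determinants. Up to a nonzero factor D_{γn} is an integer polynomial in μ (`detList`). Its values at
μ ≤ 5 are computed exactly; being nonzero at μ = 0, the polynomial has finitely many roots, and this
produces μ₀ (`exists_detD_ne_zero`). -/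

namespace HopfCubicWave

/-! ### Gegenbauer polynomials and their relation to Jacobi polynomials -/

open Polynomial

/-- The polynomial `1 - y²`. -/
noncomputable def oneSubSq : ℝ[X] := 1 - X ^ 2

/-- The Gegenbauer polynomial `n! C_n^{(μ + 1/2)}`, generated by the raising operator. -/
noncomputable def gegen (μ : ℕ) : ℕ → ℝ[X]
  | 0 => 1
  | n + 1 => C ((n : ℝ) + 2 * μ + 1) * X * gegen μ n - oneSubSq * derivative (gegen μ n)

/-- The eigenvalue of the Gegenbauer operator on polynomials of degree `n`. -/
def gegenEig (μ n : ℕ) : ℝ := (n : ℝ) * ((n : ℝ) + 2 * μ + 1)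

theorem gegen_succ (μ n : ℕ) :
    gegen μ (n + 1) =
      C ((n : ℝ) + 2 * μ + 1) * X * gegen μ n - oneSubSq * derivative (gegen μ n) := rfl

theorem derivative_oneSubSq : derivative oneSubSq = -(2 * X) := by
  simp [oneSubSq]
  norm_num

/-- The two halves feed each other: differentiating the raising relation and removing the second
derivative by the differential equation in degree n gives the derivative formula, and that formula
with the equation in degree n gives the equation in degree n + 1. -/
theorem gegen_ode (μ n : ℕ) :
    oneSubSq * derivative (derivative (gegen μ n)) =
      C (2 * ((μ : ℝ) + 1)) * X * derivative (gegen μ n) - C (gegenEig μ n) * gegen μ n ∧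
    derivative (gegen μ (n + 1)) =
      C ((n : ℝ) + 1) * (C ((n : ℝ) + 2 * μ + 1) * gegen μ n + X * derivative (gegen μ n)) := by
  induction n with
  | zero =>
    refine ⟨by simp [gegen, gegenEig], ?_⟩
    simp [gegen]
  | succ n ih =>
    obtain ⟨h1, h2⟩ := ih
    have h3 : oneSubSq * derivative (derivative (gegen μ (n + 1))) =
        C (2 * ((μ : ℝ) + 1)) * X * derivative (gegen μ (n + 1))
          - C (gegenEig μ (n + 1)) * gegen μ (n + 1) := by
      rw [h2]
      simp only [derivative_mul, derivative_add, derivative_C, derivative_X, gegen_succ]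
      simp only [gegenEig, map_add, map_mul, map_natCast, map_ofNat, map_one, Nat.cast_add,
        Nat.cast_one] at h1 ⊢
      linear_combination ((n : ℝ[X]) + 1) * X * h1
    refine ⟨h3, ?_⟩
    rw [gegen_succ μ (n + 1)]
    simp only [derivative_mul, derivative_sub, derivative_C, derivative_X, derivative_oneSubSq]
    simp only [gegenEig, map_add, map_mul, map_natCast, map_ofNat, map_one, Nat.cast_add,
        Nat.cast_one] at h3 ⊢
    linear_combination -h3

theorem derivative_gegen_succ (μ n : ℕ) :
    derivative (gegen μ (n + 1)) =
      C ((n : ℝ) + 1) * (C ((n : ℝ) + 2 * μ + 1) * gegen μ n + X * derivative (gegen μ n)) :=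
  (gegen_ode μ n).2

theorem gegen_recurrence (μ n : ℕ) :
    gegen μ (n + 2) = C (2 * (n : ℝ) + 2 * μ + 3) * X * gegen μ (n + 1)
      - C (((n : ℝ) + 1) * ((n : ℝ) + 1 + 2 * μ)) * gegen μ n := by
  have h := gegen_succ μ n
  rw [gegen_succ μ (n + 1), derivative_gegen_succ]
  simp only [map_add, map_mul, map_natCast, map_ofNat, map_one, Nat.cast_add,
        Nat.cast_one, oneSubSq] at h ⊢
  linear_combination (-(n : ℝ[X]) - 1) * X * h

theorem gegen_natDegree_le (μ n : ℕ) : (gegen μ n).natDegree ≤ n := by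
  induction n with
  | zero => simp [gegen]
  | succ n ih =>
    rw [gegen_succ]
    refine (natDegree_sub_le _ _).trans (max_le ?_ ?_)
    · refine natDegree_mul_le.trans ?_
      have : (C ((n : ℝ) + 2 * μ + 1) * X).natDegree ≤ 1 := (natDegree_C_mul_le _ _).trans natDegree_X_le
      omega
    · rcases Nat.eq_zero_or_pos (gegen μ n).natDegree with h0 | h0
      · rw [natDegree_eq_zero] at h0
        obtain ⟨c, hc⟩ := h0
        simp [← hc]
      · refine natDegree_mul_le.trans ?_
        have h1 : oneSubSq.natDegree ≤ 2 := by
          unfold oneSubSq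
          compute_degree
        have h2 := natDegree_derivative_lt (p := gegen μ n) (by omega)
        omega

/-- The Jacobi polynomial with equal parameters as an element of `ℝ[X]`. -/
noncomputable def jacobiPoly (μ n : ℕ) : ℝ[X] :=
  ∑ k ∈ Finset.range (n + 1), C (((n + μ).choose (n - k) : ℝ) * ((n + μ).choose k : ℝ))
    * ((C (1 / 2) * (X - 1)) ^ k * (C (1 / 2) * (X + 1)) ^ (n - k))

theorem eval_jacobiPoly (μ n : ℕ) (y : ℝ) : (jacobiPoly μ n).eval y = jacobiP μ μ n y := by
  unfold jacobiPoly jacobiP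
  rw [eval_finsetSum]
  refine Finset.sum_congr rfl fun k _ => ?_
  simp only [eval_mul, eval_pow, eval_C, eval_sub, eval_add, eval_X, eval_one]
  ring

/-- Coefficient bookkeeping for a binary form of degree n + 1 obtained from one of degree n, when
each monomial contributes to two neighbouring monomials. -/
theorem sum_range_shift_pair {R : Type*} [CommSemiring R] (n : ℕ) (α β γ : ℕ → R) (t s : R)
    (h0 : γ 0 = α 0) (hn : γ (n + 1) = β n) (hk : ∀ k < n, γ (k + 1) = α (k + 1) + β k) :
    ∑ k ∈ Finset.range (n + 2), γ k * (t ^ k * s ^ (n + 1 - k)) =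
      ∑ k ∈ Finset.range (n + 1),
        (α k * (t ^ k * s ^ (n - k + 1)) + β k * (t ^ (k + 1) * s ^ (n - k))) := by
  rw [Finset.sum_add_distrib, Finset.sum_range_succ', Finset.sum_range_succ, hn, h0,
    Finset.sum_range_succ' (fun k => α k * (t ^ k * s ^ (n - k + 1))),
    Finset.sum_range_succ (fun k => β k * (t ^ (k + 1) * s ^ (n - k)))]
  have : ∑ k ∈ Finset.range n, γ (k + 1) * (t ^ (k + 1) * s ^ (n + 1 - (k + 1))) =
      ∑ k ∈ Finset.range n, α (k + 1) * (t ^ (k + 1) * s ^ (n - (k + 1) + 1))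
      + ∑ k ∈ Finset.range n, β k * (t ^ (k + 1) * s ^ (n - k)) := by
    rw [← Finset.sum_add_distrib]
    refine Finset.sum_congr rfl fun k hk' => ?_
    have hk'' := Finset.mem_range.mp hk'
    rw [hk k hk'', show n + 1 - (k + 1) = n - k by omega, show n - (k + 1) + 1 = n - k by omega]
    ring
  rw [this]
  simp only [Nat.sub_zero, Nat.sub_self, show n + 1 - (n + 1) = 0 by omega]
  ring

theorem jacobi_choose_identity (μ n k : ℕ) (hk : k < n) :
    ((n : ℝ) + 1) * ((n : ℝ) + 2 * μ + 1) *
      (((n + 1 + μ).choose (n + 1 - (k + 1)) : ℝ) * ((n + 1 + μ).choose (k + 1) : ℝ)) =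
    ((n : ℝ) + μ + 1) * (((n : ℝ) + 2 * μ + 1 + 2 * ((k : ℝ) + 1)) *
        (((n + μ).choose (n - (k + 1)) : ℝ) * ((n + μ).choose (k + 1) : ℝ))
      + ((n : ℝ) + 2 * μ + 1 + 2 * ((n : ℝ) - k)) *
        (((n + μ).choose (n - k) : ℝ) * ((n + μ).choose k : ℝ))) := by
  obtain ⟨j, rfl⟩ : ∃ j, n = k + 1 + j := ⟨n - (k + 1), by omega⟩
  have e1 : k + 1 + j + 1 - (k + 1) = j + 1 := by omega
  have e2 : k + 1 + j - (k + 1) = j := by omega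
  have e3 : k + 1 + j - k = j + 1 := by omega
  rw [e1, e2, e3]
  have p1 : (k + 1 + j + 1 + μ).choose (j + 1) =
      (k + 1 + j + μ).choose j + (k + 1 + j + μ).choose (j + 1) := by
    rw [show k + 1 + j + 1 + μ = (k + 1 + j + μ) + 1 by ring, Nat.choose_succ_succ]
  have p2 : (k + 1 + j + 1 + μ).choose (k + 1) =
      (k + 1 + j + μ).choose k + (k + 1 + j + μ).choose (k + 1) := by
    rw [show k + 1 + j + 1 + μ = (k + 1 + j + μ) + 1 by ring, Nat.choose_succ_succ]
  have q1 := Nat.choose_succ_right_eq (k + 1 + j + μ) j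
  have q2 := Nat.choose_succ_right_eq (k + 1 + j + μ) k
  rw [show k + 1 + j + μ - j = k + 1 + μ by omega] at q1
  rw [show k + 1 + j + μ - k = 1 + j + μ by omega] at q2
  rw [p1, p2]
  have q1' : ((k + 1 + j + μ).choose (j + 1) : ℝ) * (j + 1) =
      (k + 1 + j + μ).choose j * (k + 1 + μ) := by exact_mod_cast q1
  have q2' : ((k + 1 + j + μ).choose (k + 1) : ℝ) * (k + 1) =
      (k + 1 + j + μ).choose k * (1 + j + μ) := by exact_mod_cast q2
  push_cast
  set a := ((k + 1 + j + μ).choose j : ℝ)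
  set b := ((k + 1 + j + μ).choose k : ℝ)
  have hj : (0 : ℝ) < j + 1 := by positivity
  have hk : (0 : ℝ) < k + 1 := by positivity
  -- All binomials become rational multiples of `a` and `b`, and the identity turns into one of
  -- rational functions.
  have r1 : ((k + 1 + j + μ).choose (j + 1) : ℝ) = a * (k + 1 + μ) / (j + 1) := by
    field_simp; linarith
  have r2 : ((k + 1 + j + μ).choose (k + 1) : ℝ) = b * (1 + j + μ) / (k + 1) := by
    field_simp; linarith
  rw [r1, r2]
  field_simp
  ring

/-- Jacobi polynomials obey the raising relation of `gegen` up to a scalar. With t = (y-1)/2 and s =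
(y+1)/2 one has y = s + t and 1 - y² = -4ts, so the raising operator sends t^k s^(n-k) to a
combination of t^k s^(n-k+1) and t^(k+1) s^(n-k); comparing coefficients leaves
`jacobi_choose_identity` and two boundary cases. -/
theorem jacobiPoly_succ (μ n : ℕ) :
    C (((n : ℝ) + 1) * ((n : ℝ) + 2 * μ + 1)) * jacobiPoly μ (n + 1) =
      C ((n : ℝ) + μ + 1) * (C ((n : ℝ) + 2 * μ + 1) * X * jacobiPoly μ n
        - oneSubSq * derivative (jacobiPoly μ n)) := by
  set t : ℝ[X] := C (1 / 2) * (X - 1) with ht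
  set s : ℝ[X] := C (1 / 2) * (X + 1) with hs
  have h2 : (C (1 / 2) : ℝ[X]) * 2 = 1 := by
    rw [← map_ofNat C, ← C_mul]; norm_num
  have hX : (X : ℝ[X]) = s + t := by
    rw [hs, ht]; linear_combination (-X : ℝ[X]) * h2
  have hst : s - t = 1 := by rw [hs, ht]; linear_combination h2
  have hS : oneSubSq = -(4 * t * s) := by
    unfold oneSubSq
    rw [hX]
    linear_combination (-(s - t) - 1) * hst
  have dt : derivative t = C (1 / 2) := by simp [ht]
  have ds : derivative s = C (1 / 2) := by simp [hs]
  set a : ℕ → ℝ := fun k => ((n + μ).choose (n - k) : ℝ) * ((n + μ).choose k : ℝ) with ha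
  have hP : jacobiPoly μ n = ∑ k ∈ Finset.range (n + 1), C (a k) * (t ^ k * s ^ (n - k)) := rfl
  have hP1 : jacobiPoly μ (n + 1) = ∑ k ∈ Finset.range (n + 2),
      C (((n + 1 + μ).choose (n + 1 - k) : ℝ) * ((n + 1 + μ).choose k : ℝ))
        * (t ^ k * s ^ (n + 1 - k)) := rfl
  have key := sum_range_shift_pair n
    (fun k => C (((n : ℝ) + μ + 1) * (((n : ℝ) + 2 * μ + 1 + 2 * k) * a k)))
    (fun k => C (((n : ℝ) + μ + 1) * (((n : ℝ) + 2 * μ + 1 + 2 * ((n : ℝ) - k)) * a k)))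
    (fun k => C (((n : ℝ) + 1) * ((n : ℝ) + 2 * μ + 1) *
      (((n + 1 + μ).choose (n + 1 - k) : ℝ) * ((n + 1 + μ).choose k : ℝ)))) t s ?_ ?_ ?_
  · rw [hP1, Finset.mul_sum]
    simp only [← mul_assoc, ← C_mul] at key ⊢
    rw [key, hP, derivative_sum, Finset.mul_sum, Finset.mul_sum, ← Finset.sum_sub_distrib,
      Finset.mul_sum]
    refine Finset.sum_congr rfl fun k hk => ?_
    have hk' : k ≤ n := by have := Finset.mem_range.mp hk; omega
    have d1 : t * derivative (t ^ k) = C (1 / 2) * C (k : ℝ) * t ^ k := by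
      rw [derivative_pow, dt]
      rcases k with _ | k
      · simp
      · simp only [Nat.add_sub_cancel]; ring
    have d2 : s * derivative (s ^ (n - k)) = C (1 / 2) * C ((n : ℝ) - k) * s ^ (n - k) := by
      rw [derivative_pow, ds, ← Nat.cast_sub hk']
      rcases h : n - k with _ | j
      · simp
      · simp only [Nat.add_sub_cancel]; ring
    rw [derivative_mul, derivative_mul, derivative_C, hS, hX]
    simp only [map_add, map_mul, map_sub, map_natCast, map_ofNat, map_one] at d1 d2 h2 ⊢
    have h3 : (C (1 / 2) : ℝ[X]) * 4 = 2 := by linear_combination 2 * h2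
    linear_combination (-4 * ((n : ℝ[X]) + μ + 1)) * C (a k) * s * s ^ (n - k) * d1
      - (4 * ((n : ℝ[X]) + μ + 1)) * C (a k) * t * t ^ k * d2
      - ((n : ℝ[X]) + μ + 1) * C (a k) * s * s ^ (n - k) * (k : ℝ[X]) * t ^ k * h3
      - ((n : ℝ[X]) + μ + 1) * C (a k) * t * t ^ k * ((n : ℝ[X]) - k) * s ^ (n - k) * h3
  · simp only [ha, C_inj, Nat.sub_zero, Nat.choose_zero_right]
    have := Nat.add_one_mul_choose_eq (n + μ) n
    have h' : ((n : ℝ) + μ + 1) * ((n + μ).choose n : ℝ)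
        = ((n + μ + 1).choose (n + 1) : ℝ) * (n + 1) := by exact_mod_cast this
    rw [show n + 1 + μ = n + μ + 1 by ring]
    push_cast
    linear_combination (-((n : ℝ) + 2 * μ + 1)) * h'
  · simp only [ha, C_inj, Nat.sub_self, Nat.choose_zero_right]
    have := Nat.add_one_mul_choose_eq (n + μ) n
    have h' : ((n : ℝ) + μ + 1) * ((n + μ).choose n : ℝ)
        = ((n + μ + 1).choose (n + 1) : ℝ) * (n + 1) := by exact_mod_cast this
    rw [show n + 1 + μ = n + μ + 1 by ring]
    push_cast
    linear_combination (-((n : ℝ) + 2 * μ + 1)) * h'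
  · intro k hk
    rw [← C_add, C_inj]
    have := jacobi_choose_identity μ n k hk
    rw [Nat.add_sub_add_right] at this ⊢
    simp only [ha]
    push_cast
    linear_combination this

/-- The ratio of the Jacobi polynomial and the Gegenbauer polynomial of the same degree. -/
noncomputable def jacobiScale (μ n : ℕ) : ℝ :=
  ∏ k ∈ Finset.range n, ((k : ℝ) + μ + 1) / (((k : ℝ) + 1) * ((k : ℝ) + 2 * μ + 1))

theorem jacobiPoly_eq (μ n : ℕ) : jacobiPoly μ n = C (jacobiScale μ n) * gegen μ n := by
  induction n with
  | zero => simp [jacobiPoly, jacobiScale, gegen]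
  | succ n ih =>
    have h := jacobiPoly_succ μ n
    rw [ih] at h
    simp only [derivative_mul, derivative_C] at h
    have hc : ((n : ℝ) + 1) * ((n : ℝ) + 2 * μ + 1) ≠ 0 := by positivity
    have hs : jacobiScale μ (n + 1) * (((n : ℝ) + 1) * ((n : ℝ) + 2 * μ + 1)) =
        jacobiScale μ n * ((n : ℝ) + μ + 1) := by
      rw [jacobiScale, Finset.prod_range_succ, ← jacobiScale]
      field_simp
    have hs' := congrArg (C : ℝ → ℝ[X]) hs
    refine mul_left_cancel₀ (C_ne_zero.mpr hc) ?_
    rw [h, gegen_succ]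
    rw [map_mul C (jacobiScale μ (n + 1)), map_mul C (jacobiScale μ n)] at hs'
    linear_combination (-(C ((n : ℝ) + 2 * μ + 1) * X * gegen μ n
      - oneSubSq * derivative (gegen μ n))) * hs'

theorem jacobiP_eq (μ n : ℕ) (y : ℝ) :
    jacobiP μ μ n y = jacobiScale μ n * (gegen μ n).eval y := by
  rw [← eval_jacobiPoly, jacobiPoly_eq, eval_mul, eval_C]

end HopfCubicWave

/-! ### Weighted integrals of Gegenbauer polynomials: recursions, orthogonality, sup bounds -/

namespace HopfCubicWave

open Polynomial

/-- Integration of polynomials over `[-1, 1]`. -/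
noncomputable def polyInt : ℝ[X] →ₗ[ℝ] ℝ where
  toFun p := ∫ y in (-1 : ℝ)..1, p.eval y
  map_add' p q := by
    simp only [eval_add]
    exact intervalIntegral.integral_add (p.continuous.intervalIntegrable _ _)
      (q.continuous.intervalIntegrable _ _)
  map_smul' c p := by
    simp only [eval_smul, RingHom.id_apply]
    exact intervalIntegral.integral_smul _ _

theorem polyInt_apply (p : ℝ[X]) : polyInt p = ∫ y in (-1 : ℝ)..1, p.eval y := rfl

theorem polyInt_C_mul (c : ℝ) (p : ℝ[X]) : polyInt (C c * p) = c * polyInt p := by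
  rw [← smul_eq_C_mul, map_smul, smul_eq_mul]

theorem polyInt_mono {p q : ℝ[X]}
    (h : ∀ y ∈ Set.Icc (-1 : ℝ) 1, p.eval y ≤ q.eval y) : polyInt p ≤ polyInt q :=
  intervalIntegral.integral_mono_on (by norm_num) (p.continuous.intervalIntegrable _ _)
    (q.continuous.intervalIntegrable _ _) h

theorem polyInt_nonneg {p : ℝ[X]} (h : ∀ y ∈ Set.Icc (-1 : ℝ) 1, 0 ≤ p.eval y) :
    0 ≤ polyInt p := by
  have := polyInt_mono (p := 0) (q := p) (by simpa using h)
  simpa using this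

theorem polyInt_derivative (p : ℝ[X]) : polyInt (derivative p) = p.eval 1 - p.eval (-1) :=
  intervalIntegral.integral_eq_sub_of_hasDerivAt (fun y _ => p.hasDerivAt y)
    ((derivative p).continuous.intervalIntegrable _ _)

theorem eval_oneSubSq (y : ℝ) : oneSubSq.eval y = 1 - y ^ 2 := by simp [oneSubSq]

theorem eval_oneSubSq_nonneg {y : ℝ} (hy : y ∈ Set.Icc (-1 : ℝ) 1) : 0 ≤ oneSubSq.eval y := by
  rw [eval_oneSubSq]; nlinarith [hy.1, hy.2]

/-- The positive power of 1 - y² kills the boundary terms. Most integral identities below are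
instances of this one. -/
theorem polyInt_derivative_oneSubSq_mul (e : ℕ) (q : ℝ[X]) :
    polyInt (derivative (oneSubSq ^ (e + 1) * q)) = 0 := by
  rw [polyInt_derivative]
  simp [eval_oneSubSq]

theorem derivative_oneSubSq_pow (e : ℕ) :
    derivative (oneSubSq ^ (e + 1)) = C (-(2 * (e : ℝ) + 2)) * (oneSubSq ^ e * X) := by
  rw [derivative_pow, derivative_oneSubSq]
  simp only [Nat.add_sub_cancel, map_add, map_mul, map_neg, map_natCast, map_ofNat, Nat.cast_add,
    Nat.cast_one, map_one]
  ring

theorem X_sq_eq : (X : ℝ[X]) ^ 2 = 1 - oneSubSq := by simp [oneSubSq]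

/-- The integral of `(1 - y²)^e g_n²`. -/
noncomputable def sqInt (μ n e : ℕ) : ℝ := polyInt (oneSubSq ^ e * gegen μ n ^ 2)

/-- The integral of `(1 - y²)^e y g_n g_n'`. -/
noncomputable def crossInt (μ n e : ℕ) : ℝ :=
  polyInt (oneSubSq ^ e * (X * gegen μ n * derivative (gegen μ n)))

/-- The integral of `(1 - y²)^e g_n'²`. -/
noncomputable def derivInt (μ n e : ℕ) : ℝ :=
  polyInt (oneSubSq ^ e * derivative (gegen μ n) ^ 2)

/-- This and the next two relations integrate the derivative of a power of 1 - y² times y g², g g'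
and y g'² respectively, with g'' eliminated by the differential equation. Together they form a
linear system for the three families of integrals. -/
theorem crossInt_succ (μ n e : ℕ) :
    2 * crossInt μ n (e + 1) =
      (2 * (e : ℝ) + 2) * sqInt μ n e - (2 * (e : ℝ) + 3) * sqInt μ n (e + 1) := by
  have h := polyInt_derivative_oneSubSq_mul e (X * gegen μ n ^ 2)
  have h2 : derivative (oneSubSq ^ (e + 1) * (X * gegen μ n ^ 2)) =
      C (-(2 * (e : ℝ) + 2)) * (oneSubSq ^ e * gegen μ n ^ 2)
      + C (2 * (e : ℝ) + 3) * (oneSubSq ^ (e + 1) * gegen μ n ^ 2)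
      + C 2 * (oneSubSq ^ (e + 1) * (X * gegen μ n * derivative (gegen μ n))) := by
    rw [derivative_mul, derivative_oneSubSq_pow]
    simp only [derivative_mul, derivative_X, derivative_pow, pow_succ, map_add, map_mul, map_neg,
      map_natCast, map_ofNat, oneSubSq]
    simp
    ring
  rw [h2, map_add, map_add, polyInt_C_mul, polyInt_C_mul, polyInt_C_mul] at h
  simp only [sqInt, crossInt]
  linarith

theorem derivInt_succ (μ n e : ℕ) :
    derivInt μ n (e + 1) =
      gegenEig μ n * sqInt μ n e + (2 * (e : ℝ) - 2 * μ) * crossInt μ n e := by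
  have h := polyInt_derivative_oneSubSq_mul e (gegen μ n * derivative (gegen μ n))
  have ode := (gegen_ode μ n).1
  have h2 : derivative (oneSubSq ^ (e + 1) * (gegen μ n * derivative (gegen μ n))) =
      C (2 * (μ : ℝ) - 2 * e) * (oneSubSq ^ e * (X * gegen μ n * derivative (gegen μ n)))
      + oneSubSq ^ (e + 1) * derivative (gegen μ n) ^ 2
      - C (gegenEig μ n) * (oneSubSq ^ e * gegen μ n ^ 2) := by
    rw [derivative_mul, derivative_oneSubSq_pow]
    simp only [derivative_mul]
    simp only [map_add, map_mul, map_neg, map_sub, map_one,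
      map_natCast, map_ofNat] at ode ⊢
    linear_combination oneSubSq ^ e * gegen μ n * ode
  rw [h2, map_sub, map_add, polyInt_C_mul, polyInt_C_mul] at h
  simp only [sqInt, crossInt, derivInt]
  linarith

theorem derivInt_succ_succ (μ n e : ℕ) :
    (4 * (μ : ℝ) - 2 * e) * (derivInt μ n (e + 1) - derivInt μ n (e + 2)) + derivInt μ n (e + 2)
      - 2 * gegenEig μ n * crossInt μ n (e + 1) = 0 := by
  have h := polyInt_derivative_oneSubSq_mul (e + 1) (X * derivative (gegen μ n) ^ 2)
  have ode := (gegen_ode μ n).1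
  have h2 : derivative (oneSubSq ^ (e + 1 + 1) * (X * derivative (gegen μ n) ^ 2)) =
      C (4 * (μ : ℝ) - 2 * e) * (oneSubSq ^ (e + 1) * derivative (gegen μ n) ^ 2)
      - C (4 * (μ : ℝ) - 2 * e) * (oneSubSq ^ (e + 2) * derivative (gegen μ n) ^ 2)
      + oneSubSq ^ (e + 2) * derivative (gegen μ n) ^ 2
      - C (2 * gegenEig μ n) *
        (oneSubSq ^ (e + 1) * (X * gegen μ n * derivative (gegen μ n))) := by
    rw [derivative_mul, derivative_oneSubSq_pow, pow_two (derivative (gegen μ n))]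
    simp only [derivative_mul, derivative_X]
    simp only [map_add, map_mul, map_neg, map_sub, map_one,
      map_natCast, map_ofNat, Nat.cast_add, Nat.cast_one] at ode ⊢
    linear_combination 2 * oneSubSq ^ (e + 1) * X * derivative (gegen μ n) * ode
      + (4 * (μ : ℝ[X]) - 2 * e) * oneSubSq ^ (e + 1) * derivative (gegen μ n) ^ 2 * X_sq_eq
  rw [h2, map_sub, map_add, map_sub, polyInt_C_mul, polyInt_C_mul, polyInt_C_mul] at h
  simp only [crossInt, derivInt]
  linarith

theorem sqInt_gegen_succ (μ n e : ℕ) :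
    sqInt μ (n + 1) e = ((n : ℝ) + 2 * μ + 1) ^ 2 * (sqInt μ n e - sqInt μ n (e + 1))
      - 2 * ((n : ℝ) + 2 * μ + 1) * crossInt μ n (e + 1) + derivInt μ n (e + 2) := by
  have h2 : oneSubSq ^ e * gegen μ (n + 1) ^ 2 =
      C (((n : ℝ) + 2 * μ + 1) ^ 2) * (oneSubSq ^ e * gegen μ n ^ 2)
      - C (((n : ℝ) + 2 * μ + 1) ^ 2) * (oneSubSq ^ (e + 1) * gegen μ n ^ 2)
      - C (2 * ((n : ℝ) + 2 * μ + 1)) *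
        (oneSubSq ^ (e + 1) * (X * gegen μ n * derivative (gegen μ n)))
      + oneSubSq ^ (e + 2) * derivative (gegen μ n) ^ 2 := by
    rw [gegen_succ]
    simp only [map_add, map_mul, map_pow, map_one, map_natCast, map_ofNat]
    linear_combination ((n : ℝ[X]) + 2 * μ + 1) ^ 2 * oneSubSq ^ e * gegen μ n ^ 2 * X_sq_eq
  rw [sqInt, h2, map_add, map_sub, map_sub, polyInt_C_mul, polyInt_C_mul, polyInt_C_mul]
  simp only [sqInt, crossInt, derivInt]
  ring

theorem freq_eq (μ n : ℕ) : freq μ μ n = 2 * (n : ℝ) + 2 * μ + 1 := by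
  unfold freq; ring

theorem freq_pos (μ n : ℕ) : 0 < freq μ μ n := by
  rw [freq_eq]; positivity

/-- At the orthogonality weight e = μ the cross term of `derivInt_succ` drops out and the system
closes to a first-order recursion in n. -/
theorem sqInt_norm_succ (μ n : ℕ) :
    freq μ μ (n + 1) * sqInt μ (n + 1) μ =
      ((n : ℝ) + 1) * ((n : ℝ) + 2 * μ + 1) * freq μ μ n * sqInt μ n μ := by
  have h1 := crossInt_succ μ n μ
  have h2 := derivInt_succ μ n μ
  have h3 := derivInt_succ μ n (μ + 1)
  have h4 := derivInt_succ_succ μ n μ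
  have h5 := sqInt_gegen_succ μ n μ
  simp only [freq_eq, gegenEig, Nat.cast_add, Nat.cast_one] at *
  have e0 : derivInt μ n (μ + 1 + 1) = derivInt μ n (μ + 2) := rfl
  rw [e0] at h3
  rw [h5, h3]
  rw [h2, h3] at h4
  linear_combination h4 + (((2 * ((n : ℝ) + 1) + 2 * μ + 1) * (2 - 2 * ((n : ℝ) + 2 * μ + 1))
    - (2 - 4 * μ - 2 * ((n : ℝ) * (n + 2 * μ + 1)))) / 2) * h1

/-- The exponent 2μ is the one occurring in C_{00nn}. There the coefficient 4μ - 2e of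
`derivInt_succ_succ` vanishes, so again a first-order recursion in n results. -/
theorem sqInt_double_succ (μ n : ℕ) :
    (4 * (μ : ℝ) + 2 * n + 3) * sqInt μ (n + 1) (2 * μ) =
      (2 * (n : ℝ) + 1) * ((n : ℝ) + 2 * μ + 1) ^ 2 * sqInt μ n (2 * μ) := by
  have h1 := crossInt_succ μ n (2 * μ)
  have h3 := derivInt_succ μ n (2 * μ + 1)
  have h4 := derivInt_succ_succ μ n (2 * μ)
  have h5 := sqInt_gegen_succ μ n (2 * μ)
  simp only [gegenEig, Nat.cast_add, Nat.cast_one, Nat.cast_mul, Nat.cast_ofNat] at *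
  have e0 : derivInt μ n (2 * μ + 1 + 1) = derivInt μ n (2 * μ + 2) := rfl
  rw [e0] at h3
  rw [h5]
  linear_combination (4 * (μ : ℝ) + 2 * n + 3 - 2 * ((n : ℝ) + 2 * μ + 1)) * h4
    - ((n : ℝ) + 2 * μ + 1) ^ 2 * h1 + 2 * ((n : ℝ) + 2 * μ + 1) * h3

/-- Eliminating the other two families leaves a three-term recurrence in the exponent for fixed n,
in which n enters only through ω_n². -/
theorem sqInt_recurrence (μ n e : ℕ) :
    8 * ((e : ℝ) + 1 - μ) * ((e : ℝ) + 1 - 2 * μ) * ((e : ℝ) + 1) * sqInt μ n e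
      + (2 * (e : ℝ) + 3 - 2 * μ) *
        (freq μ μ n ^ 2 + 4 * (μ : ℝ) ^ 2 - 2 * (2 * (e : ℝ) + 3 - 2 * μ) ^ 2 - 3) *
        sqInt μ n (e + 1) =
    (2 * (e : ℝ) + 4 - 2 * μ) * (freq μ μ n ^ 2 - (2 * (e : ℝ) + 4 - 2 * μ) ^ 2) *
      sqInt μ n (e + 2) := by
  have a1 := crossInt_succ μ n e
  have a2 := crossInt_succ μ n (e + 1)
  have b1 := derivInt_succ μ n (e + 1)
  have b2 := derivInt_succ μ n (e + 2)
  have c1 := derivInt_succ_succ μ n (e + 1)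
  have e0 : e + 1 + 1 = e + 2 := rfl
  have e1 : e + 2 + 1 = e + 3 := rfl
  simp only [freq_eq, gegenEig, Nat.cast_add, Nat.cast_one, Nat.cast_ofNat, e0, e1] at *
  linear_combination (-2) * c1
    + 2 * (4 * (μ : ℝ) - 2 * (e + 1)) * b1 + 2 * (1 - (4 * (μ : ℝ) - 2 * (e + 1))) * b2
    + (4 * (μ : ℝ) - 2 * (e + 1)) * (2 * e + 2 - 2 * μ) * a1
    + ((1 - (4 * (μ : ℝ) - 2 * (e + 1))) * (2 * e + 4 - 2 * μ)
      - 2 * ((n : ℝ) * (n + 2 * μ + 1))) * a2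

/-- This is the preceding recurrence at e = 2μ - 1, where its first term carries a zero coefficient.
It is derived separately because that exponent is negative for μ = 0; it starts the expansions at
exponent 2μ. -/
theorem sqInt_recurrence_zero (μ n : ℕ) :
    (2 * (μ : ℝ) + 1) *
        (freq μ μ n ^ 2 + 4 * (μ : ℝ) ^ 2 - 2 * (2 * (μ : ℝ) + 1) ^ 2 - 3) *
        sqInt μ n (2 * μ) =
    (2 * (μ : ℝ) + 2) * (freq μ μ n ^ 2 - (2 * (μ : ℝ) + 2) ^ 2) *
      sqInt μ n (2 * μ + 1) := by
  have a2 := crossInt_succ μ n (2 * μ)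
  have b2 := derivInt_succ μ n (2 * μ + 1)
  have c1 := derivInt_succ_succ μ n (2 * μ)
  have e0 : 2 * μ + 1 + 1 = 2 * μ + 2 := rfl
  simp only [freq_eq, gegenEig, Nat.cast_add, Nat.cast_one, Nat.cast_mul, Nat.cast_ofNat,
    e0] at *
  linear_combination (-2) * c1 + 2 * b2
    + ((2 * (μ : ℝ) + 2) - 2 * ((n : ℝ) * (n + 2 * μ + 1))) * a2

/-- Green's identity for the Gegenbauer operator: the integrand is the derivative of (1-y²)^(μ+1)
times the Wronskian of g_m and q. -/
theorem polyInt_gegen_mul_derivative (μ m : ℕ) (q : ℝ[X]) :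
    polyInt (oneSubSq ^ μ * gegen μ m * (oneSubSq * derivative (derivative q)
      - C (2 * ((μ : ℝ) + 1)) * X * derivative q + C (gegenEig μ m) * q)) = 0 := by
  have h := polyInt_derivative_oneSubSq_mul μ
    (gegen μ m * derivative q - derivative (gegen μ m) * q)
  rw [← h]
  congr 1
  have ode := (gegen_ode μ m).1
  rw [derivative_mul, derivative_oneSubSq_pow]
  simp only [derivative_mul, derivative_sub]
  simp only [map_add, map_mul, map_neg, map_one, map_natCast, map_ofNat] at ode ⊢
  linear_combination oneSubSq ^ μ * q * ode

theorem gegenEig_strictMono (μ : ℕ) : StrictMono (gegenEig μ) := by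
  refine strictMono_nat_of_lt_succ fun n => ?_
  unfold gegenEig
  push_cast
  nlinarith [(Nat.cast_nonneg n : (0 : ℝ) ≤ n), (Nat.cast_nonneg μ : (0 : ℝ) ≤ μ)]

/-- On X^k the shifted operator is triangular: it gives a nonzero multiple of X^k, as the
eigenvalues are distinct, plus a multiple of X^(k-2) covered by induction. -/
theorem polyInt_gegen_mul_X_pow (μ m k : ℕ) (hk : k < m) :
    polyInt (oneSubSq ^ μ * gegen μ m * X ^ k) = 0 := by
  induction k using Nat.strong_induction_on with
  | _ k ih =>
    have hne : gegenEig μ m - gegenEig μ k ≠ 0 :=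
      sub_ne_zero.mpr (gegenEig_strictMono μ hk).ne'
    have h := polyInt_gegen_mul_derivative μ m (X ^ k)
    have h2 : oneSubSq ^ μ * gegen μ m * (oneSubSq * derivative (derivative (X ^ k))
        - C (2 * ((μ : ℝ) + 1)) * X * derivative (X ^ k) + C (gegenEig μ m) * X ^ k) =
        C (gegenEig μ m - gegenEig μ k) * (oneSubSq ^ μ * gegen μ m * X ^ k)
        + C ((k : ℝ) * (k - 1)) * (oneSubSq ^ μ * gegen μ m * X ^ (k - 2)) := by
      rcases k with _ | _ | k
      · simp [gegenEig]
        ring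
      · simp only [derivative_X, zero_add, pow_one, derivative_one, gegenEig,
          map_add, map_mul, map_sub, map_one, map_natCast, map_ofNat, Nat.cast_one]
        simp
        ring
      · simp only [derivative_X_pow, derivative_mul, derivative_C, Nat.add_sub_cancel,
          show k + 1 + 1 - 2 = k by omega, show k + 1 + 1 - 1 = k + 1 by omega, gegenEig,
          oneSubSq]
        simp only [map_add, map_mul, map_sub, map_one, map_natCast, map_ofNat, Nat.cast_add,
          Nat.cast_one]
        ring
    rw [h2, map_add, polyInt_C_mul, polyInt_C_mul] at h
    -- For k < 2 the truncated exponent is harmless because the coefficient k(k-1) is zero.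
    have h3 : (k : ℝ) * (k - 1) * polyInt (oneSubSq ^ μ * gegen μ m * X ^ (k - 2)) = 0 := by
      rcases k with _ | _ | k
      · simp
      · simp
      · rw [ih (k + 1 + 1 - 2) (by omega) (by omega), mul_zero]
    rw [h3, add_zero] at h
    exact (mul_eq_zero.mp h).resolve_left hne

theorem polyInt_gegen_mul_eq_zero (μ m : ℕ) (q : ℝ[X]) (hq : q.natDegree < m) :
    polyInt (oneSubSq ^ μ * gegen μ m * q) = 0 := by
  rw [q.as_sum_range_C_mul_X_pow, Finset.mul_sum, map_sum]
  refine Finset.sum_eq_zero fun k hk => ?_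
  have hk' := Finset.mem_range.mp hk
  rw [show oneSubSq ^ μ * gegen μ m * (C (q.coeff k) * X ^ k) =
    C (q.coeff k) * (oneSubSq ^ μ * gegen μ m * X ^ k) by ring, polyInt_C_mul,
    polyInt_gegen_mul_X_pow μ m k (by omega), mul_zero]

/-- One-dimensional Sobolev estimate: p(y) ≤ p(x) + ∫|p'|, averaged over x in [-1, 1]. -/
theorem eval_le_of_abs_derivative_le (p q : ℝ[X])
    (h : ∀ y ∈ Set.Icc (-1 : ℝ) 1, |(derivative p).eval y| ≤ q.eval y)
    {y : ℝ} (hy : y ∈ Set.Icc (-1 : ℝ) 1) : 2 * p.eval y ≤ polyInt p + 2 * polyInt q := by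
  have key : ∀ x ∈ Set.Icc (-1 : ℝ) 1, p.eval y ≤ p.eval x + polyInt q := by
    intro x hx
    have h1 : ∫ u in x..y, (derivative p).eval u = p.eval y - p.eval x :=
      intervalIntegral.integral_eq_sub_of_hasDerivAt (fun y _ => p.hasDerivAt y)
        ((derivative p).continuous.intervalIntegrable _ _)
    have h2 : |∫ u in x..y, (derivative p).eval u| ≤
        |∫ u in x..y, abs ((derivative p).eval u)| :=
      intervalIntegral.norm_integral_le_abs_integral_norm
        (f := fun u => (derivative p).eval u) (μ := MeasureTheory.volume) (a := x) (b := y)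
    have h3 : |∫ u in x..y, abs ((derivative p).eval u)| ≤
        |∫ u in (-1 : ℝ)..1, abs ((derivative p).eval u)| := by
      refine intervalIntegral.abs_integral_mono_interval ?_ ?_ ?_
      · rw [Set.uIoc_of_le (by norm_num : (-1 : ℝ) ≤ 1)]
        intro u hu
        rcases le_total x y with hxy | hxy
        · rw [Set.uIoc_of_le hxy] at hu
          exact ⟨lt_of_le_of_lt hx.1 hu.1, hu.2.trans hy.2⟩
        · rw [Set.uIoc_of_ge hxy] at hu
          exact ⟨lt_of_le_of_lt hy.1 hu.1, hu.2.trans hx.2⟩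
      · exact Filter.Eventually.of_forall fun _ => abs_nonneg _
      · exact ((derivative p).continuous.abs).intervalIntegrable _ _
    have h4 : ∫ u in (-1 : ℝ)..1, abs ((derivative p).eval u) ≤ polyInt q :=
      intervalIntegral.integral_mono_on (by norm_num)
        (((derivative p).continuous.abs).intervalIntegrable _ _)
        (q.continuous.intervalIntegrable _ _) h
    have h5 : 0 ≤ ∫ u in (-1 : ℝ)..1, abs ((derivative p).eval u) :=
      intervalIntegral.integral_nonneg (by norm_num) fun _ _ => abs_nonneg _
    rw [abs_of_nonneg h5] at h3
    have := le_abs_self (∫ u in x..y, (derivative p).eval u)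
    linarith
  have h6 := polyInt_mono (p := C (p.eval y)) (q := p + C (polyInt q)) (fun x hx => by
    simpa using key x hx)
  have h7 : ∀ c : ℝ, polyInt (C c) = 2 * c := by
    intro c
    rw [polyInt_apply]
    simp
    norm_num
  rw [map_add, h7, h7] at h6
  exact h6

theorem sqInt_nonneg (μ n e : ℕ) : 0 ≤ sqInt μ n e :=
  polyInt_nonneg fun y hy => by
    rw [eval_mul, eval_pow, eval_pow]
    have := eval_oneSubSq_nonneg hy
    positivity

/-- A Hardy-type inequality that controls the loss of one power of the weight. It expands the
nonnegative integral of (1-y²)^μ ((1-y²)g' - (μ+1)yg)² with parameter μ + 1. -/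
theorem sqInt_pred_le (μ n : ℕ) :
    ((μ : ℝ) + 1) ^ 2 * sqInt (μ + 1) n μ ≤
      (gegenEig (μ + 1) n + ((μ : ℝ) + 1) ^ 2 + (μ + 1)) * sqInt (μ + 1) n (μ + 1) := by
  have h1 := crossInt_succ (μ + 1) n μ
  have h2 := derivInt_succ (μ + 1) n (μ + 1)
  have h3 : 0 ≤ polyInt (oneSubSq ^ μ * (oneSubSq * derivative (gegen (μ + 1) n)
      - C ((μ : ℝ) + 1) * X * gegen (μ + 1) n) ^ 2) := by
    refine polyInt_nonneg fun y hy => ?_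
    rw [eval_mul, eval_pow, eval_pow]
    have := eval_oneSubSq_nonneg hy
    positivity
  have h4 : oneSubSq ^ μ * (oneSubSq * derivative (gegen (μ + 1) n)
      - C ((μ : ℝ) + 1) * X * gegen (μ + 1) n) ^ 2 =
      oneSubSq ^ (μ + 2) * derivative (gegen (μ + 1) n) ^ 2
      - C (2 * ((μ : ℝ) + 1)) *
        (oneSubSq ^ (μ + 1) * (X * gegen (μ + 1) n * derivative (gegen (μ + 1) n)))
      + C (((μ : ℝ) + 1) ^ 2) * (oneSubSq ^ μ * gegen (μ + 1) n ^ 2)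
      - C (((μ : ℝ) + 1) ^ 2) * (oneSubSq ^ (μ + 1) * gegen (μ + 1) n ^ 2) := by
    simp only [map_add, map_mul, map_pow, map_one, map_natCast, map_ofNat]
    linear_combination ((μ : ℝ[X]) + 1) ^ 2 * oneSubSq ^ μ * gegen (μ + 1) n ^ 2 * X_sq_eq
  rw [h4, map_sub, map_add, map_sub, polyInt_C_mul, polyInt_C_mul, polyInt_C_mul] at h3
  have h3' : 0 ≤ derivInt (μ + 1) n (μ + 2)
      - 2 * ((μ : ℝ) + 1) * crossInt (μ + 1) n (μ + 1)
      + ((μ : ℝ) + 1) ^ 2 * sqInt (μ + 1) n μ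
      - ((μ : ℝ) + 1) ^ 2 * sqInt (μ + 1) n (μ + 1) := h3
  have e0 : μ + 1 + 1 = μ + 2 := rfl
  rw [e0] at h2
  rw [h2] at h3'
  push_cast at *
  have h5 : crossInt (μ + 1) n (μ + 1) = ((2 * (μ : ℝ) + 2) * sqInt (μ + 1) n μ
    - (2 * (μ : ℝ) + 3) * sqInt (μ + 1) n (μ + 1)) / 2 := by linarith
  rw [h5] at h3'
  nlinarith

theorem gegenEig_le (μ n : ℕ) : gegenEig μ n ≤ (2 * (μ : ℝ) + 1) * (1 + (n : ℝ)) ^ 2 := by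
  unfold gegenEig
  nlinarith [(Nat.cast_nonneg n : (0 : ℝ) ≤ n), (Nat.cast_nonneg μ : (0 : ℝ) ≤ μ),
    mul_nonneg (Nat.cast_nonneg n : (0 : ℝ) ≤ n) (Nat.cast_nonneg μ : (0 : ℝ) ≤ μ),
    mul_nonneg (mul_nonneg (Nat.cast_nonneg n : (0 : ℝ) ≤ n) (Nat.cast_nonneg n : (0 : ℝ) ≤ n))
      (Nat.cast_nonneg μ : (0 : ℝ) ≤ μ)]

/-- For μ = 0 no weight is available to absorb g'. Integrating the derivative of (1-y²) y g'² bounds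
∫g'² by 2ν∫y g g', with ν the eigenvalue, and the square of g' - 2νyg absorbs the cross term. -/
theorem derivInt_legendre_le (n : ℕ) :
    derivInt 0 n 0 ≤ 4 * gegenEig 0 n ^ 2 * sqInt 0 n 0 := by
  have ode := (gegen_ode 0 n).1
  have h := polyInt_derivative_oneSubSq_mul 0 (X * derivative (gegen 0 n) ^ 2)
  have h2 : derivative (oneSubSq ^ (0 + 1) * (X * derivative (gegen 0 n) ^ 2)) =
      derivative (gegen 0 n) ^ 2 + X ^ 2 * derivative (gegen 0 n) ^ 2
      - C (2 * gegenEig 0 n) * (X * gegen 0 n * derivative (gegen 0 n)) := by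
    rw [derivative_mul, derivative_oneSubSq_pow, pow_two (derivative (gegen 0 n))]
    simp only [derivative_mul, derivative_X]
    simp only [map_add, map_mul, map_neg, map_one, map_zero,
      map_ofNat, Nat.cast_zero] at ode ⊢
    linear_combination 2 * X * derivative (gegen 0 n) * ode
      + derivative (gegen 0 n) ^ 2 * X_sq_eq
  rw [h2, map_sub, map_add, polyInt_C_mul] at h
  have h3 : 0 ≤ polyInt (X ^ 2 * derivative (gegen 0 n) ^ 2) :=
    polyInt_nonneg fun y _ => by
      rw [eval_mul, eval_pow, eval_pow]; positivity
  have h4 : 0 ≤ polyInt ((derivative (gegen 0 n) - C (2 * gegenEig 0 n) * X * gegen 0 n) ^ 2) :=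
    polyInt_nonneg fun y _ => by rw [eval_pow]; positivity
  have h5 : (derivative (gegen 0 n) - C (2 * gegenEig 0 n) * X * gegen 0 n) ^ 2 =
      derivative (gegen 0 n) ^ 2
      - C (4 * gegenEig 0 n) * (X * gegen 0 n * derivative (gegen 0 n))
      + C (4 * gegenEig 0 n ^ 2) * (X ^ 2 * gegen 0 n ^ 2) := by
    simp only [map_mul, map_pow, map_ofNat]
    ring
  rw [h5, map_add, map_sub, polyInt_C_mul, polyInt_C_mul] at h4
  have h6 : polyInt (X ^ 2 * gegen 0 n ^ 2) ≤ sqInt 0 n 0 := by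
    refine polyInt_mono fun y hy => ?_
    simp only [eval_mul, eval_pow, eval_X, pow_zero, eval_one]
    have : y ^ 2 ≤ 1 := by nlinarith [hy.1, hy.2]
    exact mul_le_mul_of_nonneg_right this (sq_nonneg _)
  have h7 : derivInt 0 n 0 = polyInt (derivative (gegen 0 n) ^ 2) := by simp [derivInt]
  rw [h7]
  have h8 := mul_le_mul_of_nonneg_left h6 (by positivity : 0 ≤ 4 * gegenEig 0 n ^ 2)
  linarith

/-- Applies the Sobolev estimate to (1-y²)^μ g_n². The growth (1+n)² yields eigenfunctions of size
O(1+n). -/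
theorem exists_sup_bound (μ : ℕ) :
    ∃ K : ℝ, 0 ≤ K ∧ ∀ (n : ℕ) (y : ℝ), y ∈ Set.Icc (-1 : ℝ) 1 →
      (oneSubSq ^ μ * gegen μ n ^ 2).eval y ≤ K * (1 + (n : ℝ)) ^ 2 * sqInt μ n μ := by
  rcases μ with _ | μ
  · refine ⟨6, by norm_num, fun n y hy => ?_⟩
    have hd : derivative (oneSubSq ^ 0 * gegen 0 n ^ 2) =
        C 2 * (gegen 0 n * derivative (gegen 0 n)) := by
      rw [pow_zero, one_mul, derivative_pow]
      simp
      ring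
    have hn : (0 : ℝ) < (1 + (n : ℝ)) ^ 2 := by positivity
    have h := eval_le_of_abs_derivative_le (oneSubSq ^ 0 * gegen 0 n ^ 2)
      -- The weight (1+n)² in 2|ab| ≤ ca² + b²/c balances the two terms, because the L² norm of g'
      -- is bounded by a multiple of (1+n)² times that of g.
      (C ((1 + (n : ℝ)) ^ 2) * gegen 0 n ^ 2
        + C (((1 + (n : ℝ)) ^ 2)⁻¹) * derivative (gegen 0 n) ^ 2) (fun x _ => by
          rw [hd]
          simp only [eval_mul, eval_add, eval_C, eval_pow]
          generalize (gegen 0 n).eval x = a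
          generalize (derivative (gegen 0 n)).eval x = b
          generalize (1 + (n : ℝ)) ^ 2 = c at hn
          rw [abs_le]
          have e1 : c * a ^ 2 + c⁻¹ * b ^ 2 - 2 * (a * b) = c⁻¹ * (c * a - b) ^ 2 := by
            field_simp; ring
          have e2 : c * a ^ 2 + c⁻¹ * b ^ 2 + 2 * (a * b) = c⁻¹ * (c * a + b) ^ 2 := by
            field_simp; ring
          have p1 : 0 ≤ c⁻¹ * (c * a - b) ^ 2 := by positivity
          have p2 : 0 ≤ c⁻¹ * (c * a + b) ^ 2 := by positivity
          constructor <;> linarith) hy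
    rw [map_add, polyInt_C_mul, polyInt_C_mul] at h
    have e1 : polyInt (gegen 0 n ^ 2) = sqInt 0 n 0 := by simp [sqInt]
    have e2 : polyInt (oneSubSq ^ 0 * gegen 0 n ^ 2) = sqInt 0 n 0 := rfl
    have e3 : polyInt (derivative (gegen 0 n) ^ 2) = derivInt 0 n 0 := by simp [derivInt]
    rw [e1, e2, e3] at h
    have h1 := derivInt_legendre_le n
    have h2 := gegenEig_le 0 n
    have h3 := sqInt_nonneg 0 n 0
    have h4 : 0 ≤ gegenEig 0 n := by unfold gegenEig; positivity
    norm_num at h2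
    have h5 : gegenEig 0 n ^ 2 ≤ ((1 + (n : ℝ)) ^ 2) ^ 2 := pow_le_pow_left₀ h4 h2 2
    have h6 : ((1 + (n : ℝ)) ^ 2)⁻¹ * derivInt 0 n 0 ≤ 4 * (1 + (n : ℝ)) ^ 2 * sqInt 0 n 0 := by
      rw [inv_mul_le_iff₀ hn]
      calc _ ≤ _ := h1
        _ ≤ 4 * ((1 + (n : ℝ)) ^ 2) ^ 2 * sqInt 0 n 0 := by gcongr
        _ = _ := by ring
    have h7 : sqInt 0 n 0 ≤ (1 + (n : ℝ)) ^ 2 * sqInt 0 n 0 := by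
      have : (1 : ℝ) ≤ (1 + (n : ℝ)) ^ 2 := by nlinarith [(Nat.cast_nonneg n : (0 : ℝ) ≤ n)]
      exact le_mul_of_one_le_left h3 this
    have h8 : 0 ≤ (1 + (n : ℝ)) ^ 2 * sqInt 0 n 0 := by positivity
    linarith
  · set A : ℝ := (2 * (μ : ℝ) + 3) + (μ + 1) ^ 2 + (μ + 1) with hA
    have hA0 : 0 ≤ A := by positivity
    refine ⟨1 + (2 * (μ : ℝ) + 3) * (A + 1), by positivity, fun n y hy => ?_⟩
    have hd : derivative (oneSubSq ^ (μ + 1) * gegen (μ + 1) n ^ 2) =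
        oneSubSq ^ μ * (C 2 * (oneSubSq * gegen (μ + 1) n * derivative (gegen (μ + 1) n))
          - C (2 * (μ : ℝ) + 2) * (X * gegen (μ + 1) n ^ 2)) := by
      rw [derivative_mul, derivative_oneSubSq_pow, pow_two (gegen (μ + 1) n), derivative_mul]
      simp only [map_add, map_mul, map_neg, map_natCast, map_ofNat]
      ring
    have h := eval_le_of_abs_derivative_le (oneSubSq ^ (μ + 1) * gegen (μ + 1) n ^ 2)
      (C (2 * (μ : ℝ) + 3) * (oneSubSq ^ μ * gegen (μ + 1) n ^ 2)
        + oneSubSq ^ (μ + 2) * derivative (gegen (μ + 1) n) ^ 2) (fun x hx => by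
          rw [hd]
          have hS := eval_oneSubSq_nonneg hx
          simp only [eval_mul, eval_add, eval_sub, eval_C, eval_pow, eval_X]
          generalize (gegen (μ + 1) n).eval x = a
          generalize (derivative (gegen (μ + 1) n)).eval x = b
          generalize oneSubSq.eval x = c at hS
          rw [abs_mul, abs_of_nonneg (pow_nonneg hS μ),
            show (2 * (μ : ℝ) + 3) * (c ^ μ * a ^ 2) + c ^ (μ + 2) * b ^ 2 =
              c ^ μ * ((2 * (μ : ℝ) + 3) * a ^ 2 + (c * b) ^ 2) by ring]
          refine mul_le_mul_of_nonneg_left ?_ (pow_nonneg hS μ)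
          -- Here 2|abc| ≤ a² + (cb)² and |x| ≤ 1, so the coefficient of a² is 1 + (2μ+2).
          have p1 : 0 ≤ (c * b - a) ^ 2 := sq_nonneg _
          have p2 : 0 ≤ (c * b + a) ^ 2 := sq_nonneg _
          have p3 : 0 ≤ (2 * (μ : ℝ) + 2) * (a ^ 2 * (1 - x)) :=
            mul_nonneg (by positivity) (mul_nonneg (sq_nonneg _) (by linarith [hx.2]))
          have p4 : 0 ≤ (2 * (μ : ℝ) + 2) * (a ^ 2 * (1 + x)) :=
            mul_nonneg (by positivity) (mul_nonneg (sq_nonneg _) (by linarith [hx.1]))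
          rw [abs_le]
          constructor <;> linarith) hy
    rw [map_add, polyInt_C_mul] at h
    -- The exponent matches the parameter μ + 1, so the cross term vanishes and the derivative
    -- integral is exactly the eigenvalue times the squared norm.
    have hz := derivInt_succ (μ + 1) n (μ + 1)
    rw [sub_self, zero_mul, add_zero] at hz
    have h' : 2 * (oneSubSq ^ (μ + 1) * gegen (μ + 1) n ^ 2).eval y ≤
        sqInt (μ + 1) n (μ + 1) + 2 * ((2 * (μ : ℝ) + 3) * sqInt (μ + 1) n μ
          + derivInt (μ + 1) n (μ + 1 + 1)) := h
    rw [hz] at h'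
    have h1 := sqInt_pred_le μ n
    have h2 := gegenEig_le (μ + 1) n
    have hw := sqInt_nonneg (μ + 1) n (μ + 1)
    have hw0 := sqInt_nonneg (μ + 1) n μ
    push_cast at h2
    have hN : (1 : ℝ) ≤ (1 + (n : ℝ)) ^ 2 := by nlinarith [(Nat.cast_nonneg n : (0 : ℝ) ≤ n)]
    generalize (1 + (n : ℝ)) ^ 2 = N at *
    generalize sqInt (μ + 1) n (μ + 1) = w at *
    generalize sqInt (μ + 1) n μ = w0 at *
    generalize gegenEig (μ + 1) n = ν at *
    have hμ : (0 : ℝ) ≤ μ := Nat.cast_nonneg μ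
    have h3 : w0 ≤ A * N * w := by
      have e1 : w0 ≤ ((μ : ℝ) + 1) ^ 2 * w0 := le_mul_of_one_le_left hw0 (by nlinarith)
      have e2 : ν + ((μ : ℝ) + 1) ^ 2 + (μ + 1) ≤ A * N := by
        rw [hA]; nlinarith [mul_nonneg hμ hμ, mul_nonneg hμ (by linarith : 0 ≤ N - 1),
          mul_nonneg (mul_nonneg hμ hμ) (by linarith : 0 ≤ N - 1)]
      exact e1.trans (h1.trans (mul_le_mul_of_nonneg_right e2 hw))
    have h4 : ν * w ≤ (2 * (μ : ℝ) + 3) * N * w := mul_le_mul_of_nonneg_right (by linarith) hw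
    have h5 : w ≤ N * w := le_mul_of_one_le_left hw hN
    have h6 := mul_le_mul_of_nonneg_left h3 (by positivity : (0 : ℝ) ≤ 2 * (μ : ℝ) + 3)
    have h7 : 0 ≤ N * w := by positivity
    linarith

end HopfCubicWave

/-! ### Eigenfunctions and Fourier coefficients -/

namespace HopfCubicWave

open Polynomial

theorem integral_cos_two_mul_sin_two (F : ℝ → ℝ) (hF : Continuous F) :
    ∫ x in (0 : ℝ)..(Real.pi / 2), F (Real.cos (2 * x)) * Real.sin (2 * x) =
      (1 / 2) * ∫ y in (-1 : ℝ)..1, F y := by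
  have h := intervalIntegral.integral_comp_mul_deriv (a := 0) (b := Real.pi / 2)
    (f := fun x => Real.cos (2 * x)) (f' := fun x => -Real.sin (2 * x) * 2) (g := F)
    (fun x _ => by
      have h1 : HasDerivAt (fun x : ℝ => 2 * x) 2 x := by
        simpa using (hasDerivAt_id x).const_mul 2
      exact (Real.hasDerivAt_cos (2 * x)).comp x h1)
    (by fun_prop) hF
  have e1 : Real.cos (2 * (Real.pi / 2)) = -1 := by
    rw [show 2 * (Real.pi / 2) = Real.pi by ring, Real.cos_pi]
  simp only [Function.comp_def, mul_zero, Real.cos_zero, e1] at h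
  rw [intervalIntegral.integral_symm (-1 : ℝ) 1] at h
  rw [← neg_eq_iff_eq_neg] at h
  rw [← h, ← intervalIntegral.integral_neg, ← intervalIntegral.integral_const_mul]
  refine intervalIntegral.integral_congr fun x _ => ?_
  ring

/-- The normalization constant relative to the Gegenbauer polynomial. -/
noncomputable def gegenNorm (μ n : ℕ) : ℝ := normConst μ μ n * jacobiScale μ n

/-- The square root of the weight. -/
noncomputable def sqrtWeight (μ : ℕ) (x : ℝ) : ℝ :=
  (1 - Real.cos (2 * x)) ^ ((μ : ℝ) / 2) * (1 + Real.cos (2 * x)) ^ ((μ : ℝ) / 2)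

theorem sqrtWeight_sq (μ : ℕ) (x : ℝ) :
    sqrtWeight μ x ^ 2 = (oneSubSq ^ μ).eval (Real.cos (2 * x)) := by
  have h1 : 0 ≤ 1 - Real.cos (2 * x) := by linarith [Real.cos_le_one (2 * x)]
  have h2 : 0 ≤ 1 + Real.cos (2 * x) := by linarith [Real.neg_one_le_cos (2 * x)]
  unfold sqrtWeight
  rw [mul_pow, ← Real.rpow_mul_natCast h1, ← Real.rpow_mul_natCast h2]
  have : (μ : ℝ) / 2 * ((2 : ℕ) : ℝ) = μ := by push_cast; ring
  rw [this, Real.rpow_natCast, Real.rpow_natCast, ← mul_pow, eval_pow, eval_oneSubSq]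
  ring

theorem eigenfn_eq (μ n : ℕ) (x : ℝ) :
    eigenfn μ μ n x =
      gegenNorm μ n * sqrtWeight μ x * (gegen μ n).eval (Real.cos (2 * x)) := by
  rw [eigenfn, jacobiP_eq, gegenNorm, sqrtWeight]
  ring

theorem eigenfn_mul_eigenfn (μ i j : ℕ) (x : ℝ) :
    eigenfn μ μ i x * eigenfn μ μ j x = gegenNorm μ i * gegenNorm μ j *
      (oneSubSq ^ μ * gegen μ i * gegen μ j).eval (Real.cos (2 * x)) := by
  rw [eigenfn_eq, eigenfn_eq, eval_mul, eval_mul, ← sqrtWeight_sq]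
  ring

theorem fourierC_eq (μ i j k m : ℕ) :
    fourierC μ μ i j k m = 1 / 2 *
      (gegenNorm μ i * gegenNorm μ j * gegenNorm μ k * gegenNorm μ m) *
      polyInt (oneSubSq ^ (2 * μ) * (gegen μ i * gegen μ j * gegen μ k * gegen μ m)) := by
  have h := integral_cos_two_mul_sin_two
    (fun y => (C (gegenNorm μ i * gegenNorm μ j * gegenNorm μ k * gegenNorm μ m) *
      (oneSubSq ^ (2 * μ) * (gegen μ i * gegen μ j * gegen μ k * gegen μ m))).eval y)
    (Polynomial.continuous _)
  rw [← polyInt_apply, polyInt_C_mul] at h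
  rw [fourierC, mul_assoc (1 / 2), ← h]
  refine intervalIntegral.integral_congr fun x _ => ?_
  have e1 := eigenfn_mul_eigenfn μ i j x
  have e2 := eigenfn_mul_eigenfn μ k m x
  simp only [eval_mul, eval_C, eval_pow] at e1 e2 ⊢
  rw [e1, mul_assoc (gegenNorm μ i * gegenNorm μ j * _), e2]
  ring

theorem gegenNorm_pos (μ n : ℕ) : 0 < gegenNorm μ n := by
  unfold gegenNorm normConst jacobiScale
  have := freq_pos μ n
  refine mul_pos (Real.sqrt_pos.mpr (by positivity)) (Finset.prod_pos fun k _ => by positivity)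

theorem gegenNorm_sq_succ (μ n : ℕ) :
    ((n : ℝ) + 1) * ((n : ℝ) + 2 * μ + 1) * freq μ μ n * gegenNorm μ (n + 1) ^ 2 =
      freq μ μ (n + 1) * gegenNorm μ n ^ 2 := by
  have hf := freq_pos μ n
  have hf1 := freq_pos μ (n + 1)
  have e : ∀ n, normConst μ μ n ^ 2 = freq μ μ n / 2 ^ (μ + μ)
    * (((n.factorial : ℝ) * ((n + μ + μ).factorial : ℝ))
      / (((n + μ).factorial : ℝ) * ((n + μ).factorial : ℝ))) := by
    intro n
    have := freq_pos μ n
    exact Real.sq_sqrt (by positivity)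
  have e2 : jacobiScale μ (n + 1) = jacobiScale μ n *
      (((n : ℝ) + μ + 1) / (((n : ℝ) + 1) * ((n : ℝ) + 2 * μ + 1))) := by
    rw [jacobiScale, Finset.prod_range_succ, ← jacobiScale]
  rw [gegenNorm, gegenNorm, mul_pow, mul_pow, e, e, e2,
    show n + 1 + μ + μ = (n + μ + μ) + 1 by ring, show n + 1 + μ = (n + μ) + 1 by ring,
    Nat.factorial_succ, Nat.factorial_succ, Nat.factorial_succ]
  push_cast
  have p1 : (0 : ℝ) < (n.factorial : ℝ) := by positivity
  have p2 : (0 : ℝ) < ((n + μ).factorial : ℝ) := by positivity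
  have p3 : (0 : ℝ) < ((n + μ + μ).factorial : ℝ) := by positivity
  have p4 : (0 : ℝ) < (n : ℝ) + 2 * μ + 1 := by positivity
  have p5 : (0 : ℝ) < (n : ℝ) + μ + 1 := by positivity
  field_simp
  ring

/-- The recursions of `gegenNorm_sq_succ` and `sqInt_norm_succ` are reciprocal. Independence of n is
what the bounds require; the value of the constant plays no role. -/
theorem gegenNorm_sq_mul_sqInt (μ n : ℕ) :
    gegenNorm μ n ^ 2 * sqInt μ n μ = gegenNorm μ 0 ^ 2 * sqInt μ 0 μ := by
  induction n with
  | zero => rfl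
  | succ n ih =>
    rw [← ih]
    have h1 := gegenNorm_sq_succ μ n
    have h2 := sqInt_norm_succ μ n
    have hf := freq_pos μ n
    have hf1 := freq_pos μ (n + 1)
    have hc : ((n : ℝ) + 1) * ((n : ℝ) + 2 * μ + 1) * freq μ μ n * freq μ μ (n + 1) ≠ 0 := by
      positivity
    apply mul_left_cancel₀ hc
    linear_combination freq μ μ (n + 1) * sqInt μ (n + 1) μ * h1
      + freq μ μ (n + 1) * gegenNorm μ n ^ 2 * h2

/-- One factor (1-y²)^μ serves as the orthogonality weight for g_m; the other is a polynomial of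
degree 2μ, which explains the shift in the threshold. -/
theorem fourierC_eq_zero (μ i j k m : ℕ) (h : i + j + k + 2 * μ < m) :
    fourierC μ μ i j k m = 0 := by
  rw [fourierC_eq]
  have e : oneSubSq ^ (2 * μ) * (gegen μ i * gegen μ j * gegen μ k * gegen μ m) =
      oneSubSq ^ μ * gegen μ m * (oneSubSq ^ μ * gegen μ i * gegen μ j * gegen μ k) := by
    ring
  rw [e, polyInt_gegen_mul_eq_zero, mul_zero]
  refine lt_of_le_of_lt ?_ h
  have h1 : oneSubSq.natDegree ≤ 2 := by
    unfold oneSubSq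
    compute_degree
  have h2 : (oneSubSq ^ μ).natDegree ≤ μ * 2 :=
    natDegree_pow_le.trans (Nat.mul_le_mul_left _ h1)
  have h3 := gegen_natDegree_le μ i
  have h4 := gegen_natDegree_le μ j
  have h5 := gegen_natDegree_le μ k
  have h6 := natDegree_mul_le (p := oneSubSq ^ μ * gegen μ i * gegen μ j) (q := gegen μ k)
  have h7 := natDegree_mul_le (p := oneSubSq ^ μ * gegen μ i) (q := gegen μ j)
  have h8 := natDegree_mul_le (p := oneSubSq ^ μ) (q := gegen μ i)
  omega

theorem fourierC_swap12 (μ i j k m : ℕ) : fourierC μ μ i j k m = fourierC μ μ j i k m := by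
  simp only [fourierC_eq, mul_comm (gegenNorm μ i), mul_comm (gegen μ i)]

theorem fourierC_swap23 (μ i j k m : ℕ) : fourierC μ μ i j k m = fourierC μ μ i k j m := by
  simp only [fourierC_eq, mul_right_comm _ (gegenNorm μ j), mul_right_comm _ (gegen μ j)]

theorem fourierC_swap34 (μ i j k m : ℕ) : fourierC μ μ i j k m = fourierC μ μ i j m k := by
  simp only [fourierC_eq, mul_right_comm _ (gegenNorm μ k), mul_right_comm _ (gegen μ k)]

theorem cos_mem_Icc (t : ℝ) : Real.cos t ∈ Set.Icc (-1 : ℝ) 1 :=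
  ⟨Real.neg_one_le_cos t, Real.cos_le_one t⟩

theorem exists_eigenfn_bound (μ : ℕ) :
    ∃ K : ℝ, 0 ≤ K ∧ ∀ (n : ℕ) (x : ℝ), |eigenfn μ μ n x| ≤ K * (1 + (n : ℝ)) := by
  obtain ⟨K, hK, h⟩ := exists_sup_bound μ
  set c := gegenNorm μ 0 ^ 2 * sqInt μ 0 μ with hc
  have hc0 : 0 ≤ c := mul_nonneg (sq_nonneg _) (sqInt_nonneg _ _ _)
  refine ⟨Real.sqrt (K * c), Real.sqrt_nonneg _, fun n x => ?_⟩
  refine abs_le_of_sq_le_sq ?_ (by positivity)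
  rw [mul_pow, Real.sq_sqrt (by positivity), pow_two (eigenfn μ μ n x), eigenfn_mul_eigenfn,
    hc, ← gegenNorm_sq_mul_sqInt μ n]
  have h1 := mul_le_mul_of_nonneg_left (h n _ (cos_mem_Icc (2 * x)))
    (sq_nonneg (gegenNorm μ n))
  rw [show oneSubSq ^ μ * gegen μ n ^ 2 = oneSubSq ^ μ * gegen μ n * gegen μ n by ring] at h1
  linarith

theorem continuous_eigenfn (μ n : ℕ) : Continuous (eigenfn μ μ n) := by
  unfold eigenfn
  simp only [jacobiP_eq]
  have hp : Continuous fun x : ℝ => (gegen μ n).eval (Real.cos (2 * x)) :=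
    (gegen μ n).continuous.comp (by fun_prop)
  have h1 : Continuous fun x : ℝ => (1 - Real.cos (2 * x)) ^ ((μ : ℝ) / 2) :=
    Continuous.rpow_const (by fun_prop) fun _ => Or.inr (by positivity)
  have h2 : Continuous fun x : ℝ => (1 + Real.cos (2 * x)) ^ ((μ : ℝ) / 2) :=
    Continuous.rpow_const (by fun_prop) fun _ => Or.inr (by positivity)
  fun_prop

theorem integral_eigenfn_sq (μ n : ℕ) :
    ∫ x in (0 : ℝ)..(Real.pi / 2), eigenfn μ μ n x ^ 2 * Real.sin (2 * x) =
      1 / 2 * (gegenNorm μ 0 ^ 2 * sqInt μ 0 μ) := by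
  have h := integral_cos_two_mul_sin_two
    (fun y => (C (gegenNorm μ n ^ 2) * (oneSubSq ^ μ * gegen μ n ^ 2)).eval y)
    (Polynomial.continuous _)
  rw [← polyInt_apply, polyInt_C_mul] at h
  rw [← gegenNorm_sq_mul_sqInt μ n]
  rw [sqInt, ← h]
  refine intervalIntegral.integral_congr fun x _ => ?_
  have e1 := eigenfn_mul_eigenfn μ n n x
  simp only [eval_mul, eval_C, eval_pow] at e1 ⊢
  rw [pow_two, e1]
  ring

theorem sin_two_mul_nonneg {x : ℝ} (hx : x ∈ Set.Icc (0 : ℝ) (Real.pi / 2)) :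
    0 ≤ Real.sin (2 * x) :=
  Real.sin_nonneg_of_nonneg_of_le_pi (by linarith [hx.1]) (by linarith [hx.2])

/-- Sup norms for e_i and e_j, the common L² norm for e_k and e_m. By symmetry any two indices may
carry the growth, in particular the two smallest of i, j, k. -/
theorem exists_fourierC_bound (μ : ℕ) :
    ∃ K : ℝ, 0 ≤ K ∧ ∀ i j k m : ℕ,
      |fourierC μ μ i j k m| ≤ K * ((1 + (i : ℝ)) * (1 + (j : ℝ))) := by
  obtain ⟨K, hK, h⟩ := exists_eigenfn_bound μ
  set c := gegenNorm μ 0 ^ 2 * sqInt μ 0 μ with hc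
  have hc0 : 0 ≤ c := mul_nonneg (sq_nonneg _) (sqInt_nonneg _ _ _)
  refine ⟨K ^ 2 * c, by positivity, fun i j k m => ?_⟩
  have hpi : (0 : ℝ) ≤ Real.pi / 2 := by positivity
  have ci := continuous_eigenfn μ i
  have cj := continuous_eigenfn μ j
  have ck := continuous_eigenfn μ k
  have cm := continuous_eigenfn μ m
  calc |fourierC μ μ i j k m| ≤ ∫ x in (0 : ℝ)..(Real.pi / 2),
        abs (eigenfn μ μ i x * eigenfn μ μ j x * eigenfn μ μ k x * eigenfn μ μ m x
          * Real.sin (2 * x)) := intervalIntegral.abs_integral_le_integral_abs hpi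
    _ ≤ ∫ x in (0 : ℝ)..(Real.pi / 2), K ^ 2 * ((1 + (i : ℝ)) * (1 + (j : ℝ))) *
        (eigenfn μ μ k x ^ 2 * Real.sin (2 * x) + eigenfn μ μ m x ^ 2 * Real.sin (2 * x)) := by
      refine intervalIntegral.integral_mono_on hpi
        (Continuous.intervalIntegrable (by fun_prop) _ _)
        (Continuous.intervalIntegrable (by fun_prop) _ _) fun x hx => ?_
      have hs := sin_two_mul_nonneg hx
      rw [abs_mul, abs_of_nonneg hs, mul_assoc (eigenfn μ μ i x * eigenfn μ μ j x), abs_mul,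
        abs_mul (eigenfn μ μ i x), ← add_mul, ← mul_assoc]
      refine mul_le_mul_of_nonneg_right ?_ hs
      refine mul_le_mul ?_ ?_ (abs_nonneg _) (by positivity)
      · calc _ ≤ (K * (1 + (i : ℝ))) * (K * (1 + (j : ℝ))) :=
              mul_le_mul (h i x) (h j x) (abs_nonneg _) (by positivity)
          _ = _ := by ring
      · rw [abs_le]
        constructor <;>
          nlinarith [sq_nonneg (eigenfn μ μ k x + eigenfn μ μ m x),
            sq_nonneg (eigenfn μ μ k x - eigenfn μ μ m x)]
    _ = _ := by
      rw [intervalIntegral.integral_const_mul, intervalIntegral.integral_add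
        (Continuous.intervalIntegrable (by fun_prop) _ _)
        (Continuous.intervalIntegrable (by fun_prop) _ _), integral_eigenfn_sq,
        integral_eigenfn_sq]
      ring

end HopfCubicWave

/-! ### The diagonal condition for m ≥ 2γ + 1 through Newton expansions in ω_m² -/

namespace HopfCubicWave

open Polynomial

set_option linter.unusedSimpArgs false

/-- The products that serve as Newton basis for functions of the squared frequency. -/
noncomputable def newtonFactor (μ m i : ℕ) : ℝ :=
  ∏ j ∈ Finset.range i, ((2 * (m : ℝ) - 1 - 2 * j) * (4 * μ + 2 * m + 3 + 2 * j))⁻¹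

theorem two_mul_sub_ne_zero (m j : ℕ) : (2 * (m : ℝ) - 1 - 2 * j) ≠ 0 := by
  have : (2 * (m : ℤ) - 1 - 2 * j) ≠ 0 := by omega
  exact_mod_cast this

theorem newtonFactor_succ (μ m i : ℕ) :
    newtonFactor μ m i =
      (freq μ μ m ^ 2 - 4 * ((μ : ℝ) + (i + 1)) ^ 2) * newtonFactor μ m (i + 1) := by
  have h1 := two_mul_sub_ne_zero m i
  have h2 : (4 * (μ : ℝ) + 2 * m + 3 + 2 * i) ≠ 0 := by positivity
  have e : freq μ μ m ^ 2 - 4 * ((μ : ℝ) + (i + 1)) ^ 2 =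
      (2 * (m : ℝ) - 1 - 2 * i) * (4 * μ + 2 * m + 3 + 2 * i) := by
    rw [freq_eq]; ring
  rw [newtonFactor, newtonFactor, Finset.prod_range_succ, e]
  field_simp

/-- The frequency ω_m is an odd integer, so ω_m² never meets the poles 4(μ+i+1)². -/
theorem freq_sq_sub_ne_zero (μ m i : ℕ) :
    freq μ μ m ^ 2 - 4 * ((μ : ℝ) + (i + 1)) ^ 2 ≠ 0 := by
  have h1 := two_mul_sub_ne_zero m i
  have h2 : (4 * (μ : ℝ) + 2 * m + 3 + 2 * i) ≠ 0 := by positivity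
  have e : freq μ μ m ^ 2 - 4 * ((μ : ℝ) + (i + 1)) ^ 2 =
      (2 * (m : ℝ) - 1 - 2 * i) * (4 * μ + 2 * m + 3 + 2 * i) := by
    rw [freq_eq]; ring
  rw [e]
  exact mul_ne_zero h1 h2

/-- A product with the integral of `(1 - y²)^(2 μ) g_m²`. -/
noncomputable def newtonInt (μ m i : ℕ) : ℝ := sqInt μ m (2 * μ) * newtonFactor μ m i

theorem newtonInt_zero (μ m : ℕ) : newtonInt μ m 0 = sqInt μ m (2 * μ) := by
  simp [newtonInt, newtonFactor]

theorem newtonInt_succ (μ m i : ℕ) :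
    newtonInt μ m i =
      (freq μ μ m ^ 2 - 4 * ((μ : ℝ) + (i + 1)) ^ 2) * newtonInt μ m (i + 1) := by
  rw [newtonInt, newtonFactor_succ, newtonInt]
  ring

theorem sqInt_double_recurrence (μ n k : ℕ) :
    8 * ((k : ℝ) + 1) * ((μ : ℝ) + (k + 1)) * (2 * μ + (k + 1)) * sqInt μ n (2 * μ + k)
      + (2 * (μ : ℝ) + 2 * k + 3) *
        (freq μ μ n ^ 2 + 4 * (μ : ℝ) ^ 2 - 2 * (2 * (μ : ℝ) + 2 * k + 3) ^ 2 - 3) *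
        sqInt μ n (2 * μ + (k + 1)) =
    (2 * (μ : ℝ) + 2 * k + 4) * (freq μ μ n ^ 2 - 4 * ((μ : ℝ) + (k + 1 + 1)) ^ 2) *
      sqInt μ n (2 * μ + (k + 2)) := by
  have h := sqInt_recurrence μ n (2 * μ + k)
  push_cast at h
  rw [add_assoc (2 * μ) k 1, add_assoc (2 * μ) k 2] at h
  linear_combination h

/-- Each expansion follows from the recurrence in the exponent: after multiplication by the nonzero
factor ω_m² - 4(μ+j)² of its leading term, `newtonInt_succ` absorbs the powers of ω_m², and a
polynomial identity between coefficients remains. Denominators in μ are cleared on the left. -/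
theorem sqInt_expansion_one (μ m : ℕ) :
    2 * (μ + 1) * sqInt μ m (2 * μ + 1) =
      (1 * (2 * μ + 1)) * newtonInt μ m 0
        + (-1 * (2 * μ + 1)) * newtonInt μ m 1 := by
  have z1 := newtonInt_succ μ m 0
  have r := sqInt_recurrence_zero μ m
  have z0 := newtonInt_zero μ m
  have hne := freq_sq_sub_ne_zero μ m 0
  norm_num at r z1 hne
  generalize freq μ μ m ^ 2 = X at *
  refine mul_left_cancel₀ hne ?_
  linear_combination -r
    - (2 * μ + 1) * (X + 4 * (μ : ℝ) ^ 2 - 2 * (2 * μ + 1) ^ 2 - 3) * z0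
    + ((-1 * (2 * μ + 1)) - (2 * μ + 1) * 0) * z1

theorem sqInt_expansion_two (μ m : ℕ) :
    4 * (μ + 1) * (μ + 2) * sqInt μ m (2 * μ + 2) =
      (1 * (2 * μ + 1) * (2 * μ + 3)) * newtonInt μ m 0
        + (-2 * (2 * μ + 1) * (2 * μ + 1)) * newtonInt μ m 1
        + (9 * (2 * μ + 1) * (2 * μ + 3)) * newtonInt μ m 2 := by
  have z1 := newtonInt_succ μ m 0
  have z2 := newtonInt_succ μ m 1
  have r := sqInt_double_recurrence μ m 0
  have h0 := newtonInt_zero μ m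
  have h1 := sqInt_expansion_one μ m
  have hne := freq_sq_sub_ne_zero μ m 1
  norm_num at r z1 z2 hne
  generalize freq μ μ m ^ 2 = X at *
  refine mul_left_cancel₀ hne ?_
  linear_combination -(2 * (μ + 1)) * r
    - 8 * (2 * μ + 1) * (μ + 1) * (2 * (μ + 1)) * h0
    + (2 * μ + 3) * (X + 4 * (μ : ℝ) ^ 2 - 2 * (2 * μ + 3) ^ 2 - 3) * h1
    + ((-2 * (2 * μ + 1) * (2 * μ + 1)) - (2 * μ + 3) * (-1 * (2 * μ + 1))) * z1
    + ((9 * (2 * μ + 1) * (2 * μ + 3)) - (2 * μ + 3) * 0) * z2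

theorem sqInt_expansion_three (μ m : ℕ) :
    8 * (μ + 1) * (μ + 2) * (μ + 3) * sqInt μ m (2 * μ + 3) =
      (1 * (2 * μ + 1) * (2 * μ + 3) * (2 * μ + 5)) * newtonInt μ m 0
        + (-3 * (2 * μ + 1) * (2 * μ + 3) * (2 * μ + 1)) * newtonInt μ m 1
        + (27 * (2 * μ + 1) * (2 * μ + 1) * (2 * μ + 3)) * newtonInt μ m 2
        + (-225 * (2 * μ + 1) * (2 * μ + 3) * (2 * μ + 5)) * newtonInt μ m 3 := by
  have z1 := newtonInt_succ μ m 0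
  have z2 := newtonInt_succ μ m 1
  have z3 := newtonInt_succ μ m 2
  have r := sqInt_double_recurrence μ m 1
  have h0 := sqInt_expansion_one μ m
  have h1 := sqInt_expansion_two μ m
  have hne := freq_sq_sub_ne_zero μ m 2
  norm_num at r z1 z2 z3 hne
  generalize freq μ μ m ^ 2 = X at *
  refine mul_left_cancel₀ hne ?_
  linear_combination -(4 * (μ + 1) * (μ + 2)) * r
    + 16 * (2 * μ + 2) * (μ + 2) * (2 * (μ + 2)) * h0
    + (2 * μ + 5) * (X + 4 * (μ : ℝ) ^ 2 - 2 * (2 * μ + 5) ^ 2 - 3) * h1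
    + ((-3 * (2 * μ + 1) * (2 * μ + 3) * (2 * μ + 1)) - (2 * μ + 5) * (-2 * (2 * μ + 1) * (2 * μ + 1))) * z1
    + ((27 * (2 * μ + 1) * (2 * μ + 1) * (2 * μ + 3)) - (2 * μ + 5) * (9 * (2 * μ + 1) * (2 * μ + 3))) * z2
    + ((-225 * (2 * μ + 1) * (2 * μ + 3) * (2 * μ + 5)) - (2 * μ + 5) * 0) * z3

theorem sqInt_expansion_four (μ m : ℕ) :
    16 * (μ + 1) * (μ + 2) * (μ + 3) * (μ + 4) * sqInt μ m (2 * μ + 4) =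
      (1 * (2 * μ + 1) * (2 * μ + 3) * (2 * μ + 5) * (2 * μ + 7)) * newtonInt μ m 0
        + (-4 * (2 * μ + 1) * (2 * μ + 3) * (2 * μ + 5) * (2 * μ + 1)) * newtonInt μ m 1
        + (54 * (2 * μ + 1) * (2 * μ + 3) * (2 * μ + 1) * (2 * μ + 3)) * newtonInt μ m 2
        + (-900 * (2 * μ + 1) * (2 * μ + 1) * (2 * μ + 3) * (2 * μ + 5)) * newtonInt μ m 3
        + (11025 * (2 * μ + 1) * (2 * μ + 3) * (2 * μ + 5) * (2 * μ + 7)) * newtonInt μ m 4 := by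
  have z1 := newtonInt_succ μ m 0
  have z2 := newtonInt_succ μ m 1
  have z3 := newtonInt_succ μ m 2
  have z4 := newtonInt_succ μ m 3
  have r := sqInt_double_recurrence μ m 2
  have h0 := sqInt_expansion_two μ m
  have h1 := sqInt_expansion_three μ m
  have hne := freq_sq_sub_ne_zero μ m 3
  norm_num at r z1 z2 z3 z4 hne
  generalize freq μ μ m ^ 2 = X at *
  refine mul_left_cancel₀ hne ?_
  linear_combination -(8 * (μ + 1) * (μ + 2) * (μ + 3)) * r
    + 24 * (2 * μ + 3) * (μ + 3) * (2 * (μ + 3)) * h0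
    + (2 * μ + 7) * (X + 4 * (μ : ℝ) ^ 2 - 2 * (2 * μ + 7) ^ 2 - 3) * h1
    + ((-4 * (2 * μ + 1) * (2 * μ + 3) * (2 * μ + 5) * (2 * μ + 1)) - (2 * μ + 7) * (-3 * (2 * μ + 1) * (2 * μ + 3) * (2 * μ + 1))) * z1
    + ((54 * (2 * μ + 1) * (2 * μ + 3) * (2 * μ + 1) * (2 * μ + 3)) - (2 * μ + 7) * (27 * (2 * μ + 1) * (2 * μ + 1) * (2 * μ + 3))) * z2
    + ((-900 * (2 * μ + 1) * (2 * μ + 1) * (2 * μ + 3) * (2 * μ + 5)) - (2 * μ + 7) * (-225 * (2 * μ + 1) * (2 * μ + 3) * (2 * μ + 5))) * z3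
    + ((11025 * (2 * μ + 1) * (2 * μ + 3) * (2 * μ + 5) * (2 * μ + 7)) - (2 * μ + 7) * 0) * z4

theorem sqInt_expansion_five (μ m : ℕ) :
    32 * (μ + 1) * (μ + 2) * (μ + 3) * (μ + 4) * (μ + 5) * sqInt μ m (2 * μ + 5) =
      (1 * (2 * μ + 1) * (2 * μ + 3) * (2 * μ + 5) * (2 * μ + 7) * (2 * μ + 9)) * newtonInt μ m 0
        + (-5 * (2 * μ + 1) * (2 * μ + 3) * (2 * μ + 5) * (2 * μ + 7) * (2 * μ + 1)) * newtonInt μ m 1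
        + (90 * (2 * μ + 1) * (2 * μ + 3) * (2 * μ + 5) * (2 * μ + 1) * (2 * μ + 3)) * newtonInt μ m 2
        + (-2250 * (2 * μ + 1) * (2 * μ + 3) * (2 * μ + 1) * (2 * μ + 3) * (2 * μ + 5)) * newtonInt μ m 3
        + (55125 * (2 * μ + 1) * (2 * μ + 1) * (2 * μ + 3) * (2 * μ + 5) * (2 * μ + 7)) * newtonInt μ m 4
        + (-893025 * (2 * μ + 1) * (2 * μ + 3) * (2 * μ + 5) * (2 * μ + 7) * (2 * μ + 9)) * newtonInt μ m 5 := by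
  have z1 := newtonInt_succ μ m 0
  have z2 := newtonInt_succ μ m 1
  have z3 := newtonInt_succ μ m 2
  have z4 := newtonInt_succ μ m 3
  have z5 := newtonInt_succ μ m 4
  have r := sqInt_double_recurrence μ m 3
  have h0 := sqInt_expansion_three μ m
  have h1 := sqInt_expansion_four μ m
  have hne := freq_sq_sub_ne_zero μ m 4
  norm_num at r z1 z2 z3 z4 z5 hne
  generalize freq μ μ m ^ 2 = X at *
  refine mul_left_cancel₀ hne ?_
  linear_combination -(16 * (μ + 1) * (μ + 2) * (μ + 3) * (μ + 4)) * r
    + 32 * (2 * μ + 4) * (μ + 4) * (2 * (μ + 4)) * h0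
    + (2 * μ + 9) * (X + 4 * (μ : ℝ) ^ 2 - 2 * (2 * μ + 9) ^ 2 - 3) * h1
    + ((-5 * (2 * μ + 1) * (2 * μ + 3) * (2 * μ + 5) * (2 * μ + 7) * (2 * μ + 1)) - (2 * μ + 9) * (-4 * (2 * μ + 1) * (2 * μ + 3) * (2 * μ + 5) * (2 * μ + 1))) * z1
    + ((90 * (2 * μ + 1) * (2 * μ + 3) * (2 * μ + 5) * (2 * μ + 1) * (2 * μ + 3)) - (2 * μ + 9) * (54 * (2 * μ + 1) * (2 * μ + 3) * (2 * μ + 1) * (2 * μ + 3))) * z2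
    + ((-2250 * (2 * μ + 1) * (2 * μ + 3) * (2 * μ + 1) * (2 * μ + 3) * (2 * μ + 5)) - (2 * μ + 9) * (-900 * (2 * μ + 1) * (2 * μ + 1) * (2 * μ + 3) * (2 * μ + 5))) * z3
    + ((55125 * (2 * μ + 1) * (2 * μ + 1) * (2 * μ + 3) * (2 * μ + 5) * (2 * μ + 7)) - (2 * μ + 9) * (11025 * (2 * μ + 1) * (2 * μ + 3) * (2 * μ + 5) * (2 * μ + 7))) * z4
    + ((-893025 * (2 * μ + 1) * (2 * μ + 3) * (2 * μ + 5) * (2 * μ + 7) * (2 * μ + 9)) - (2 * μ + 9) * 0) * z5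

/-- For m ≥ i all factors in the denominator are positive and increase with m; for smaller m some
would be negative. -/
theorem newtonFactor_nonneg_antitone (μ i m m' : ℕ) (hi : i ≤ m) (hm : m ≤ m') :
    0 ≤ newtonFactor μ m' i ∧ newtonFactor μ m' i ≤ newtonFactor μ m i := by
  have hm' : (m : ℝ) ≤ m' := by exact_mod_cast hm
  have hpos : ∀ j ∈ Finset.range i, 0 < 2 * (m : ℝ) - 1 - 2 * j := by
    intro j hj
    have : (j : ℝ) + 1 ≤ m := by exact_mod_cast (Finset.mem_range.mp hj).trans_le hi
    linarith
  have hnn : ∀ j ∈ Finset.range i,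
      0 ≤ ((2 * (m' : ℝ) - 1 - 2 * j) * (4 * μ + 2 * m' + 3 + 2 * j))⁻¹ := by
    intro j hj
    have := hpos j hj
    exact inv_nonneg.mpr (mul_nonneg (by linarith) (by positivity))
  refine ⟨Finset.prod_nonneg hnn, Finset.prod_le_prod hnn fun j hj => ?_⟩
  have h1 := hpos j hj
  refine inv_anti₀ (mul_pos h1 (by positivity)) ?_
  exact mul_le_mul (by linarith) (by linarith) (by positivity) (by linarith)

/-- The normalized integral of `(1 - y²)^(2 μ) g_m²`. -/
noncomputable def groundInt (μ m : ℕ) : ℝ := gegenNorm μ m ^ 2 * sqInt μ m (2 * μ)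

/-- The ratio of successive values of `groundInt μ m / freq μ μ m`. -/
noncomputable def groundRatio (μ m : ℕ) : ℝ :=
  (2 * (m : ℝ) + 1) * (m + 2 * μ + 1) / ((m + 1) * (4 * μ + 2 * m + 3))

theorem groundInt_succ (μ m : ℕ) :
    groundInt μ (m + 1) * freq μ μ m = groundRatio μ m * freq μ μ (m + 1) * groundInt μ m := by
  have h1 := gegenNorm_sq_succ μ m
  have h2 := sqInt_double_succ μ m
  have p1 : (0 : ℝ) < (m : ℝ) + 1 := by positivity
  have p2 : (0 : ℝ) < 4 * (μ : ℝ) + 2 * m + 3 := by positivity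
  have p3 : (0 : ℝ) < (m : ℝ) + 2 * μ + 1 := by positivity
  rw [groundRatio]
  field_simp
  apply mul_left_cancel₀ p3.ne'
  rw [groundInt, groundInt]
  linear_combination (4 * (μ : ℝ) + 2 * m + 3) * sqInt μ (m + 1) (2 * μ) * h1
    + freq μ μ (m + 1) * gegenNorm μ m ^ 2 * h2

theorem sqInt_pos (μ e : ℕ) : 0 < sqInt μ 0 e := by
  have h : 0 < ∫ y in (-1 : ℝ)..1, (1 - y ^ 2) ^ e := by
    refine intervalIntegral.intervalIntegral_pos_of_pos_on
      (Continuous.intervalIntegrable (by fun_prop) _ _) (fun y hy => ?_) (by norm_num)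
    have : 0 < 1 - y ^ 2 := by nlinarith [hy.1, hy.2]
    positivity
  rw [sqInt, polyInt_apply]
  simpa [gegen, eval_oneSubSq] using h

theorem groundRatio_pos (μ m : ℕ) : 0 < groundRatio μ m := by
  unfold groundRatio; positivity

theorem groundInt_pos (μ m : ℕ) : 0 < groundInt μ m := by
  induction m with
  | zero => exact mul_pos (pow_pos (gegenNorm_pos μ 0) 2) (sqInt_pos μ _)
  | succ m ih =>
    have h := groundInt_succ μ m
    have h1 := freq_pos μ m
    have h2 := freq_pos μ (m + 1)
    have h3 := groundRatio_pos μ m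
    have : 0 < groundInt μ (m + 1) * freq μ μ m := by rw [h]; positivity
    exact (mul_pos_iff_of_pos_right h1).mp this

/-- The step ratio is `groundRatio` times ω_{m+1}/ω_m; after clearing denominators the difference to
1 has nonnegative coefficients. -/
theorem groundInt_antitone (μ : ℕ) : Antitone (groundInt μ) := by
  refine antitone_nat_of_succ_le fun m => ?_
  have h := groundInt_succ μ m
  have h1 := freq_pos μ m
  have h3 := groundInt_pos μ m
  have h4 : groundRatio μ m * freq μ μ (m + 1) ≤ freq μ μ m := by
    rw [groundRatio, div_mul_eq_mul_div, div_le_iff₀ (by positivity), freq_eq, freq_eq]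
    push_cast
    rw [← sub_nonneg]
    ring_nf
    positivity
  have : groundInt μ (m + 1) * freq μ μ m ≤ groundInt μ m * freq μ μ m := by
    rw [h, mul_comm (groundInt μ m)]
    exact mul_le_mul_of_nonneg_right h4 h3.le
  exact le_of_mul_le_mul_right this h1

theorem groundInt_add (μ m k : ℕ) :
    groundInt μ (m + k) * freq μ μ m =
      (∏ j ∈ Finset.range k, groundRatio μ (m + j)) * freq μ μ (m + k) * groundInt μ m := by
  induction k with
  | zero => simp [mul_comm]
  | succ k ih =>
    have h := groundInt_succ μ (m + k)
    have h1 := freq_pos μ (m + k)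
    rw [Finset.prod_range_succ]
    apply mul_left_cancel₀ h1.ne'
    rw [← add_assoc]
    linear_combination freq μ μ m * h + groundRatio μ (m + k) * freq μ μ (m + k + 1) * ih

/-- The value at `m` of a function of the squared frequency given in the Newton basis. -/
noncomputable def newtonSum (μ : ℕ) (d : ℕ → ℝ) (γ m : ℕ) : ℝ :=
  ∑ i ∈ Finset.range (γ + 1), d i * newtonFactor μ m i

theorem fourierC_diag_eq (μ γ : ℕ) {κ c : ℝ} (d : ℕ → ℝ) (q : ℝ[X])
    (hκ : κ ≠ 0) (hq : gegen μ γ = C c * q)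
    (hexp : ∀ m, κ * polyInt (oneSubSq ^ (2 * μ) * (q ^ 2 * gegen μ m ^ 2)) =
      ∑ i ∈ Finset.range (γ + 1), d i * newtonInt μ m i) (m : ℕ) :
    fourierC μ μ γ γ m m =
      1 / 2 * gegenNorm μ γ ^ 2 * c ^ 2 / κ * (groundInt μ m * newtonSum μ d γ m) := by
  have h := hexp m
  have e1 : ∑ i ∈ Finset.range (γ + 1), d i * newtonInt μ m i =
      sqInt μ m (2 * μ) * newtonSum μ d γ m := by
    rw [newtonSum, Finset.mul_sum]
    refine Finset.sum_congr rfl fun i _ => ?_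
    rw [newtonInt]; ring
  rw [e1] at h
  rw [fourierC_eq, show oneSubSq ^ (2 * μ) * (gegen μ γ * gegen μ γ * gegen μ m * gegen μ m) =
    C (c ^ 2) * (oneSubSq ^ (2 * μ) * (q ^ 2 * gegen μ m ^ 2)) by rw [hq, C_pow]; ring,
    polyInt_C_mul, groundInt]
  field_simp
  linear_combination gegenNorm μ γ ^ 2 * c ^ 2 * gegenNorm μ m ^ 2 * h

/-- C_{γγmm} is a positive constant times `groundInt` times `newtonSum`. For m ≥ 2γ+1 both are
nonnegative and decreasing, the second because the coefficients are nonnegative, while ω_m²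
increases, so m = 2γ+1 is the worst case. `groundInt_add` removes the transcendental-looking part
from it and leaves the explicit inequality `hbase`. -/
theorem diag_condition_of_expansion (μ γ : ℕ) {κ c : ℝ} (d : ℕ → ℝ) (q : ℝ[X])
    (hκ : 0 < κ) (hc : c ≠ 0) (hd : ∀ i, 0 ≤ d i) (hq : gegen μ γ = C c * q)
    (hexp : ∀ m, κ * polyInt (oneSubSq ^ (2 * μ) * (q ^ 2 * gegen μ m ^ 2)) =
      ∑ i ∈ Finset.range (γ + 1), d i * newtonInt μ m i)
    (hbase : 0 < freq μ μ (2 * γ + 1) * newtonSum μ d γ γ -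
      2 * freq μ μ γ * (∏ j ∈ Finset.range (γ + 1), groundRatio μ (γ + j)) *
        newtonSum μ d γ (2 * γ + 1))
    (m : ℕ) (hm : 2 * γ + 1 ≤ m) :
    0 < freq μ μ m ^ 2 * fourierC μ μ γ γ γ γ - 2 * freq μ μ γ ^ 2 * fourierC μ μ γ γ m m := by
  rw [fourierC_diag_eq μ γ d q hκ.ne' hq hexp, fourierC_diag_eq μ γ d q hκ.ne' hq hexp]
  have hN := gegenNorm_pos μ γ
  have hA : 0 < 1 / 2 * gegenNorm μ γ ^ 2 * c ^ 2 / κ := by positivity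
  generalize 1 / 2 * gegenNorm μ γ ^ 2 * c ^ 2 / κ = A at hA
  have hnf := fun i (hi : i ∈ Finset.range (γ + 1)) =>
    newtonFactor_nonneg_antitone μ i (2 * γ + 1) m (by have := Finset.mem_range.mp hi; omega) hm
  have h1 : newtonSum μ d γ m ≤ newtonSum μ d γ (2 * γ + 1) :=
    Finset.sum_le_sum fun i hi => mul_le_mul_of_nonneg_left (hnf i hi).2 (hd i)
  have h0 : 0 ≤ newtonSum μ d γ m :=
    Finset.sum_nonneg fun i hi => mul_nonneg (hd i) (hnf i hi).1
  have h0' : 0 ≤ newtonSum μ d γ γ := Finset.sum_nonneg fun i hi =>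
    mul_nonneg (hd i) (newtonFactor_nonneg_antitone μ i γ γ
      (by have := Finset.mem_range.mp hi; omega) le_rfl).1
  have h2 : groundInt μ m * newtonSum μ d γ m ≤
      groundInt μ (2 * γ + 1) * newtonSum μ d γ (2 * γ + 1) :=
    mul_le_mul (groundInt_antitone μ hm) h1 h0 (groundInt_pos μ _).le
  have h3 := groundInt_add μ γ (γ + 1)
  rw [show γ + (γ + 1) = 2 * γ + 1 by ring] at h3
  have hf := freq_pos μ γ
  have hf1 := freq_pos μ (2 * γ + 1)
  have hg := groundInt_pos μ γ
  have h4 : freq μ μ (2 * γ + 1) ≤ freq μ μ m := by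
    rw [freq_eq, freq_eq]
    have : ((2 * γ + 1 : ℕ) : ℝ) ≤ m := by exact_mod_cast hm
    linarith
  have h5 : freq μ μ (2 * γ + 1) ^ 2 ≤ freq μ μ m ^ 2 := pow_le_pow_left₀ hf1.le h4 2
  have h6 : 0 < freq μ μ (2 * γ + 1) ^ 2 * (groundInt μ γ * newtonSum μ d γ γ) -
      2 * freq μ μ γ ^ 2 * (groundInt μ (2 * γ + 1) * newtonSum μ d γ (2 * γ + 1)) := by
    have : freq μ μ (2 * γ + 1) ^ 2 * (groundInt μ γ * newtonSum μ d γ γ) -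
        2 * freq μ μ γ ^ 2 * (groundInt μ (2 * γ + 1) * newtonSum μ d γ (2 * γ + 1)) =
        freq μ μ (2 * γ + 1) * groundInt μ γ * (freq μ μ (2 * γ + 1) * newtonSum μ d γ γ -
        2 * freq μ μ γ * (∏ j ∈ Finset.range (γ + 1), groundRatio μ (γ + j)) *
        newtonSum μ d γ (2 * γ + 1)) := by
      linear_combination -2 * freq μ μ γ * newtonSum μ d γ (2 * γ + 1) * h3
    rw [this]
    exact mul_pos (mul_pos hf1 hg) hbase
  have h7 : freq μ μ (2 * γ + 1) ^ 2 * (groundInt μ γ * newtonSum μ d γ γ) ≤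
      freq μ μ m ^ 2 * (groundInt μ γ * newtonSum μ d γ γ) :=
    mul_le_mul_of_nonneg_right h5 (mul_nonneg hg.le h0')
  have h8 := mul_le_mul_of_nonneg_left h2 (by positivity : 0 ≤ 2 * freq μ μ γ ^ 2)
  have h9 : 0 < freq μ μ m ^ 2 * (groundInt μ γ * newtonSum μ d γ γ) -
      2 * freq μ μ γ ^ 2 * (groundInt μ m * newtonSum μ d γ m) := by linarith
  have := mul_pos hA h9
  linarith

theorem gegen_zero (μ : ℕ) : gegen μ 0 =
    C (1) * (C (1 : ℝ)) := by
  simp [gegen]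

/-- The Newton coefficients that belong to `g_0²`. -/
noncomputable def newtonCoeffZero (_μ : ℝ) : ℕ → ℝ
  | 0 => 1
  | _ => 0

theorem newtonExpansion_zero (μ m : ℕ) :
    (1 : ℝ) * polyInt (oneSubSq ^ (2 * μ) *
      ((C (1 : ℝ)) ^ 2 * gegen μ m ^ 2)) =
      ∑ i ∈ Finset.range (0 + 1), newtonCoeffZero μ i * newtonInt μ m i := by
  have e : oneSubSq ^ (2 * μ) * ((C (1 : ℝ)) ^ 2 * gegen μ m ^ 2) =
      C (1 : ℝ) * (oneSubSq ^ (2 * μ) * gegen μ m ^ 2) := by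
    simp only [map_add, map_mul, map_neg, map_natCast, map_ofNat, map_one, pow_add, oneSubSq]
    ring
  have h0 := newtonInt_zero μ m
  rw [e]
  simp only [map_add, polyInt_C_mul, ← sqInt.eq_1]
  simp only [Finset.sum_range_succ, Finset.sum_range_zero, newtonCoeffZero]
  linear_combination -(1) * h0

theorem diag_condition_zero (μ m : ℕ) (hm : 2 * 0 + 1 ≤ m) :
    0 < freq μ μ m ^ 2 * fourierC μ μ 0 0 0 0
      - 2 * freq μ μ 0 ^ 2 * fourierC μ μ 0 0 m m := by
  refine diag_condition_of_expansion μ 0 (newtonCoeffZero μ) _ (by positivity) (by positivity)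
    (fun i => ?_) (gegen_zero μ) (newtonExpansion_zero μ) ?_ m hm
  · unfold newtonCoeffZero
    split <;> positivity
  -- Here and in the analogous lemmas for larger γ, the worst case m = 2γ+1 becomes a quotient of
  -- polynomials in μ with positive coefficients only.
  · have e : freq μ μ (2 * 0 + 1) * newtonSum μ (newtonCoeffZero μ) 0 0 -
        2 * freq μ μ 0 * (∏ j ∈ Finset.range (0 + 1), groundRatio μ (0 + j)) *
          newtonSum μ (newtonCoeffZero μ) 0 (2 * 0 + 1) =
        (7 + 10 * (μ : ℝ)) /
          ((4 * (μ : ℝ) + 3)) := by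
      simp only [newtonSum, newtonFactor, groundRatio, freq_eq, Finset.sum_range_succ,
        Finset.prod_range_succ, Finset.sum_range_zero, Finset.prod_range_zero, newtonCoeffZero]
      norm_num
      field_simp
      ring
    rw [e]
    positivity

theorem gegen_one (μ : ℕ) : gegen μ 1 =
    C (2 * (μ : ℝ) + 1) * (C (1 : ℝ) * X) := by
  simp [gegen]

/-- The Newton coefficients that belong to `g_1²`. -/
noncomputable def newtonCoeffOne (μ : ℝ) : ℕ → ℝ
  | 0 => 1
  | 1 => (2 * μ + 1)
  | _ => 0

/-- The square of g_γ is even, hence a polynomial in 1 - y², and the expansions of `sqInt` apply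
term by term; the higher cases follow the same pattern. Signs alternate both in the powers of 1 - y²
and in the Newton expansions, yet the resulting coefficients are nonnegative, as the monotonicity
argument needs. -/
theorem newtonExpansion_one (μ m : ℕ) :
    (2 * (μ + 1) : ℝ) * polyInt (oneSubSq ^ (2 * μ) *
      ((C (1 : ℝ) * X) ^ 2 * gegen μ m ^ 2)) =
      ∑ i ∈ Finset.range (1 + 1), newtonCoeffOne μ i * newtonInt μ m i := by
  have e : oneSubSq ^ (2 * μ) * ((C (1 : ℝ) * X) ^ 2 * gegen μ m ^ 2) =
      C (1 : ℝ) * (oneSubSq ^ (2 * μ) * gegen μ m ^ 2)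
      + C (-1 : ℝ) * (oneSubSq ^ (2 * μ + 1) * gegen μ m ^ 2) := by
    simp only [map_add, map_mul, map_neg, map_natCast, map_ofNat, map_one, pow_add, oneSubSq]
    ring
  have h0 := newtonInt_zero μ m
  have h1 := sqInt_expansion_one μ m
  rw [e]
  simp only [map_add, polyInt_C_mul, ← sqInt.eq_1]
  simp only [Finset.sum_range_succ, Finset.sum_range_zero, newtonCoeffOne]
  linear_combination -(2 * ((μ : ℝ) + 1)) * h0
    + (-1) * h1

theorem diag_condition_one (μ m : ℕ) (hm : 2 * 1 + 1 ≤ m) :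
    0 < freq μ μ m ^ 2 * fourierC μ μ 1 1 1 1
      - 2 * freq μ μ 1 ^ 2 * fourierC μ μ 1 1 m m := by
  refine diag_condition_of_expansion μ 1 (newtonCoeffOne μ) _ (by positivity) (by positivity)
    (fun i => ?_) (gegen_one μ) (newtonExpansion_one μ) ?_ m hm
  · unfold newtonCoeffOne
    split <;> positivity
  · have e : freq μ μ (2 * 1 + 1) * newtonSum μ (newtonCoeffOne μ) 1 1 -
        2 * freq μ μ 1 * (∏ j ∈ Finset.range (1 + 1), groundRatio μ (1 + j)) *
          newtonSum μ (newtonCoeffOne μ) 1 (2 * 1 + 1) =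
        2 * ((μ : ℝ) + 1) * (909 + 972 * (μ : ℝ) + 272 * (μ : ℝ) ^ 2 + 8 * (μ : ℝ) ^ 3) /
          ((4 * (μ : ℝ) + 5) * (4 * (μ : ℝ) + 7) * (4 * (μ : ℝ) + 9)) := by
      simp only [newtonSum, newtonFactor, groundRatio, freq_eq, Finset.sum_range_succ,
        Finset.prod_range_succ, Finset.sum_range_zero, Finset.prod_range_zero, newtonCoeffOne]
      norm_num
      field_simp
      ring
    rw [e]
    positivity

theorem gegen_two (μ : ℕ) : gegen μ 2 =
    C (2 * (μ : ℝ) + 1) * (C (-1 : ℝ) + C ((2 * (μ : ℝ) + 3)) * X ^ 2) := by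
  rw [gegen_recurrence, gegen_one, gegen_zero]
  simp only [map_add, map_mul, map_neg, map_natCast, map_ofNat, map_one, Nat.cast_ofNat,
    map_zero, Nat.cast_zero, Nat.cast_one]
  ring

/-- The Newton coefficients that belong to `g_2²`. -/
noncomputable def newtonCoeffTwo (μ : ℝ) : ℕ → ℝ
  | 0 => (11 + 20 * μ + 8 * μ ^ 2)
  | 1 => 2 * (2 * μ + 1) * (2 * μ + 3) * (4 * μ + 5)
  | 2 => 9 * (2 * μ + 1) * (2 * μ + 3) * (2 * μ + 3) * (2 * μ + 3)
  | _ => 0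

theorem newtonExpansion_two (μ m : ℕ) :
    (4 * (μ + 1) * (μ + 2) : ℝ) * polyInt (oneSubSq ^ (2 * μ) *
      ((C (-1 : ℝ) + C ((2 * (μ : ℝ) + 3)) * X ^ 2) ^ 2 * gegen μ m ^ 2)) =
      ∑ i ∈ Finset.range (2 + 1), newtonCoeffTwo μ i * newtonInt μ m i := by
  have e : oneSubSq ^ (2 * μ) * ((C (-1 : ℝ) + C ((2 * (μ : ℝ) + 3)) * X ^ 2) ^ 2 * gegen μ m ^ 2) =
      C (4 * ((μ : ℝ) + 1) * (μ + 1)) * (oneSubSq ^ (2 * μ) * gegen μ m ^ 2)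
      + C (-4 * ((μ : ℝ) + 1) * (2 * μ + 3)) * (oneSubSq ^ (2 * μ + 1) * gegen μ m ^ 2)
      + C ((2 * (μ : ℝ) + 3) * (2 * μ + 3)) * (oneSubSq ^ (2 * μ + 2) * gegen μ m ^ 2) := by
    simp only [map_add, map_mul, map_neg, map_natCast, map_ofNat, map_one, pow_add, oneSubSq]
    ring
  have h0 := newtonInt_zero μ m
  have h1 := sqInt_expansion_one μ m
  have h2 := sqInt_expansion_two μ m
  rw [e]
  simp only [map_add, polyInt_C_mul, ← sqInt.eq_1]
  simp only [Finset.sum_range_succ, Finset.sum_range_zero, newtonCoeffTwo]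
  linear_combination -(16 * ((μ : ℝ) + 1) * (μ + 1) * (μ + 1) * (μ + 2)) * h0
    + (-8 * ((μ : ℝ) + 1) * (μ + 2) * (2 * μ + 3)) * h1
    + ((2 * (μ : ℝ) + 3) * (2 * μ + 3)) * h2

theorem diag_condition_two (μ m : ℕ) (hm : 2 * 2 + 1 ≤ m) :
    0 < freq μ μ m ^ 2 * fourierC μ μ 2 2 2 2
      - 2 * freq μ μ 2 ^ 2 * fourierC μ μ 2 2 m m := by
  refine diag_condition_of_expansion μ 2 (newtonCoeffTwo μ) _ (by positivity) (by positivity)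
    (fun i => ?_) (gegen_two μ) (newtonExpansion_two μ) ?_ m hm
  · unfold newtonCoeffTwo
    split <;> positivity
  · have e : freq μ μ (2 * 2 + 1) * newtonSum μ (newtonCoeffTwo μ) 2 2 -
        2 * freq μ μ 2 * (∏ j ∈ Finset.range (2 + 1), groundRatio μ (2 + j)) *
          newtonSum μ (newtonCoeffTwo μ) 2 (2 * 2 + 1) =
        16 * ((μ : ℝ) + 2) * (420615 + 1498914 * (μ : ℝ) + 2063882 * (μ : ℝ) ^ 2 + 1435568 * (μ : ℝ) ^ 3 + 541259 * (μ : ℝ) ^ 4 + 107994 * (μ : ℝ) ^ 5 + 9836 * (μ : ℝ) ^ 6 + 232 * (μ : ℝ) ^ 7) /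
          ((4 * (μ : ℝ) + 7) * (4 * (μ : ℝ) + 9) * (4 * (μ : ℝ) + 11) * (4 * (μ : ℝ) + 13) * (4 * (μ : ℝ) + 15)) := by
      simp only [newtonSum, newtonFactor, groundRatio, freq_eq, Finset.sum_range_succ,
        Finset.prod_range_succ, Finset.sum_range_zero, Finset.prod_range_zero, newtonCoeffTwo]
      norm_num
      field_simp
      ring
    rw [e]
    positivity

theorem gegen_three (μ : ℕ) : gegen μ 3 =
    C ((2 * (μ : ℝ) + 1) * (2 * μ + 3)) * (C (-3 : ℝ) * X + C ((2 * (μ : ℝ) + 5)) * X ^ 3) := by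
  rw [gegen_recurrence, gegen_two, gegen_one]
  simp only [map_add, map_mul, map_neg, map_natCast, map_ofNat, map_one, Nat.cast_ofNat,
    map_zero, Nat.cast_zero, Nat.cast_one]
  ring

/-- The Newton coefficients that belong to `g_3²`. -/
noncomputable def newtonCoeffThree (μ : ℝ) : ℕ → ℝ
  | 0 => 3 * (17 + 28 * μ + 8 * μ ^ 2)
  | 1 => 9 * (2 * μ + 1) * (29 + 32 * μ + 8 * μ ^ 2)
  | 2 => 27 * (2 * μ + 1) * (2 * μ + 3) * (2 * μ + 5) * (13 + 6 * μ)
  | 3 => 225 * (2 * μ + 1) * (2 * μ + 3) * (2 * μ + 5) * (2 * μ + 5) * (2 * μ + 5)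
  | _ => 0

theorem newtonExpansion_three (μ m : ℕ) :
    (8 * (μ + 1) * (μ + 2) * (μ + 3) : ℝ) * polyInt (oneSubSq ^ (2 * μ) *
      ((C (-3 : ℝ) * X + C ((2 * (μ : ℝ) + 5)) * X ^ 3) ^ 2 * gegen μ m ^ 2)) =
      ∑ i ∈ Finset.range (3 + 1), newtonCoeffThree μ i * newtonInt μ m i := by
  have e : oneSubSq ^ (2 * μ) * ((C (-3 : ℝ) * X + C ((2 * (μ : ℝ) + 5)) * X ^ 3) ^ 2 * gegen μ m ^ 2) =
      C (4 * ((μ : ℝ) + 1) * (μ + 1)) * (oneSubSq ^ (2 * μ) * gegen μ m ^ 2)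
      + C (-12 * ((μ : ℝ) + 1) * (μ + 2)) * (oneSubSq ^ (2 * μ + 1) * gegen μ m ^ 2)
      + C (3 * (2 * (μ : ℝ) + 3) * (2 * μ + 5)) * (oneSubSq ^ (2 * μ + 2) * gegen μ m ^ 2)
      + C (-(2 * (μ : ℝ) + 5) * (2 * μ + 5)) * (oneSubSq ^ (2 * μ + 3) * gegen μ m ^ 2) := by
    simp only [map_add, map_mul, map_neg, map_natCast, map_ofNat, map_one, pow_add, oneSubSq]
    ring
  have h0 := newtonInt_zero μ m
  have h1 := sqInt_expansion_one μ m
  have h2 := sqInt_expansion_two μ m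
  have h3 := sqInt_expansion_three μ m
  rw [e]
  simp only [map_add, polyInt_C_mul, ← sqInt.eq_1]
  simp only [Finset.sum_range_succ, Finset.sum_range_zero, newtonCoeffThree]
  linear_combination -(32 * ((μ : ℝ) + 1) * (μ + 1) * (μ + 1) * (μ + 2) * (μ + 3)) * h0
    + (-48 * ((μ : ℝ) + 1) * (μ + 2) * (μ + 2) * (μ + 3)) * h1
    + (6 * ((μ : ℝ) + 3) * (2 * μ + 3) * (2 * μ + 5)) * h2
    + (-(2 * (μ : ℝ) + 5) * (2 * μ + 5)) * h3

theorem diag_condition_three (μ m : ℕ) (hm : 2 * 3 + 1 ≤ m) :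
    0 < freq μ μ m ^ 2 * fourierC μ μ 3 3 3 3
      - 2 * freq μ μ 3 ^ 2 * fourierC μ μ 3 3 m m := by
  refine diag_condition_of_expansion μ 3 (newtonCoeffThree μ) _ (by positivity) (by positivity)
    (fun i => ?_) (gegen_three μ) (newtonExpansion_three μ) ?_ m hm
  · unfold newtonCoeffThree
    split <;> positivity
  · have e : freq μ μ (2 * 3 + 1) * newtonSum μ (newtonCoeffThree μ) 3 3 -
        2 * freq μ μ 3 * (∏ j ∈ Finset.range (3 + 1), groundRatio μ (3 + j)) *
          newtonSum μ (newtonCoeffThree μ) 3 (2 * 3 + 1) =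
        (96 / 5) * ((μ : ℝ) + 2) * ((μ : ℝ) + 3) * (714993195 + 2243431268 * (μ : ℝ) + 2606232473 * (μ : ℝ) ^ 2 + 1554950979 * (μ : ℝ) ^ 3 + 531715470 * (μ : ℝ) ^ 4 + 106942497 * (μ : ℝ) ^ 5 + 12179862 * (μ : ℝ) ^ 6 + 686236 * (μ : ℝ) ^ 7 + 12520 * (μ : ℝ) ^ 8) /
          ((4 * (μ : ℝ) + 9) * (4 * (μ : ℝ) + 11) * (4 * (μ : ℝ) + 13) * (4 * (μ : ℝ) + 15) * (4 * (μ : ℝ) + 17) * (4 * (μ : ℝ) + 19) * (4 * (μ : ℝ) + 21)) := by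
      simp only [newtonSum, newtonFactor, groundRatio, freq_eq, Finset.sum_range_succ,
        Finset.prod_range_succ, Finset.sum_range_zero, Finset.prod_range_zero, newtonCoeffThree]
      norm_num
      field_simp
      ring
    rw [e]
    positivity

theorem gegen_four (μ : ℕ) : gegen μ 4 =
    C ((2 * (μ : ℝ) + 1) * (2 * μ + 3)) * (C (3 : ℝ) + C (-6 * (2 * (μ : ℝ) + 5)) * X ^ 2 + C ((2 * (μ : ℝ) + 5) * (2 * μ + 7)) * X ^ 4) := by
  rw [gegen_recurrence, gegen_three, gegen_two]
  simp only [map_add, map_mul, map_neg, map_natCast, map_ofNat, map_one, Nat.cast_ofNat,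
    map_zero, Nat.cast_zero, Nat.cast_one]
  ring

/-- The Newton coefficients that belong to `g_4²`. -/
noncomputable def newtonCoeffFour (μ : ℝ) : ℕ → ℝ
  | 0 => 3 * (1787 + 4464 * μ + 3584 * μ ^ 2 + 1152 * μ ^ 3 + 128 * μ ^ 4)
  | 1 => 12 * (2 * μ + 1) * (2 * μ + 5) * (727 + 1040 * μ + 464 * μ ^ 2 + 64 * μ ^ 3)
  | 2 => 54 * (2 * μ + 1) * (2 * μ + 3) * (2 * μ + 5) * (1951 + 2178 * μ + 800 * μ ^ 2 + 96 * μ ^ 3)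
  | 3 => 900 * (2 * μ + 1) * (2 * μ + 3) * (2 * μ + 5) * (2 * μ + 5) * (2 * μ + 5) * (2 * μ + 7) * (25 + 8 * μ)
  | 4 => 11025 * (2 * μ + 1) * (2 * μ + 3) * (2 * μ + 5) * (2 * μ + 5) * (2 * μ + 5) * (2 * μ + 7) * (2 * μ + 7) * (2 * μ + 7)
  | _ => 0

theorem newtonExpansion_four (μ m : ℕ) :
    (16 * (μ + 1) * (μ + 2) * (μ + 3) * (μ + 4) : ℝ) * polyInt (oneSubSq ^ (2 * μ) *
      ((C (3 : ℝ) + C (-6 * (2 * (μ : ℝ) + 5)) * X ^ 2 + C ((2 * (μ : ℝ) + 5) * (2 * μ + 7)) * X ^ 4) ^ 2 * gegen μ m ^ 2)) =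
      ∑ i ∈ Finset.range (4 + 1), newtonCoeffFour μ i * newtonInt μ m i := by
  have e : oneSubSq ^ (2 * μ) * ((C (3 : ℝ) + C (-6 * (2 * (μ : ℝ) + 5)) * X ^ 2 + C ((2 * (μ : ℝ) + 5) * (2 * μ + 7)) * X ^ 4) ^ 2 * gegen μ m ^ 2) =
      C (16 * ((μ : ℝ) + 1) * (μ + 1) * (μ + 2) * (μ + 2)) * (oneSubSq ^ (2 * μ) * gegen μ m ^ 2)
      + C (-32 * ((μ : ℝ) + 1) * (μ + 2) * (μ + 2) * (2 * μ + 5)) * (oneSubSq ^ (2 * μ + 1) * gegen μ m ^ 2)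
      + C (24 * ((μ : ℝ) + 2) * (μ + 3) * (2 * μ + 3) * (2 * μ + 5)) * (oneSubSq ^ (2 * μ + 2) * gegen μ m ^ 2)
      + C (-8 * ((μ : ℝ) + 2) * (2 * μ + 5) * (2 * μ + 5) * (2 * μ + 7)) * (oneSubSq ^ (2 * μ + 3) * gegen μ m ^ 2)
      + C ((2 * (μ : ℝ) + 5) * (2 * μ + 5) * (2 * μ + 7) * (2 * μ + 7)) * (oneSubSq ^ (2 * μ + 4) * gegen μ m ^ 2) := by
    simp only [map_add, map_mul, map_neg, map_natCast, map_ofNat, map_one, pow_add, oneSubSq]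
    ring
  have h0 := newtonInt_zero μ m
  have h1 := sqInt_expansion_one μ m
  have h2 := sqInt_expansion_two μ m
  have h3 := sqInt_expansion_three μ m
  have h4 := sqInt_expansion_four μ m
  rw [e]
  simp only [map_add, polyInt_C_mul, ← sqInt.eq_1]
  simp only [Finset.sum_range_succ, Finset.sum_range_zero, newtonCoeffFour]
  linear_combination -(256 * ((μ : ℝ) + 1) * (μ + 1) * (μ + 1) * (μ + 2) * (μ + 2) * (μ + 2) * (μ + 3) * (μ + 4)) * h0
    + (-256 * ((μ : ℝ) + 1) * (μ + 2) * (μ + 2) * (μ + 2) * (μ + 3) * (μ + 4) * (2 * μ + 5)) * h1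
    + (96 * ((μ : ℝ) + 2) * (μ + 3) * (μ + 3) * (μ + 4) * (2 * μ + 3) * (2 * μ + 5)) * h2
    + (-16 * ((μ : ℝ) + 2) * (μ + 4) * (2 * μ + 5) * (2 * μ + 5) * (2 * μ + 7)) * h3
    + ((2 * (μ : ℝ) + 5) * (2 * μ + 5) * (2 * μ + 7) * (2 * μ + 7)) * h4

theorem diag_condition_four (μ m : ℕ) (hm : 2 * 4 + 1 ≤ m) :
    0 < freq μ μ m ^ 2 * fourierC μ μ 4 4 4 4
      - 2 * freq μ μ 4 ^ 2 * fourierC μ μ 4 4 m m := by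
  refine diag_condition_of_expansion μ 4 (newtonCoeffFour μ) _ (by positivity) (by positivity)
    (fun i => ?_) (gegen_four μ) (newtonExpansion_four μ) ?_ m hm
  · unfold newtonCoeffFour
    split <;> positivity
  · have e : freq μ μ (2 * 4 + 1) * newtonSum μ (newtonCoeffFour μ) 4 4 -
        2 * freq μ μ 4 * (∏ j ∈ Finset.range (4 + 1), groundRatio μ (4 + j)) *
          newtonSum μ (newtonCoeffFour μ) 4 (2 * 4 + 1) =
        (384 / 7) * ((μ : ℝ) + 3) * ((μ : ℝ) + 4) * (28743399342000 + 123071403514320 * (μ : ℝ) + 218741914841376 * (μ : ℝ) ^ 2 + 218939197779364 * (μ : ℝ) ^ 3 + 139268236349437 * (μ : ℝ) ^ 4 + 59737254823532 * (μ : ℝ) ^ 5 + 17778516819386 * (μ : ℝ) ^ 6 + 3701371802172 * (μ : ℝ) ^ 7 + 533814437361 * (μ : ℝ) ^ 8 + 51687541964 * (μ : ℝ) ^ 9 + 3147639632 * (μ : ℝ) ^ 10 + 105203920 * (μ : ℝ) ^ 11 + 1356976 * (μ : ℝ) ^ 12) /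
          ((4 * (μ : ℝ) + 11) * (4 * (μ : ℝ) + 13) * (4 * (μ : ℝ) + 15) * (4 * (μ : ℝ) + 17) * (4 * (μ : ℝ) + 19) * (4 * (μ : ℝ) + 21) * (4 * (μ : ℝ) + 23) * (4 * (μ : ℝ) + 25) * (4 * (μ : ℝ) + 27)) := by
      simp only [newtonSum, newtonFactor, groundRatio, freq_eq, Finset.sum_range_succ,
        Finset.prod_range_succ, Finset.sum_range_zero, Finset.prod_range_zero, newtonCoeffFour]
      norm_num
      field_simp
      ring
    rw [e]
    positivity

theorem gegen_five (μ : ℕ) : gegen μ 5 =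
    C ((2 * (μ : ℝ) + 1) * (2 * μ + 3) * (2 * μ + 5)) * (C (15 : ℝ) * X + C (-10 * (2 * (μ : ℝ) + 7)) * X ^ 3 + C ((2 * (μ : ℝ) + 7) * (2 * μ + 9)) * X ^ 5) := by
  rw [gegen_recurrence, gegen_four, gegen_three]
  simp only [map_add, map_mul, map_neg, map_natCast, map_ofNat, map_one, Nat.cast_ofNat,
    map_zero, Nat.cast_zero, Nat.cast_one]
  ring

/-- The Newton coefficients that belong to `g_5²`. -/
noncomputable def newtonCoeffFive (μ : ℝ) : ℕ → ℝ
  | 0 => 15 * (3047 + 7216 * μ + 5184 * μ ^ 2 + 1408 * μ ^ 3 + 128 * μ ^ 4)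
  | 1 => 75 * (2 * μ + 1) * (7167 + 11560 * μ + 6528 * μ ^ 2 + 1536 * μ ^ 3 + 128 * μ ^ 4)
  | 2 => 1350 * (2 * μ + 1) * (2 * μ + 3) * (2 * μ + 7) * (4 * μ + 11) * (97 + 58 * μ + 8 * μ ^ 2)
  | 3 => 2250 * (2 * μ + 1) * (2 * μ + 3) * (2 * μ + 5) * (2 * μ + 7) * (8201 + 6678 * μ + 1800 * μ ^ 2 + 160 * μ ^ 3)
  | 4 => 55125 * (2 * μ + 1) * (2 * μ + 3) * (2 * μ + 5) * (2 * μ + 7) * (2 * μ + 7) * (2 * μ + 7) * (2 * μ + 9) * (41 + 10 * μ)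
  | 5 => 893025 * (2 * μ + 1) * (2 * μ + 3) * (2 * μ + 5) * (2 * μ + 7) * (2 * μ + 7) * (2 * μ + 7) * (2 * μ + 9) * (2 * μ + 9) * (2 * μ + 9)
  | _ => 0

theorem newtonExpansion_five (μ m : ℕ) :
    (32 * (μ + 1) * (μ + 2) * (μ + 3) * (μ + 4) * (μ + 5) : ℝ) * polyInt (oneSubSq ^ (2 * μ) *
      ((C (15 : ℝ) * X + C (-10 * (2 * (μ : ℝ) + 7)) * X ^ 3 + C ((2 * (μ : ℝ) + 7) * (2 * μ + 9)) * X ^ 5) ^ 2 * gegen μ m ^ 2)) =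
      ∑ i ∈ Finset.range (5 + 1), newtonCoeffFive μ i * newtonInt μ m i := by
  have e : oneSubSq ^ (2 * μ) * ((C (15 : ℝ) * X + C (-10 * (2 * (μ : ℝ) + 7)) * X ^ 3 + C ((2 * (μ : ℝ) + 7) * (2 * μ + 9)) * X ^ 5) ^ 2 * gegen μ m ^ 2) =
      C (16 * ((μ : ℝ) + 1) * (μ + 1) * (μ + 2) * (μ + 2)) * (oneSubSq ^ (2 * μ) * gegen μ m ^ 2)
      + C (-80 * ((μ : ℝ) + 1) * (μ + 2) * (μ + 2) * (μ + 3)) * (oneSubSq ^ (2 * μ + 1) * gegen μ m ^ 2)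
      + C (40 * ((μ : ℝ) + 2) * (μ + 3) * (2 * μ + 3) * (2 * μ + 7)) * (oneSubSq ^ (2 * μ + 2) * gegen μ m ^ 2)
      + C (-40 * ((μ : ℝ) + 2) * (μ + 4) * (2 * μ + 5) * (2 * μ + 7)) * (oneSubSq ^ (2 * μ + 3) * gegen μ m ^ 2)
      + C (5 * (2 * (μ : ℝ) + 5) * (2 * μ + 7) * (2 * μ + 7) * (2 * μ + 9)) * (oneSubSq ^ (2 * μ + 4) * gegen μ m ^ 2)
      + C (-(2 * (μ : ℝ) + 7) * (2 * μ + 7) * (2 * μ + 9) * (2 * μ + 9)) * (oneSubSq ^ (2 * μ + 5) * gegen μ m ^ 2) := by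
    simp only [map_add, map_mul, map_neg, map_natCast, map_ofNat, map_one, pow_add, oneSubSq]
    ring
  have h0 := newtonInt_zero μ m
  have h1 := sqInt_expansion_one μ m
  have h2 := sqInt_expansion_two μ m
  have h3 := sqInt_expansion_three μ m
  have h4 := sqInt_expansion_four μ m
  have h5 := sqInt_expansion_five μ m
  rw [e]
  simp only [map_add, polyInt_C_mul, ← sqInt.eq_1]
  simp only [Finset.sum_range_succ, Finset.sum_range_zero, newtonCoeffFive]
  linear_combination -(512 * ((μ : ℝ) + 1) * (μ + 1) * (μ + 1) * (μ + 2) * (μ + 2) * (μ + 2) * (μ + 3) * (μ + 4) * (μ + 5)) * h0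
    + (-1280 * ((μ : ℝ) + 1) * (μ + 2) * (μ + 2) * (μ + 2) * (μ + 3) * (μ + 3) * (μ + 4) * (μ + 5)) * h1
    + (320 * ((μ : ℝ) + 2) * (μ + 3) * (μ + 3) * (μ + 4) * (μ + 5) * (2 * μ + 3) * (2 * μ + 7)) * h2
    + (-160 * ((μ : ℝ) + 2) * (μ + 4) * (μ + 4) * (μ + 5) * (2 * μ + 5) * (2 * μ + 7)) * h3
    + (10 * ((μ : ℝ) + 5) * (2 * μ + 5) * (2 * μ + 7) * (2 * μ + 7) * (2 * μ + 9)) * h4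
    + (-(2 * (μ : ℝ) + 7) * (2 * μ + 7) * (2 * μ + 9) * (2 * μ + 9)) * h5

theorem diag_condition_five (μ m : ℕ) (hm : 2 * 5 + 1 ≤ m) :
    0 < freq μ μ m ^ 2 * fourierC μ μ 5 5 5 5
      - 2 * freq μ μ 5 ^ 2 * fourierC μ μ 5 5 m m := by
  refine diag_condition_of_expansion μ 5 (newtonCoeffFive μ) _ (by positivity) (by positivity)
    (fun i => ?_) (gegen_five μ) (newtonExpansion_five μ) ?_ m hm
  · unfold newtonCoeffFive
    split <;> positivity
  · have e : freq μ μ (2 * 5 + 1) * newtonSum μ (newtonCoeffFive μ) 5 5 -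
        2 * freq μ μ 5 * (∏ j ∈ Finset.range (5 + 1), groundRatio μ (5 + j)) *
          newtonSum μ (newtonCoeffFive μ) 5 (2 * 5 + 1) =
        (1280 / 21) * ((μ : ℝ) + 3) * ((μ : ℝ) + 4) * ((μ : ℝ) + 5) * (144130832914677840 + 573415361640328464 * (μ : ℝ) + 925145763757356168 * (μ : ℝ) ^ 2 + 833556133791216048 * (μ : ℝ) ^ 3 + 478006893535572929 * (μ : ℝ) ^ 4 + 186534809152034505 * (μ : ℝ) ^ 5 + 51338296942950504 * (μ : ℝ) ^ 6 + 10130496037935400 * (μ : ℝ) ^ 7 + 1435345167593331 * (μ : ℝ) ^ 8 + 144059743851111 * (μ : ℝ) ^ 9 + 9912261657988 * (μ : ℝ) ^ 10 + 438590656272 * (μ : ℝ) ^ 11 + 10967419200 * (μ : ℝ) ^ 12 + 111886160 * (μ : ℝ) ^ 13) /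
          ((4 * (μ : ℝ) + 13) * (4 * (μ : ℝ) + 15) * (4 * (μ : ℝ) + 17) * (4 * (μ : ℝ) + 19) * (4 * (μ : ℝ) + 21) * (4 * (μ : ℝ) + 23) * (4 * (μ : ℝ) + 25) * (4 * (μ : ℝ) + 27) * (4 * (μ : ℝ) + 29) * (4 * (μ : ℝ) + 31) * (4 * (μ : ℝ) + 33)) := by
      simp only [newtonSum, newtonFactor, groundRatio, freq_eq, Finset.sum_range_succ,
        Finset.prod_range_succ, Finset.sum_range_zero, Finset.prod_range_zero, newtonCoeffFive]
      norm_num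
      field_simp
      ring
    rw [e]
    positivity
end HopfCubicWave

/-! ### The determinants D_{γn} as integer polynomials in μ -/

namespace HopfCubicWave

open Polynomial

section ListPolynomials

variable {R S : Type*} [CommRing R] [CommRing S]

/-- Addition of polynomials given by their lists of coefficients. -/
def addList : List R → List R → List R
  | [], t => t
  | a :: s, [] => a :: s
  | a :: s, b :: t => (a + b) :: addList s t

/-- Multiplication of polynomials given by their lists of coefficients. -/
def mulList : List R → List R → List R
  | [], _ => []
  | a :: s, t => addList (t.map (a * ·)) (0 :: mulList s t)

/-- The coefficients of two consecutive Gegenbauer polynomials with parameter `m`; a list `l`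
stands for the polynomial `∑ l_k y^(2 k)`, multiplied by `y` if the degree is odd. -/
def gegenListPair (m : R) : ℕ → List R × List R
  | 0 => ([1], [2 * m + 1])
  | n + 1 =>
    ((gegenListPair m n).2,
      addList (List.replicate ((n + 1) % 2) 0 ++
          (gegenListPair m n).2.map (((2 * n + 3 : ℕ) + 2 * m) * ·))
        ((gegenListPair m n).1.map (-(((n + 1 : ℕ) : R) * ((n + 1 : ℕ) + 2 * m)) * ·)))

/-- The coefficients of the Gegenbauer polynomial with parameter `m`. -/
def gegenList (m : R) (n : ℕ) : List R := (gegenListPair m n).1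

/-- Numerator and denominator of the mean of `y^(2 k) p(y²)` with respect to the weight
`(1 - y²)^(2 m)`, relative to the mean of `y^(2 k)`. -/
def momentList (m : R) : ℕ → List R → R × R
  | _, [] => (0, 1)
  | k, a :: t =>
    (a * (((2 * k + 3 : ℕ) + 4 * m) * (momentList m (k + 1) t).2)
      + (2 * k + 1 : ℕ) * (momentList m (k + 1) t).1,
      ((2 * k + 3 : ℕ) + 4 * m) * (momentList m (k + 1) t).2)

/-- The mean of a product of four Gegenbauer polynomials as a fraction. -/
def quadMoment (m : R) (i j k l : ℕ) : R × R :=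
  momentList m 0 (List.replicate ((i % 2 + j % 2 + k % 2 + l % 2) / 2) 0 ++
    mulList (mulList (gegenList m i) (gegenList m j)) (mulList (gegenList m k) (gegenList m l)))

/-- The squared norm of the Gegenbauer polynomial, up to the factor `2 n + 2 m + 1`. -/
def normProd (m : R) : ℕ → R
  | 0 => 1
  | n + 1 => normProd m n * (((n + 1 : ℕ) : R) * ((n + 1 : ℕ) + 2 * m))

/-- The factor `2 ω_γ ρ_γ` or `ω_n ρ_n` of the determinant. -/
def freqNorm (m : R) (n : ℕ) : R := ((2 * n + 1 : ℕ) + 2 * m) * normProd m n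

/-- The determinant `D_{γ n}` up to a nonzero factor, as a polynomial in the parameter. -/
def detList (m : R) (γ n : ℕ) : R :=
  (freqNorm m n * (quadMoment m γ γ γ γ).1 * (quadMoment m γ γ n n).2
      - 2 * freqNorm m γ * (quadMoment m γ γ n n).1 * (quadMoment m γ γ γ γ).2)
    * (freqNorm m (2 * γ - n) * (quadMoment m γ γ γ γ).1
        * (quadMoment m γ γ (2 * γ - n) (2 * γ - n)).2
      - 2 * freqNorm m γ * (quadMoment m γ γ (2 * γ - n) (2 * γ - n)).1
        * (quadMoment m γ γ γ γ).2) * (quadMoment m γ (2 * γ - n) γ n).2 ^ 2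
    - (freqNorm m γ * (quadMoment m γ (2 * γ - n) γ n).1) ^ 2 * (quadMoment m γ γ γ γ).2 ^ 2
      * (quadMoment m γ γ n n).2 * (quadMoment m γ γ (2 * γ - n) (2 * γ - n)).2

theorem map_addList (f : R →+* S) (s t : List R) :
    (addList s t).map f = addList (s.map f) (t.map f) := by
  induction s generalizing t with
  | nil => simp [addList]
  | cons a s ih => cases t <;> simp [addList, ih]

theorem map_mulList (f : R →+* S) (s t : List R) :
    (mulList s t).map f = mulList (s.map f) (t.map f) := by
  induction s with
  | nil => simp [mulList]
  | cons a s ih => simp [mulList, map_addList, ih, Function.comp_def]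

theorem map_gegenListPair (f : R →+* S) (m : R) (n : ℕ) :
    (gegenListPair m n).1.map f = (gegenListPair (f m) n).1 ∧
    (gegenListPair m n).2.map f = (gegenListPair (f m) n).2 := by
  induction n with
  | zero => simp [gegenListPair, map_ofNat]
  | succ n ih =>
    refine ⟨ih.2, ?_⟩
    simp [gegenListPair, map_addList, ← ih.1, ← ih.2, Function.comp_def, map_ofNat]

theorem map_gegenList (f : R →+* S) (m : R) (n : ℕ) :
    (gegenList m n).map f = gegenList (f m) n := (map_gegenListPair f m n).1

theorem map_momentList (f : R →+* S) (m : R) (k : ℕ) (l : List R) :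
    f (momentList m k l).1 = (momentList (f m) k (l.map f)).1 ∧
    f (momentList m k l).2 = (momentList (f m) k (l.map f)).2 := by
  fun_induction momentList m k l with
  | case1 k => simp [momentList]
  | case2 k a t ih => simp [momentList, ih.1, ih.2, map_ofNat]

theorem map_quadMoment (f : R →+* S) (m : R) (i j k l : ℕ) :
    f (quadMoment m i j k l).1 = (quadMoment (f m) i j k l).1 ∧
    f (quadMoment m i j k l).2 = (quadMoment (f m) i j k l).2 := by
  have := map_momentList f m 0 (List.replicate ((i % 2 + j % 2 + k % 2 + l % 2) / 2) 0 ++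
    mulList (mulList (gegenList m i) (gegenList m j)) (mulList (gegenList m k) (gegenList m l)))
  simpa only [quadMoment, List.map_append, List.map_replicate, map_zero, map_mulList,
    map_gegenList] using this

theorem map_normProd (f : R →+* S) (m : R) (n : ℕ) : f (normProd m n) = normProd (f m) n := by
  induction n with
  | zero => simp [normProd]
  | succ n ih => simp [normProd, ih, map_ofNat]

theorem map_freqNorm (f : R →+* S) (m : R) (n : ℕ) : f (freqNorm m n) = freqNorm (f m) n := by
  simp [freqNorm, map_normProd, map_ofNat]

/-- Compatibility with ring homomorphisms lets one definition serve three purposes: evaluation over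
ℤ, a polynomial over ℤ[X], and the real determinant. -/
theorem map_detList (f : R →+* S) (m : R) (γ n : ℕ) : f (detList m γ n) = detList (f m) γ n := by
  simp only [detList, map_sub, map_mul, map_pow, map_ofNat, map_freqNorm,
    (map_quadMoment f m _ _ _ _).1, (map_quadMoment f m _ _ _ _).2]

end ListPolynomials

-- A finite computation with 90 integers, carried out by the kernel.
set_option maxRecDepth 100000 in
theorem detList_ne_zero_of_small : ∀ μ : ℕ, μ < 6 → ∀ γ : ℕ, γ < 6 → ∀ n : ℕ, n < γ →
    detList (μ : ℤ) γ n ≠ 0 := by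
  decide +kernel

/-- The even polynomial `∑ l_k y^(2 k)`. -/
noncomputable def evenPoly : List ℝ → ℝ[X]
  | [] => 0
  | a :: t => C a + X ^ 2 * evenPoly t

theorem evenPoly_addList (s t : List ℝ) :
    evenPoly (addList s t) = evenPoly s + evenPoly t := by
  induction s generalizing t with
  | nil => simp [addList, evenPoly]
  | cons a s ih =>
    cases t with
    | nil => simp [addList, evenPoly]
    | cons b t => simp only [addList, evenPoly, ih, C_add]; ring

theorem evenPoly_map_mul (c : ℝ) (s : List ℝ) :
    evenPoly (s.map (c * ·)) = C c * evenPoly s := by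
  induction s with
  | nil => simp [evenPoly]
  | cons a s ih => simp only [List.map_cons, evenPoly, ih, C_mul]; ring

theorem evenPoly_mulList (s t : List ℝ) :
    evenPoly (mulList s t) = evenPoly s * evenPoly t := by
  induction s with
  | nil => simp [mulList, evenPoly]
  | cons a s ih =>
    simp only [mulList, evenPoly, evenPoly_addList, evenPoly_map_mul, ih, C_0]
    ring

theorem evenPoly_replicate_append (k : ℕ) (s : List ℝ) :
    evenPoly (List.replicate k 0 ++ s) = X ^ (2 * k) * evenPoly s := by
  induction k with
  | zero => simp
  | succ k ih =>
    simp only [List.replicate_succ, List.cons_append, evenPoly, ih, C_0]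
    ring

theorem gegen_eq_evenPoly (μ n : ℕ) :
    gegen μ n = X ^ (n % 2) * evenPoly (gegenListPair (μ : ℝ) n).1 ∧
    gegen μ (n + 1) = X ^ ((n + 1) % 2) * evenPoly (gegenListPair (μ : ℝ) n).2 := by
  induction n with
  | zero => simp [gegen, gegenListPair, evenPoly, mul_comm]
  | succ n ih =>
    refine ⟨ih.2, ?_⟩
    rw [gegen_recurrence, ih.1, ih.2]
    simp only [gegenListPair, evenPoly_addList, evenPoly_replicate_append, evenPoly_map_mul]
    -- Multiplying y p(y²) by y gives y² p(y²), which is the zero prepended in `gegenListPair`; an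
    -- even polynomial only gains the parity factor y.
    rcases Nat.mod_two_eq_zero_or_one n with h | h
    · have h1 : (n + 1) % 2 = 1 := by omega
      have h2 : (n + 1 + 1) % 2 = 0 := by omega
      rw [h, h1, h2]
      simp only [map_add, map_mul, map_neg, map_natCast, map_ofNat, map_one, Nat.cast_add,
        Nat.cast_mul, Nat.cast_ofNat, Nat.cast_one]
      ring
    · have h1 : (n + 1) % 2 = 0 := by omega
      have h2 : (n + 1 + 1) % 2 = 1 := by omega
      rw [h, h1, h2]
      simp only [map_add, map_mul, map_neg, map_natCast, map_ofNat, map_one, Nat.cast_add,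
        Nat.cast_mul, Nat.cast_ofNat, Nat.cast_one]
      ring

/-- Integration of the derivative of (1-y²)^(2μ+1) y^(2k+1). All even moments thus become rational
in μ relative to the total mass, as encoded in `momentList`. -/
theorem polyInt_X_pow_succ (μ k : ℕ) :
    ((2 * k + 3 : ℕ) + 4 * (μ : ℝ)) * polyInt (oneSubSq ^ (2 * μ) * X ^ (2 * (k + 1))) =
      (2 * k + 1 : ℕ) * polyInt (oneSubSq ^ (2 * μ) * X ^ (2 * k)) := by
  have h := polyInt_derivative_oneSubSq_mul (2 * μ) (X ^ (2 * k + 1))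
  have h2 : derivative (oneSubSq ^ (2 * μ + 1) * X ^ (2 * k + 1)) =
      C (2 * (k : ℝ) + 1) * (oneSubSq ^ (2 * μ) * X ^ (2 * k))
      - C (2 * (k : ℝ) + 3 + 4 * μ) * (oneSubSq ^ (2 * μ) * X ^ (2 * (k + 1))) := by
    rw [derivative_mul, derivative_oneSubSq_pow, derivative_X_pow]
    simp only [map_add, map_mul, map_neg, map_natCast, map_ofNat, map_one, Nat.cast_add,
      Nat.cast_mul, Nat.cast_ofNat, Nat.cast_one, Nat.add_sub_cancel, pow_succ _ (2 * μ)]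
    linear_combination (2 * (k : ℝ[X]) + 1) * oneSubSq ^ (2 * μ) * X ^ (2 * k) * X_sq_eq
  rw [h2, map_sub, polyInt_C_mul, polyInt_C_mul] at h
  push_cast
  linarith

theorem momentList_den_pos (μ k : ℕ) (l : List ℝ) : 0 < (momentList (μ : ℝ) k l).2 := by
  fun_induction momentList (μ : ℝ) k l with
  | case1 k => norm_num
  | case2 k a t ih => simp only; positivity

theorem polyInt_evenPoly (μ k : ℕ) (l : List ℝ) :
    polyInt (oneSubSq ^ (2 * μ) * (X ^ (2 * k) * evenPoly l)) * (momentList (μ : ℝ) k l).2 =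
      (momentList (μ : ℝ) k l).1 * polyInt (oneSubSq ^ (2 * μ) * X ^ (2 * k)) := by
  fun_induction momentList (μ : ℝ) k l with
  | case1 k => simp [evenPoly]
  | case2 k a t ih =>
    have h := polyInt_X_pow_succ μ k
    have e : oneSubSq ^ (2 * μ) * (X ^ (2 * k) * evenPoly (a :: t)) =
        C a * (oneSubSq ^ (2 * μ) * X ^ (2 * k))
        + oneSubSq ^ (2 * μ) * (X ^ (2 * (k + 1)) * evenPoly t) := by
      rw [evenPoly]; ring
    rw [e, map_add, polyInt_C_mul]
    simp only
    linear_combination ((2 * k + 3 : ℕ) + 4 * (μ : ℝ)) * ih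
      + (momentList (μ : ℝ) (k + 1) t).1 * h

theorem polyInt_quad (μ i j k l : ℕ) (h : (i + j + k + l) % 2 = 0) :
    polyInt (oneSubSq ^ (2 * μ) * (gegen μ i * gegen μ j * gegen μ k * gegen μ l)) =
      (quadMoment (μ : ℝ) i j k l).1 / (quadMoment (μ : ℝ) i j k l).2 * sqInt μ 0 (2 * μ) := by
  have h0 := momentList_den_pos μ 0 (List.replicate ((i % 2 + j % 2 + k % 2 + l % 2) / 2) 0 ++
    mulList (mulList (gegenList (μ : ℝ) i) (gegenList μ j))
      (mulList (gegenList μ k) (gegenList μ l)))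
  have h1 := polyInt_evenPoly μ 0 (List.replicate ((i % 2 + j % 2 + k % 2 + l % 2) / 2) 0 ++
    mulList (mulList (gegenList (μ : ℝ) i) (gegenList μ j))
      (mulList (gegenList μ k) (gegenList μ l)))
  rw [evenPoly_replicate_append, evenPoly_mulList, evenPoly_mulList, evenPoly_mulList] at h1
  -- Since the total degree is even, the leftover factors y pair up into powers of y², and the
  -- halving loses nothing.
  have h2 : 2 * ((i % 2 + j % 2 + k % 2 + l % 2) / 2) = i % 2 + j % 2 + k % 2 + l % 2 := by
    omega
  have h3 : gegen μ i * gegen μ j * gegen μ k * gegen μ l = X ^ (2 * 0) *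
      (X ^ (2 * ((i % 2 + j % 2 + k % 2 + l % 2) / 2)) *
      (evenPoly (gegenList (μ : ℝ) i) * evenPoly (gegenList (μ : ℝ) j) *
        (evenPoly (gegenList (μ : ℝ) k) * evenPoly (gegenList (μ : ℝ) l)))) := by
    rw [h2, (gegen_eq_evenPoly μ i).1, (gegen_eq_evenPoly μ j).1, (gegen_eq_evenPoly μ k).1,
      (gegen_eq_evenPoly μ l).1]
    simp only [gegenList, pow_add]
    ring
  have h4 : sqInt μ 0 (2 * μ) = polyInt (oneSubSq ^ (2 * μ) * X ^ (2 * 0)) := by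
    simp [sqInt, gegen]
  rw [h3, h4, div_mul_eq_mul_div, eq_div_iff (show (quadMoment (μ : ℝ) i j k l).2 ≠ 0 from h0.ne')]
  exact h1

theorem normProd_pos (μ n : ℕ) : 0 < normProd (μ : ℝ) n := by
  induction n with
  | zero => simp [normProd]
  | succ n ih => rw [normProd]; positivity

theorem gegenNorm_sq_eq (μ n : ℕ) :
    gegenNorm μ n ^ 2 =
      gegenNorm μ 0 ^ 2 / freq μ μ 0 * (freq μ μ n / normProd (μ : ℝ) n) := by
  have h0 := freq_pos μ 0
  induction n with
  | zero => simp only [normProd]; field_simp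
  | succ n ih =>
    have h := gegenNorm_sq_succ μ n
    rw [ih] at h
    have h1 := freq_pos μ n
    have h2 := normProd_pos μ n
    have h3 : (0 : ℝ) < (n : ℝ) + 2 * μ + 1 := by positivity
    rw [normProd]
    push_cast
    field_simp at h ⊢
    linear_combination h

/-- Every N_k² is a common constant times ω_k/ρ_k with ρ_k = `normProd`, and every integral is a
fraction times the same mass. All normalizations and denominators therefore leave the determinant as
one nonzero factor. -/
theorem detD_ne_zero_of_detList (μ γ n : ℕ) (hn : n < γ) (h : detList (μ : ℝ) γ n ≠ 0) :
    detD μ μ γ n ≠ 0 := by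
  intro h0
  apply h
  have hM := (sqInt_pos μ (2 * μ)).ne'
  have hN := (gegenNorm_pos μ 0).ne'
  have hγ := gegenNorm_sq_eq μ γ
  have hn' := gegenNorm_sq_eq μ n
  have hq := gegenNorm_sq_eq μ (2 * γ - n)
  have p0 := (freq_pos μ 0).ne'
  have p1 := (freq_pos μ γ).ne'
  have p2 := (freq_pos μ n).ne'
  have p3 := (freq_pos μ (2 * γ - n)).ne'
  have r1 := (normProd_pos μ γ).ne'
  have r2 := (normProd_pos μ n).ne'
  have r3 := (normProd_pos μ (2 * γ - n)).ne'
  have hf : ∀ k : ℕ, freqNorm (μ : ℝ) k = freq μ μ k * normProd (μ : ℝ) k := by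
    intro k
    rw [freqNorm, freq_eq]
    push_cast
    ring
  have d1 : (quadMoment (μ : ℝ) γ γ γ γ).2 ≠ 0 := (momentList_den_pos μ _ _).ne'
  have d2 : (quadMoment (μ : ℝ) γ γ n n).2 ≠ 0 := (momentList_den_pos μ _ _).ne'
  have d3 : (quadMoment (μ : ℝ) γ γ (2 * γ - n) (2 * γ - n)).2 ≠ 0 :=
    (momentList_den_pos μ _ _).ne'
  have d4 : (quadMoment (μ : ℝ) γ (2 * γ - n) γ n).2 ≠ 0 := (momentList_den_pos μ _ _).ne'
  rw [detD] at h0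
  simp only [fourierC_eq] at h0
  rw [polyInt_quad μ γ γ γ γ (by omega), polyInt_quad μ γ γ n n (by omega),
    polyInt_quad μ γ γ (2 * γ - n) (2 * γ - n) (by omega),
    polyInt_quad μ γ (2 * γ - n) γ n (by omega)] at h0
  rw [detList, hf, hf, hf]
  generalize quadMoment (μ : ℝ) γ γ γ γ = I1 at *
  generalize quadMoment (μ : ℝ) γ γ n n = I2 at *
  generalize quadMoment (μ : ℝ) γ γ (2 * γ - n) (2 * γ - n) = I3 at *
  generalize quadMoment (μ : ℝ) γ (2 * γ - n) γ n = I4 at *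
  generalize normProd (μ : ℝ) γ = ργ at *
  generalize normProd (μ : ℝ) n = ρn at *
  generalize normProd (μ : ℝ) (2 * γ - n) = ρq at *
  generalize gegenNorm μ (2 * γ - n) = Nq at *
  generalize gegenNorm μ n = Nn at *
  have hNγ := (gegenNorm_pos μ γ).ne'
  generalize gegenNorm μ γ = Nγ at *
  generalize sqInt μ 0 (2 * μ) = M at *
  generalize freq μ μ (2 * γ - n) = wq at *
  generalize freq μ μ n = wn at *
  generalize freq μ μ γ = wγ at *
  have hc : gegenNorm μ 0 ^ 2 / freq μ μ 0 ≠ 0 := by positivity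
  generalize gegenNorm μ 0 ^ 2 / freq μ μ 0 = c at *
  have e : (1 / 4 * M ^ 2 * (Nγ ^ 2) ^ 2) *
      ((wn ^ 2 * Nγ ^ 2 * (I1.1 / I1.2) - 2 * wγ ^ 2 * Nn ^ 2 * (I2.1 / I2.2))
        * (wq ^ 2 * Nγ ^ 2 * (I1.1 / I1.2) - 2 * wγ ^ 2 * Nq ^ 2 * (I3.1 / I3.2))
        - wγ ^ 4 * Nn ^ 2 * Nq ^ 2 * (I4.1 / I4.2) ^ 2) = 0 := by
    rw [← h0]; ring
  have e2 := (mul_eq_zero.mp e).resolve_left (by positivity)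
  rw [hγ, hn', hq] at e2
  have e3 : (c ^ 2 * wγ ^ 2 * wn * wq / (ργ ^ 2 * ρn * ρq * I1.2 ^ 2 * I2.2 * I3.2 * I4.2 ^ 2)) *
      ((wn * ρn * I1.1 * I2.2 - 2 * (wγ * ργ) * I2.1 * I1.2)
        * (wq * ρq * I1.1 * I3.2 - 2 * (wγ * ργ) * I3.1 * I1.2) * I4.2 ^ 2
        - (wγ * ργ * I4.1) ^ 2 * I1.2 ^ 2 * I2.2 * I3.2) = 0 := by
    rw [← e2]
    field_simp
  exact (mul_eq_zero.mp e3).resolve_left (by positivity)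

/-- Taking the indeterminate as parameter gives a polynomial over ℤ; a single nonzero value shows
that it is not zero, so it has finitely many roots. -/
theorem eventually_detList_ne_zero (γ n : ℕ) (h : detList (0 : ℤ) γ n ≠ 0) :
    ∀ᶠ μ : ℕ in Filter.atTop, detList (μ : ℤ) γ n ≠ 0 := by
  set p : ℤ[X] := detList X γ n with hp
  have hev : ∀ z : ℤ, p.eval z = detList z γ n := by
    intro z
    have := map_detList (evalRingHom z) X γ n
    simpa using this
  have hp0 : p ≠ 0 := by
    intro h0
    apply h
    rw [← hev, h0, eval_zero]
  rw [← Nat.cofinite_eq_atTop, Filter.eventually_cofinite]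
  have hfin : {z : ℤ | p.IsRoot z}.Finite := finite_setOfPred_isRoot hp0
  refine (hfin.preimage (Nat.cast_injective.injOn (s := Set.univ) |>.mono
    (Set.subset_univ _))).subset fun μ hμ => ?_
  simp only [Set.mem_ofPred_eq, not_not] at hμ
  simp only [Set.mem_preimage, Set.mem_ofPred_eq, IsRoot.def]
  rw [hev]
  exact hμ

theorem exists_detD_ne_zero :
    ∃ μ₀ : ℕ, ∀ γ μ : ℕ, γ ≤ 5 → (μ ≤ 5 ∨ μ₀ ≤ μ) → ∀ n : ℕ, n < γ → detD μ μ γ n ≠ 0 := by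
  have h : ∀ᶠ μ : ℕ in Filter.atTop, ∀ γ ∈ Finset.range 6, ∀ n ∈ Finset.range γ,
      detList (μ : ℤ) γ n ≠ 0 := by
    rw [Filter.eventually_all_finset]
    intro γ hγ
    rw [Filter.eventually_all_finset]
    intro n hn
    refine eventually_detList_ne_zero γ n ?_
    exact_mod_cast detList_ne_zero_of_small 0 (by norm_num) γ (Finset.mem_range.mp hγ) n
      (Finset.mem_range.mp hn)
  obtain ⟨μ₀, hμ₀⟩ := Filter.eventually_atTop.mp h
  refine ⟨μ₀, fun γ μ hγ hμ n hn => detD_ne_zero_of_detList μ γ n hn ?_⟩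
  have h1 : detList (μ : ℤ) γ n ≠ 0 := by
    rcases hμ with hμ | hμ
    · exact detList_ne_zero_of_small μ (by omega) γ (by omega) n hn
    · exact hμ₀ μ hμ γ (Finset.mem_range.mpr (by omega)) n (Finset.mem_range.mpr hn)
  have h2 := map_detList (Int.castRingHom ℝ) (μ : ℤ) γ n
  have h3 : Int.castRingHom ℝ (μ : ℤ) = (μ : ℝ) := by simp
  rw [h3] at h2
  rw [← h2]
  simpa using h1

end HopfCubicWave

/-! ### Weighted sequence spaces and bounded trilinear maps -/

namespace HopfCubicWave

/-- The `ℓ²` norm of `j ↦ (1 + j)⁻¹`. -/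
noncomputable def harmonicNorm : ℝ := Real.sqrt (∑' j : ℕ, ((1 + (j : ℝ))⁻¹) ^ 2)

theorem harmonicNorm_nonneg : 0 ≤ harmonicNorm := Real.sqrt_nonneg _

theorem summable_inv_one_add_sq : Summable fun j : ℕ => ((1 + (j : ℝ))⁻¹) ^ 2 := by
  have h := (summable_nat_add_iff (f := fun j : ℕ => ((j : ℝ) ^ 2)⁻¹) 1).mpr
    (Real.summable_nat_pow_inv.mpr one_lt_two)
  refine h.congr fun j => ?_
  push_cast
  rw [inv_pow, add_comm]

theorem SeqSpace.hasSum_sq {r : ℕ} (u : SeqSpace r) :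
    HasSum (fun j : ℕ => ((1 + (j : ℝ)) ^ r * u.seq j) ^ 2) (‖u‖ ^ 2) := by
  have h := lp.hasSum_norm (p := 2) (by norm_num) (SeqSpace.toLp r u)
  have e : ‖SeqSpace.toLp r u‖ = ‖u‖ := rfl
  rw [e] at h
  simpa [SeqSpace.toLp, -abs_mul, -abs_pow, -norm_mul, -norm_pow] using h

/-- Cauchy–Schwarz against (1+j)⁻¹: one power of the weight buys the passage from ℓ² to ℓ¹. -/
theorem SeqSpace.summable_weighted {q : ℕ} (u : SeqSpace (q + 2)) :
    Summable (fun j : ℕ => (1 + (j : ℝ)) ^ (q + 1) * |u.seq j|) ∧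
      ∑' j : ℕ, (1 + (j : ℝ)) ^ (q + 1) * |u.seq j| ≤ harmonicNorm * ‖u‖ := by
  have hu := u.hasSum_sq
  have key := Real.summable_and_inner_le_Lp_mul_Lq_tsum_of_nonneg
    (f := fun j : ℕ => (1 + (j : ℝ))⁻¹)
    (g := fun j : ℕ => |(1 + (j : ℝ)) ^ (q + 2) * u.seq j|) (p := 2) (q := 2)
    Real.HolderConjugate.two_two (fun j => by positivity) (fun j => abs_nonneg _)
    (by simpa using summable_inv_one_add_sq) (by simpa [-abs_mul, -abs_pow] using hu.summable)
  have e : (fun j : ℕ => (1 + (j : ℝ))⁻¹ * |(1 + (j : ℝ)) ^ (q + 2) * u.seq j|)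
      = fun j : ℕ => (1 + (j : ℝ)) ^ (q + 1) * |u.seq j| := by
    funext j
    have hj : (0 : ℝ) < 1 + (j : ℝ) := by positivity
    rw [abs_mul, abs_of_pos (pow_pos hj _)]
    field_simp
    ring
  rw [e] at key
  refine ⟨key.1, key.2.trans (le_of_eq ?_)⟩
  have e2 : (∑' j : ℕ, |(1 + (j : ℝ)) ^ (q + 2) * u.seq j| ^ (2 : ℝ)) = ‖u‖ ^ 2 := by
    simpa [-abs_mul, -abs_pow] using hu.tsum_eq
  rw [e2, ← Real.sqrt_eq_rpow, ← Real.sqrt_eq_rpow, Real.sqrt_sq (norm_nonneg _), harmonicNorm]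
  simp

theorem sq_weighted_le {q : ℕ} {v : ℕ → ℝ} {B : ℝ}
    (hv : ∀ m, |v m| * (1 + (m : ℝ)) ^ (q + 1) ≤ B) (m : ℕ) :
    ((1 + (m : ℝ)) ^ q * v m) ^ 2 ≤ B ^ 2 * ((1 + (m : ℝ))⁻¹) ^ 2 := by
  have hm : (0 : ℝ) < 1 + (m : ℝ) := by positivity
  rw [← mul_pow, sq_le_sq, abs_mul, abs_of_pos (pow_pos hm q)]
  refine le_trans ?_ (le_abs_self _)
  rw [le_mul_inv_iff₀ hm]
  refine le_trans (le_of_eq ?_) (hv m)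
  ring

/-- The second power of the weight is spent here, on passing from a pointwise bound with weight q +
1 to ℓ² with weight q. Hence the loss from q + 2 to q, the same as for the operator u ↦ ω_m² u^m. -/
theorem mem_weightedSubmodule {q : ℕ} {v : ℕ → ℝ} {B : ℝ}
    (hv : ∀ m, |v m| * (1 + (m : ℝ)) ^ (q + 1) ≤ B) : v ∈ weightedSubmodule q := by
  refine memℓp_gen ?_
  have h := Summable.of_nonneg_of_le (fun m => sq_nonneg _) (sq_weighted_le hv)
    (summable_inv_one_add_sq.mul_left (B ^ 2))
  simpa [-abs_mul, -abs_pow, -norm_mul, -norm_pow] using h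

theorem SeqSpace.norm_le {q : ℕ} {v : SeqSpace q} {B : ℝ} (hB : 0 ≤ B)
    (hv : ∀ m, |v.seq m| * (1 + (m : ℝ)) ^ (q + 1) ≤ B) : ‖v‖ ≤ harmonicNorm * B := by
  have h := hasSum_le (sq_weighted_le hv) v.hasSum_sq
    (summable_inv_one_add_sq.hasSum.mul_left (B ^ 2))
  rw [harmonicNorm, ← abs_of_nonneg (norm_nonneg v), ← Real.sqrt_sq hB,
    ← Real.sqrt_mul (tsum_nonneg fun j => sq_nonneg _), ← Real.sqrt_sq_eq_abs]
  exact Real.sqrt_le_sqrt (by rw [mul_comm]; exact h)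

/-- The element of `l²_r` with a given underlying sequence. -/
def SeqSpace.mk {r : ℕ} (v : ℕ → ℝ) (hv : v ∈ weightedSubmodule r) : SeqSpace r := ⟨v, hv⟩

@[ext] theorem SeqSpace.ext {r : ℕ} {u v : SeqSpace r} (h : ∀ j, u.seq j = v.seq j) : u = v :=
  Subtype.ext (funext h)

@[simp] theorem SeqSpace.seq_add {r : ℕ} (u v : SeqSpace r) (j : ℕ) :
    (u + v).seq j = u.seq j + v.seq j := rfl

@[simp] theorem SeqSpace.seq_sub {r : ℕ} (u v : SeqSpace r) (j : ℕ) :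
    (u - v).seq j = u.seq j - v.seq j := rfl

@[simp] theorem SeqSpace.seq_smul {r : ℕ} (c : ℝ) (u : SeqSpace r) (j : ℕ) :
    (c • u).seq j = c * u.seq j := rfl

@[simp] theorem SeqSpace.seq_zero {r : ℕ} (j : ℕ) : (0 : SeqSpace r).seq j = 0 := rfl

/-- The trilinear form with kernel `T`. -/
noncomputable def trilin (T : ℕ × ℕ × ℕ → ℝ) (u v w : ℕ → ℝ) : ℝ :=
  ∑' p : ℕ × ℕ × ℕ, T p * (u p.1 * v p.2.1 * w p.2.2)

section Kernel

variable {q : ℕ} {K : ℝ} {T : ℕ → ℕ × ℕ × ℕ → ℝ}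

/-- The kernels `T` that act boundedly on sequences summable against `(1 + j) ^ (q + 1)`. -/
def KernelBound (q : ℕ) (K : ℝ) (T : ℕ → ℕ × ℕ × ℕ → ℝ) : Prop :=
  ∀ m p, |T m p| * (1 + (m : ℝ)) ^ (q + 1)
    ≤ K * ((1 + (p.1 : ℝ)) ^ (q + 1) * ((1 + (p.2.1 : ℝ)) ^ (q + 1) *
      (1 + (p.2.2 : ℝ)) ^ (q + 1)))

theorem KernelBound.hasSum (u v w : SeqSpace (q + 2)) (K : ℝ) :
    ∃ S, HasSum (fun p : ℕ × ℕ × ℕ => K * ((1 + (p.1 : ℝ)) ^ (q + 1) * |u.seq p.1| *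
      ((1 + (p.2.1 : ℝ)) ^ (q + 1) * |v.seq p.2.1| *
        ((1 + (p.2.2 : ℝ)) ^ (q + 1) * |w.seq p.2.2|)))) (K * S) ∧
      S ≤ harmonicNorm ^ 3 * (‖u‖ * ‖v‖ * ‖w‖) := by
  obtain ⟨su, lu⟩ := u.summable_weighted
  obtain ⟨sv, lv⟩ := v.summable_weighted
  obtain ⟨sw, lw⟩ := w.summable_weighted
  have svw := sv.mul_of_nonneg sw (fun j => by positivity) (fun j => by positivity)
  have suvw := su.mul_of_nonneg svw (fun j => by positivity) (fun j => by
    simp only [Pi.zero_apply]; positivity)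
  refine ⟨_, suvw.hasSum.mul_left K, ?_⟩
  rw [← su.tsum_mul_tsum svw suvw, ← sv.tsum_mul_tsum sw svw]
  calc _ ≤ (harmonicNorm * ‖u‖) * ((harmonicNorm * ‖v‖) * (harmonicNorm * ‖w‖)) := by
        have hH := harmonicNorm_nonneg
        have h0 : ∀ z : SeqSpace (q + 2),
            0 ≤ ∑' j : ℕ, (1 + (j : ℝ)) ^ (q + 1) * |z.seq j| :=
          fun z => tsum_nonneg fun j => by positivity
        have := h0 u
        have := h0 v
        have := h0 w
        gcongr
    _ = _ := by ring

theorem KernelBound.term_le (hT : KernelBound q K T) (m : ℕ) (u v w : ℕ → ℝ) (p : ℕ × ℕ × ℕ) :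
    |T m p * (u p.1 * v p.2.1 * w p.2.2)| * (1 + (m : ℝ)) ^ (q + 1)
      ≤ K * ((1 + (p.1 : ℝ)) ^ (q + 1) * |u p.1| *
      ((1 + (p.2.1 : ℝ)) ^ (q + 1) * |v p.2.1| *
        ((1 + (p.2.2 : ℝ)) ^ (q + 1) * |w p.2.2|))) := by
  have h := mul_le_mul_of_nonneg_right (hT m p) (abs_nonneg (u p.1 * v p.2.1 * w p.2.2))
  simp only [abs_mul] at h ⊢
  refine le_trans (le_of_eq ?_) (h.trans (le_of_eq ?_)) <;> ring

theorem KernelBound.summable (hT : KernelBound q K T) (m : ℕ) (u v w : SeqSpace (q + 2)) :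
    Summable fun p : ℕ × ℕ × ℕ => T m p * (u.seq p.1 * v.seq p.2.1 * w.seq p.2.2) := by
  obtain ⟨S, hS, -⟩ := KernelBound.hasSum u v w K
  refine Summable.of_norm_bounded hS.summable fun p => ?_
  refine le_trans ?_ (hT.term_le m u.seq v.seq w.seq p)
  exact le_mul_of_one_le_right (abs_nonneg _) (one_le_pow₀ (by simp))

theorem KernelBound.trilin_le (hK : 0 ≤ K) (hT : KernelBound q K T) (m : ℕ)
    (u v w : SeqSpace (q + 2)) :
    |trilin (T m) u.seq v.seq w.seq| * (1 + (m : ℝ)) ^ (q + 1)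
      ≤ K * (harmonicNorm ^ 3 * (‖u‖ * ‖v‖ * ‖w‖)) := by
  obtain ⟨S, hS, hle⟩ := KernelBound.hasSum u v w K
  refine le_trans ?_ (mul_le_mul_of_nonneg_left hle hK)
  have hs := (hT.summable m u v w).norm
  calc _ ≤ (∑' p : ℕ × ℕ × ℕ, ‖T m p * (u.seq p.1 * v.seq p.2.1 * w.seq p.2.2)‖)
        * (1 + (m : ℝ)) ^ (q + 1) := by
        gcongr
        exact norm_tsum_le_tsum_norm hs
    _ ≤ K * S := by
        rw [← tsum_mul_right]
        exact hasSum_le (hT.term_le m u.seq v.seq w.seq) (hs.mul_right _).hasSum hS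

/-- The trilinear map from `l²_{q+2}` to `l²_q` defined by a kernel. -/
noncomputable def kernelMap (hK : 0 ≤ K) (hT : KernelBound q K T) :
    ContinuousMultilinearMap ℝ (fun _ : Fin 3 => SeqSpace (q + 2)) (SeqSpace q) :=
  MultilinearMap.mkContinuous
    { toFun := fun x => SeqSpace.mk (fun m => trilin (T m) (x 0).seq (x 1).seq (x 2).seq)
        (mem_weightedSubmodule fun m => hT.trilin_le hK m (x 0) (x 1) (x 2))
      map_update_add' := by
        intro inst x i a b
        -- Multilinearity is required for an arbitrary decidability instance; the canonical one lets
        -- `simp` evaluate the updates.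
        obtain rfl : inst = instDecidableEqFin 3 := Subsingleton.elim _ _
        refine SeqSpace.ext fun m => ?_
        change trilin (T m) _ _ _ = trilin (T m) _ _ _ + trilin (T m) _ _ _
        simp only [trilin]
        rw [← (hT.summable m _ _ _).tsum_add (hT.summable m _ _ _)]
        refine tsum_congr fun p => ?_
        obtain rfl | rfl | rfl : i = 0 ∨ i = 1 ∨ i = 2 := by decide +revert
        all_goals simp [Function.update_of_ne]
        all_goals ring
      map_update_smul' := by
        intro inst x i c a
        obtain rfl : inst = instDecidableEqFin 3 := Subsingleton.elim _ _
        refine SeqSpace.ext fun m => ?_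
        change trilin (T m) _ _ _ = c * trilin (T m) _ _ _
        simp only [trilin]
        rw [← tsum_mul_left]
        refine tsum_congr fun p => ?_
        obtain rfl | rfl | rfl : i = 0 ∨ i = 1 ∨ i = 2 := by decide +revert
        all_goals simp [Function.update_of_ne]
        all_goals ring }
    (harmonicNorm * (K * harmonicNorm ^ 3)) (by
      intro x
      rw [Fin.prod_univ_three, mul_assoc, mul_assoc]
      have := harmonicNorm_nonneg
      exact SeqSpace.norm_le (by positivity) fun m => hT.trilin_le hK m (x 0) (x 1) (x 2))

theorem kernelMap_seq (hK : 0 ≤ K) (hT : KernelBound q K T) (x : Fin 3 → SeqSpace (q + 2))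
    (m : ℕ) :
    (kernelMap hK hT x).seq m = trilin (T m) (x 0).seq (x 1).seq (x 2).seq := rfl

end Kernel

end HopfCubicWave

/-! ### The resonant operator as a differentiable map between sequence spaces -/

namespace HopfCubicWave

/-- The largest input index k carries the whole output weight, as 1 + m ≤ (3+2μ)(1+k) by the degree
bound; the growth (1+i)(1+j) of the coefficient is absorbed by the weights of the other two, whose
exponent is at least 1. -/
theorem weight_le_of_max {μ q i j k m : ℕ} {K c : ℝ} (hc0 : 0 ≤ c)
    (hc : c ≤ K * ((1 + (i : ℝ)) * (1 + (j : ℝ)))) (hi : i ≤ k) (hj : j ≤ k)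
    (hm : m ≤ i + j + k + 2 * μ) :
    c * (1 + (m : ℝ)) ^ (q + 1) ≤ K * (3 + 2 * (μ : ℝ)) ^ (q + 1) *
      ((1 + (i : ℝ)) ^ (q + 1) * (1 + (j : ℝ)) ^ (q + 1) * (1 + (k : ℝ)) ^ (q + 1)) := by
  have hK : 0 ≤ K := by
    by_contra hK
    have h1 : K * ((1 + (i : ℝ)) * (1 + (j : ℝ))) < 0 :=
      mul_neg_of_neg_of_pos (not_le.mp hK) (by positivity)
    linarith
  have hle : (1 + (m : ℝ)) ≤ (3 + 2 * (μ : ℝ)) * (1 + (k : ℝ)) := by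
    have hi' : (i : ℝ) ≤ k := by exact_mod_cast hi
    have hj' : (j : ℝ) ≤ k := by exact_mod_cast hj
    have hm' : (m : ℝ) ≤ i + j + k + 2 * μ := by exact_mod_cast hm
    have : 0 ≤ (μ : ℝ) * k := by positivity
    linarith
  have h1 : ∀ a : ℕ, (1 + (a : ℝ)) ≤ (1 + (a : ℝ)) ^ (q + 1) := fun a =>
    le_self_pow₀ (by simp) (by omega)
  calc c * (1 + (m : ℝ)) ^ (q + 1)
      ≤ (K * ((1 + (i : ℝ)) ^ (q + 1) * (1 + (j : ℝ)) ^ (q + 1))) *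
          ((3 + 2 * (μ : ℝ)) * (1 + (k : ℝ))) ^ (q + 1) := by
        have h2 := h1 i
        have h3 := h1 j
        refine mul_le_mul (hc.trans ?_) (pow_le_pow_left₀ (by positivity) hle _)
          (by positivity) (by positivity)
        gcongr
    _ = _ := by rw [mul_pow]; ring

theorem exists_kernelBound (μ q : ℕ) : ∃ K : ℝ, 0 ≤ K ∧ ∀ T : ℕ → ℕ × ℕ × ℕ → ℝ,
    (∀ m p, |T m p| ≤ |fourierC μ μ p.1 p.2.1 p.2.2 m|) → KernelBound q K T := by
  obtain ⟨K, hK, hC⟩ := exists_fourierC_bound μ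
  refine ⟨K * (3 + 2 * (μ : ℝ)) ^ (q + 1), by positivity, fun T hT m p => ?_⟩
  obtain ⟨i, j, k⟩ := p
  refine le_trans (mul_le_mul_of_nonneg_right (hT m (i, j, k)) (by positivity)) ?_
  dsimp only
  by_cases hm : i + j + k + 2 * μ < m
  · rw [fourierC_eq_zero μ i j k m hm, abs_zero, zero_mul]
    positivity
  have hm := not_lt.mp hm
  -- The symmetry of the coefficients moves the largest input index to the third place, so that the
  -- bound grows only in the two smaller ones.
  obtain h | h | h : (i ≤ k ∧ j ≤ k) ∨ (i ≤ j ∧ k ≤ j) ∨ (j ≤ i ∧ k ≤ i) := by omega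
  · refine (weight_le_of_max (abs_nonneg _) (hC i j k m) h.1 h.2 hm).trans (le_of_eq ?_)
    ring
  · rw [fourierC_swap23]
    refine (weight_le_of_max (μ := μ) (abs_nonneg _) (hC i k j m) h.1 h.2
      (by omega)).trans (le_of_eq ?_)
    ring
  · rw [fourierC_swap12, fourierC_swap23]
    refine (weight_le_of_max (μ := μ) (abs_nonneg _) (hC j k i m) h.1 h.2
      (by omega)).trans (le_of_eq ?_)
    ring

/-- The product of the four oscillating factors at time `t`. -/
noncomputable def cosProd (μ : ℕ) (t : ℝ) (m : ℕ) (p : ℕ × ℕ × ℕ) : ℝ :=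
  Real.cos (freq μ μ p.1 * t) * Real.cos (freq μ μ p.2.1 * t) * Real.cos (freq μ μ p.2.2 * t)
    * Real.cos (freq μ μ m * t)

theorem continuous_cosProd (μ m : ℕ) (p : ℕ × ℕ × ℕ) :
    Continuous fun t => cosProd μ t m p := by
  unfold cosProd
  fun_prop

theorem abs_cosProd_le (μ : ℕ) (t : ℝ) (m : ℕ) (p : ℕ × ℕ × ℕ) : |cosProd μ t m p| ≤ 1 := by
  simp only [cosProd, abs_mul]
  have h := fun a : ℕ => Real.abs_cos_le_one (freq μ μ a * t)
  exact mul_le_one₀ (mul_le_one₀ (mul_le_one₀ (h _) (abs_nonneg _) (h _)) (abs_nonneg _) (h _))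
    (abs_nonneg _) (h _)

/-- The mean of `cosProd` over a period. -/
noncomputable def cosMean (μ m : ℕ) (p : ℕ × ℕ × ℕ) : ℝ :=
  1 / (2 * Real.pi) * ∫ t in (0 : ℝ)..(2 * Real.pi), cosProd μ t m p

theorem abs_cosMean_le (μ m : ℕ) (p : ℕ × ℕ × ℕ) : |cosMean μ m p| ≤ 1 := by
  have h := intervalIntegral.norm_integral_le_of_norm_le_const (a := 0) (b := 2 * Real.pi)
    (f := fun t => cosProd μ t m p) (C := 1) (fun t _ => abs_cosProd_le μ t m p)
  have hpi := Real.two_pi_pos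
  rw [Real.norm_eq_abs, one_mul, sub_zero, abs_of_pos hpi] at h
  rw [cosMean, abs_mul, abs_of_pos (by positivity), one_div]
  exact (inv_mul_le_one₀ hpi).mpr h

/-- The kernel of the time-averaged nonlinearity. -/
noncomputable def meanKernel (μ m : ℕ) (p : ℕ × ℕ × ℕ) : ℝ :=
  fourierC μ μ p.1 p.2.1 p.2.2 m * cosMean μ m p

theorem abs_meanKernel_le (μ m : ℕ) (p : ℕ × ℕ × ℕ) :
    |meanKernel μ m p| ≤ |fourierC μ μ p.1 p.2.1 p.2.2 m| := by
  rw [meanKernel, abs_mul]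
  exact mul_le_of_le_one_right (abs_nonneg _) (abs_cosMean_le μ m p)

section Orbit

variable {q : ℕ} (μ m : ℕ) (u : SeqSpace (q + 2))

theorem summable_abs_cubic : Summable fun p : ℕ × ℕ × ℕ =>
    ‖fourierC μ μ p.1 p.2.1 p.2.2 m * (u.seq p.1 * u.seq p.2.1 * u.seq p.2.2)‖ := by
  obtain ⟨K, -, h⟩ := exists_kernelBound μ q
  exact ((h (fun m p => fourierC μ μ p.1 p.2.1 p.2.2 m) fun _ _ => le_rfl).summable m u u u).norm

theorem summable_cubicTerm_linFlow (t : ℝ) :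
    Summable (cubicTerm μ μ (linFlow μ μ t u.seq) m) := by
  refine Summable.of_norm_bounded (summable_abs_cubic μ m u) fun p => ?_
  simp only [cubicTerm, linFlow, norm_mul, Real.norm_eq_abs]
  have h : ∀ a : ℕ, |Real.cos (freq μ μ a * t)| * |u.seq a| ≤ |u.seq a| := fun a =>
    mul_le_of_le_one_left (abs_nonneg _) (Real.abs_cos_le_one _)
  have h1 := h p.1
  have h2 := h p.2.1
  have h3 := h p.2.2
  gcongr

theorem linFlow_nonlinearity (t : ℝ) :
    linFlow μ μ t (nonlinearity μ μ (linFlow μ μ t u.seq)) m =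
      -∑' p : ℕ × ℕ × ℕ, fourierC μ μ p.1 p.2.1 p.2.2 m *
        (u.seq p.1 * u.seq p.2.1 * u.seq p.2.2) * cosProd μ t m p := by
  rw [linFlow, nonlinearity, mul_neg, ← tsum_mul_left]
  congr 1
  refine tsum_congr fun p => ?_
  simp only [cubicTerm, linFlow, cosProd]
  ring

theorem norm_orbit_term_le (t : ℝ) (p : ℕ × ℕ × ℕ) :
    ‖fourierC μ μ p.1 p.2.1 p.2.2 m *
        (u.seq p.1 * u.seq p.2.1 * u.seq p.2.2) * cosProd μ t m p‖ ≤
      ‖fourierC μ μ p.1 p.2.1 p.2.2 m * (u.seq p.1 * u.seq p.2.1 * u.seq p.2.2)‖ := by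
  rw [norm_mul]
  exact mul_le_of_le_one_right (norm_nonneg _) (abs_cosProd_le μ t m p)

/-- The cosines are bounded by 1, so the series at u dominates the series along the whole orbit;
uniform convergence makes the averaged function continuous. -/
theorem resonantOpConverges : ResonantOpConverges μ μ u.seq := by
  refine fun m => ⟨summable_cubicTerm_linFlow μ m u, Continuous.intervalIntegrable ?_ _ _⟩
  simp only [linFlow_nonlinearity]
  refine (continuous_tsum (fun p => ?_) (summable_abs_cubic μ m u)
    fun p t => norm_orbit_term_le μ m u t p).neg
  exact continuous_const.mul (continuous_cosProd μ m p)

/-- Dominated convergence exchanges the average with the sum, so the average becomes a trilinear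
form on the diagonal and differentiability comes for free. -/
theorem averagedNonlinearity_eq :
    averagedNonlinearity μ μ u.seq m = -trilin (meanKernel μ m) u.seq u.seq u.seq := by
  have h := intervalIntegral.hasSum_integral_of_dominated_convergence
    (μ := MeasureTheory.volume) (a := 0) (b := 2 * Real.pi)
    (F := fun (p : ℕ × ℕ × ℕ) t => fourierC μ μ p.1 p.2.1 p.2.2 m *
        (u.seq p.1 * u.seq p.2.1 * u.seq p.2.2) * cosProd μ t m p)
    (f := fun t => ∑' p : ℕ × ℕ × ℕ, fourierC μ μ p.1 p.2.1 p.2.2 m *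
        (u.seq p.1 * u.seq p.2.1 * u.seq p.2.2) * cosProd μ t m p)
    (fun p _ => ‖fourierC μ μ p.1 p.2.1 p.2.2 m *
      (u.seq p.1 * u.seq p.2.1 * u.seq p.2.2)‖)
    (fun p => (continuous_const.mul (continuous_cosProd μ m p)).aestronglyMeasurable)
    (fun p => .of_forall fun t _ => norm_orbit_term_le μ m u t p)
    (.of_forall fun _ _ => summable_abs_cubic μ m u)
    intervalIntegrable_const
    (.of_forall fun t _ => (Summable.of_norm_bounded (summable_abs_cubic μ m u)
      (norm_orbit_term_le μ m u t)).hasSum)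
  simp only [averagedNonlinearity, linFlow_nonlinearity, intervalIntegral.integral_neg, mul_neg]
  rw [← h.tsum_eq, trilin, ← tsum_mul_left]
  congr 1
  refine tsum_congr fun p => ?_
  rw [intervalIntegral.integral_const_mul, meanKernel, cosMean]
  ring

end Orbit

theorem freq_le (μ m : ℕ) : freq μ μ m ≤ (2 * (μ : ℝ) + 2) * (1 + (m : ℝ)) := by
  rw [freq_eq]
  have : 0 ≤ (μ : ℝ) * m := by positivity
  linarith

theorem freq_sq_mul_le {μ q : ℕ} (u : SeqSpace (q + 2)) (m : ℕ) :
    ((1 + (m : ℝ)) ^ q * (freq μ μ m ^ 2 * u.seq m)) ^ 2 ≤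
      ((2 * (μ : ℝ) + 2) ^ 2) ^ 2 * ((1 + (m : ℝ)) ^ (q + 2) * u.seq m) ^ 2 := by
  have h1 : (0 : ℝ) ≤ 1 + (m : ℝ) := by positivity
  have h2 : (0 : ℝ) ≤ 2 * (μ : ℝ) + 2 := by positivity
  rw [← mul_pow, sq_le_sq]
  simp only [abs_mul, abs_pow, abs_of_pos (freq_pos μ m), abs_of_nonneg h1, abs_of_nonneg h2]
  have h := pow_le_pow_left₀ (freq_pos μ m).le (freq_le μ m) 2
  calc (1 + (m : ℝ)) ^ q * (freq μ μ m ^ 2 * |u.seq m|)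
      ≤ (1 + (m : ℝ)) ^ q * (((2 * (μ : ℝ) + 2) * (1 + (m : ℝ))) ^ 2 * |u.seq m|) := by gcongr
    _ = _ := by ring

theorem freq_sq_mul_mem {μ q : ℕ} (u : SeqSpace (q + 2)) :
    (fun m => freq μ μ m ^ 2 * u.seq m) ∈ weightedSubmodule q := by
  refine memℓp_gen ?_
  have h := Summable.of_nonneg_of_le (fun m => sq_nonneg _) (freq_sq_mul_le (μ := μ) u)
    (u.hasSum_sq.summable.mul_left _)
  simpa [-abs_mul, -abs_pow, -norm_mul, -norm_pow] using h

theorem norm_freq_sq_mul_le {μ q : ℕ} (u : SeqSpace (q + 2)) :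
    ‖(SeqSpace.mk _ (freq_sq_mul_mem (μ := μ) u) : SeqSpace q)‖ ≤
      (2 * (μ : ℝ) + 2) ^ 2 * ‖u‖ := by
  have h := (SeqSpace.mk _ (freq_sq_mul_mem (μ := μ) u) : SeqSpace q).hasSum_sq
  refine abs_le_of_sq_le_sq' ?_ (by positivity) |>.2
  rw [mul_pow]
  exact hasSum_le (freq_sq_mul_le u) h (u.hasSum_sq.mul_left _)

/-- The diagonal operator `(A u)^m = ω_m² u^m` from `l²_{q+2}` to `l²_q`. -/
noncomputable def freqSqMap (μ q : ℕ) : SeqSpace (q + 2) →L[ℝ] SeqSpace q :=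
  LinearMap.mkContinuous
    { toFun := fun u => SeqSpace.mk (fun m => freq μ μ m ^ 2 * u.seq m) (freq_sq_mul_mem u)
      map_add' := fun _ _ => SeqSpace.ext fun _ => mul_add _ _ _
      map_smul' := fun _ _ => SeqSpace.ext fun _ => mul_left_comm _ _ _ }
    ((2 * (μ : ℝ) + 2) ^ 2) fun u => norm_freq_sq_mul_le u

theorem freqSqMap_seq (μ q : ℕ) (u : SeqSpace (q + 2)) (m : ℕ) :
    (freqSqMap μ q u).seq m = freq μ μ m ^ 2 * u.seq m := rfl

/-- The resonant operator as a map `l²_{q+2} → l²_q`, with its derivative. -/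
theorem exists_resonantMap (μ q : ℕ) : ∃ N : SeqSpace (q + 2) → SeqSpace q,
    (∀ u, (N u).seq = resonantOp μ μ u.seq) ∧
    ∀ x, DifferentiableAt ℝ N x ∧ ∀ h m, (fderiv ℝ N x h).seq m = freq μ μ m ^ 2 * h.seq m -
      (trilin (meanKernel μ m) h.seq x.seq x.seq + trilin (meanKernel μ m) x.seq h.seq x.seq +
        trilin (meanKernel μ m) x.seq x.seq h.seq) := by
  obtain ⟨K, hK, hT⟩ := exists_kernelBound μ q
  set T := kernelMap hK (hT (meanKernel μ) (abs_meanKernel_le μ)) with hTdef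
  let D : SeqSpace (q + 2) →L[ℝ] (Fin 3 → SeqSpace (q + 2)) :=
    ContinuousLinearMap.pi fun _ => ContinuousLinearMap.id ℝ _
  refine ⟨fun u => freqSqMap μ q u - T (D u), fun u => ?_, fun x => ?_⟩
  · funext m
    rw [SeqSpace.seq_sub, freqSqMap_seq, resonantOp, averagedNonlinearity_eq, hTdef,
      kernelMap_seq, sub_eq_add_neg]
    rfl
  · have hd : HasFDerivAt (fun u => freqSqMap μ q u - T (D u))
        (freqSqMap μ q - (T.linearDeriv (D x)).comp D) x :=
      (freqSqMap μ q).hasFDerivAt.sub ((T.hasFDerivAt (D x)).comp x D.hasFDerivAt)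
    refine ⟨hd.differentiableAt, fun h m => ?_⟩
    rw [hd.fderiv, sub_apply, SeqSpace.seq_sub, freqSqMap_seq,
      ContinuousLinearMap.comp_apply, ContinuousMultilinearMap.linearDeriv_apply,
      Fin.sum_univ_three, SeqSpace.seq_add, SeqSpace.seq_add, hTdef, kernelMap_seq,
      kernelMap_seq, kernelMap_seq]
    simp [D, Function.update_of_ne]

end HopfCubicWave

/-! ### Resonances and the linearization at a 1-mode -/

namespace HopfCubicWave

theorem integral_cos_int_mul (a : ℤ) :
    1 / (2 * Real.pi) * ∫ t in (0 : ℝ)..(2 * Real.pi), Real.cos (a * t) =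
      if a = 0 then 1 else 0 := by
  have hpi := Real.two_pi_pos.ne'
  split_ifs with h
  · simp only [h, Int.cast_zero, zero_mul, Real.cos_zero, intervalIntegral.integral_const,
      sub_zero, smul_eq_mul, mul_one]
    exact one_div_mul_cancel hpi
  · have ha : (a : ℝ) ≠ 0 := by exact_mod_cast h
    rw [intervalIntegral.integral_comp_mul_left (fun t => Real.cos t) ha, integral_cos]
    have h0 : Real.sin (a * (2 * Real.pi)) = 0 := by
      have := Real.sin_int_mul_pi (a * 2)
      push_cast at this
      rwa [mul_assoc] at this
    simp [h0]

theorem cos_mul_cos_mul_cos_mul_cos (A B C : ℝ) :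
    Real.cos A * Real.cos A * Real.cos B * Real.cos C =
      1 / 4 * (Real.cos (B - C) + Real.cos (B + C)) +
      1 / 8 * (Real.cos (2 * A + (B - C)) + Real.cos (2 * A - (B - C)) +
        (Real.cos (2 * A + (B + C)) + Real.cos (2 * A - (B + C)))) := by
  simp only [Real.cos_add (2 * A), Real.cos_sub (2 * A), Real.cos_two_mul]
  simp only [Real.cos_add, Real.cos_sub]
  ring

theorem cosMean_eq (μ γ k m : ℕ) : cosMean μ m (γ, γ, k) =
    1 / 4 * (if k = m then 1 else 0) +
    1 / 8 * ((if m = k + 2 * γ + 2 * μ + 1 then 1 else 0) +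
      (if k = m + 2 * γ + 2 * μ + 1 then 1 else 0) + (if k + m = 2 * γ then 1 else 0)) := by
  have hint : ∀ a : ℤ, IntervalIntegrable (fun t : ℝ => Real.cos (a * t))
      MeasureTheory.volume 0 (2 * Real.pi) := fun a =>
    (by fun_prop : Continuous fun t : ℝ => Real.cos (a * t)).intervalIntegrable _ _
  have hcos : ∀ t, cosProd μ t m (γ, γ, k) =
      1 / 4 * (Real.cos (((2 * k - 2 * m : ℤ) : ℝ) * t) +
        Real.cos (((2 * k + 2 * m + 4 * μ + 2 : ℤ) : ℝ) * t)) +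
      1 / 8 * (Real.cos (((4 * γ + 4 * μ + 2 + 2 * k - 2 * m : ℤ) : ℝ) * t) +
        Real.cos (((4 * γ + 4 * μ + 2 - 2 * k + 2 * m : ℤ) : ℝ) * t) +
        (Real.cos (((4 * γ + 8 * μ + 4 + 2 * k + 2 * m : ℤ) : ℝ) * t) +
          Real.cos (((4 * γ - 2 * k - 2 * m : ℤ) : ℝ) * t))) := by
    intro t
    rw [cosProd, cos_mul_cos_mul_cos_mul_cos]
    simp only [freq_eq]
    push_cast
    congr! 4 <;> ring_nf
  rw [cosMean]
  simp only [hcos]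
  rw [intervalIntegral.integral_add, intervalIntegral.integral_const_mul,
    intervalIntegral.integral_const_mul, intervalIntegral.integral_add,
    intervalIntegral.integral_add, intervalIntegral.integral_add, intervalIntegral.integral_add]
  · have e := integral_cos_int_mul
    have e0 := e (2 * k - 2 * m)
    have e1 := e (2 * k + 2 * m + 4 * μ + 2)
    have e2 := e (4 * γ + 4 * μ + 2 + 2 * k - 2 * m)
    have e3 := e (4 * γ + 4 * μ + 2 - 2 * k + 2 * m)
    have e4 := e (4 * γ + 8 * μ + 4 + 2 * k + 2 * m)
    have e5 := e (4 * γ - 2 * k - 2 * m)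
    -- Sums of positive frequencies never vanish; the other four combinations can.
    rw [if_neg (by omega)] at e1 e4
    rw [if_congr (by omega : _ ↔ k = m) rfl rfl] at e0
    rw [if_congr (by omega : _ ↔ m = k + 2 * γ + 2 * μ + 1) rfl rfl] at e2
    rw [if_congr (by omega : _ ↔ k = m + 2 * γ + 2 * μ + 1) rfl rfl] at e3
    rw [if_congr (by omega : _ ↔ k + m = 2 * γ) rfl rfl] at e5
    rw [← e0, ← e2, ← e3, ← e5]
    linear_combination 1 / 4 * e1 + 1 / 8 * e4
  all_goals first
    | exact hint _
    | exact (hint _).add (hint _)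
    | exact ((hint _).add (hint _)).add ((hint _).add (hint _))
    | exact ((hint _).add (hint _)).const_mul _
    | exact (((hint _).add (hint _)).add ((hint _).add (hint _))).const_mul _

/-- Of the four resonances in `cosMean_eq`, the two with |k - m| = 2γ + 2μ + 1 exceed the degree
threshold by one and meet a zero Fourier coefficient. -/
theorem meanKernel_eq (μ γ k m : ℕ) : meanKernel μ m (γ, γ, k) =
    fourierC μ μ γ γ k m *
      (1 / 4 * (if k = m then 1 else 0) + 1 / 8 * (if k + m = 2 * γ then 1 else 0)) := by
  rw [meanKernel, cosMean_eq]
  dsimp only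
  by_cases h1 : m = k + 2 * γ + 2 * μ + 1
  · rw [fourierC_eq_zero μ γ γ k m (by omega)]
    ring
  by_cases h2 : k = m + 2 * γ + 2 * μ + 1
  · rw [fourierC_swap34, fourierC_eq_zero μ γ γ m k (by omega)]
    ring
  rw [if_neg h1, if_neg h2]
  ring

theorem meanKernel_swap12 (μ m i j k : ℕ) :
    meanKernel μ m (i, j, k) = meanKernel μ m (j, i, k) := by
  simp only [meanKernel, cosMean, cosProd]
  rw [fourierC_swap12]
  congr! 5
  ring

theorem meanKernel_swap23 (μ m i j k : ℕ) :
    meanKernel μ m (i, j, k) = meanKernel μ m (i, k, j) := by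
  simp only [meanKernel, cosMean, cosProd]
  rw [fourierC_swap23]
  congr! 5
  ring

theorem trilin_swap12 {T : ℕ × ℕ × ℕ → ℝ} (hT : ∀ i j k, T (i, j, k) = T (j, i, k))
    (u v w : ℕ → ℝ) : trilin T u v w = trilin T v u w := by
  let e : ℕ × ℕ × ℕ ≃ ℕ × ℕ × ℕ :=
    ⟨fun p => (p.2.1, p.1, p.2.2), fun p => (p.2.1, p.1, p.2.2), fun _ => rfl, fun _ => rfl⟩
  rw [trilin, ← e.tsum_eq]
  refine tsum_congr fun p => ?_
  change T (p.2.1, p.1, p.2.2) * (u p.2.1 * v p.1 * w p.2.2) = _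
  rw [hT]
  ring

theorem trilin_swap23 {T : ℕ × ℕ × ℕ → ℝ} (hT : ∀ i j k, T (i, j, k) = T (i, k, j))
    (u v w : ℕ → ℝ) : trilin T u v w = trilin T u w v := by
  let e : ℕ × ℕ × ℕ ≃ ℕ × ℕ × ℕ :=
    ⟨fun p => (p.1, p.2.2, p.2.1), fun p => (p.1, p.2.2, p.2.1), fun _ => rfl, fun _ => rfl⟩
  rw [trilin, ← e.tsum_eq]
  refine tsum_congr fun p => ?_
  change T (p.1, p.2.2, p.2.1) * (u p.1 * v p.2.2 * w p.2.1) = _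
  rw [hT]
  ring

theorem trilin_oneMode_of_lt (μ γ : ℕ) {x : ℕ → ℝ} (hx : ∀ m, m ≠ γ → x m = 0)
    (h : ℕ → ℝ) {m : ℕ} (hm : 2 * γ < m) :
    trilin (meanKernel μ m) x x h = x γ ^ 2 * (fourierC μ μ γ γ m m / 4) * h m := by
  rw [trilin, tsum_eq_single (γ, γ, m)]
  · dsimp only
    rw [meanKernel_eq, if_pos rfl, if_neg (by omega)]
    ring
  · rintro ⟨i, j, k⟩ hp
    dsimp only
    by_cases hi : i = γ
    · by_cases hj : j = γ
      · subst hi hj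
        have hk : k ≠ m := by rintro rfl; exact hp rfl
        rw [meanKernel_eq, if_neg hk, if_neg (by omega)]
        ring
      · rw [hx j hj]; ring
    · rw [hx i hi]; ring

theorem trilin_oneMode_self (μ γ : ℕ) {x : ℕ → ℝ} (hx : ∀ m, m ≠ γ → x m = 0)
    (h : ℕ → ℝ) :
    trilin (meanKernel μ γ) x x h = x γ ^ 2 * (3 * fourierC μ μ γ γ γ γ / 8) * h γ := by
  rw [trilin, tsum_eq_single (γ, γ, γ)]
  · dsimp only
    rw [meanKernel_eq, if_pos rfl, if_pos (by omega)]
    ring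
  · rintro ⟨i, j, k⟩ hp
    dsimp only
    by_cases hi : i = γ
    · by_cases hj : j = γ
      · have hk : k ≠ γ := by rintro rfl; exact hp (by rw [hi, hj])
        subst hi hj
        rw [meanKernel_eq, if_neg hk, if_neg (by omega)]
        ring
      · rw [hx j hj]; ring
    · rw [hx i hi]; ring

theorem trilin_oneMode_of_add (μ γ : ℕ) {x : ℕ → ℝ} (hx : ∀ m, m ≠ γ → x m = 0)
    (h : ℕ → ℝ) {m k : ℕ} (hmk : k + m = 2 * γ) (hne : k ≠ m) :
    trilin (meanKernel μ m) x x h = x γ ^ 2 * (fourierC μ μ γ γ m m / 4) * h m +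
      x γ ^ 2 * (fourierC μ μ γ γ k m / 8) * h k := by
  rw [trilin, tsum_eq_sum (s := {(γ, γ, m), (γ, γ, k)})]
  · rw [Finset.sum_pair (by simpa using hne.symm)]
    dsimp only
    rw [meanKernel_eq, meanKernel_eq, if_pos rfl, if_pos hmk, if_neg hne, if_neg (by omega)]
    ring
  · rintro ⟨i, j, l⟩ hp
    dsimp only
    by_cases hi : i = γ
    · by_cases hj : j = γ
      · subst hi hj
        simp only [Finset.mem_insert, Finset.mem_singleton, Prod.mk.injEq, true_and,
          not_or] at hp
        rw [meanKernel_eq, if_neg hp.1, if_neg (by omega)]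
        ring
      · rw [hx j hj]; ring
    · rw [hx i hi]; ring

theorem oneMode_mem (μ γ q : ℕ) (σ : ℝ) : oneMode μ μ γ σ ∈ weightedSubmodule q := by
  refine mem_weightedSubmodule (B := |oneMode μ μ γ σ γ| * (1 + (γ : ℝ)) ^ (q + 1)) fun m => ?_
  by_cases hm : m = γ
  · rw [hm]
  · rw [show oneMode μ μ γ σ m = 0 from if_neg hm, abs_zero, zero_mul]
    positivity

/-- This is the equation ω_γ² ξ = (3/8) C ξ³ divided by ξ, where 3/8 is the mean of cos⁴. Positivity
of the coefficient is needed for the square root. -/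
theorem oneMode_self_sq (μ γ : ℕ) (σ : ℝ) (hσ : σ = 1 ∨ σ = -1)
    (hC : 0 < fourierC μ μ γ γ γ γ) :
    3 * fourierC μ μ γ γ γ γ * oneMode μ μ γ σ γ ^ 2 = 8 * freq μ μ γ ^ 2 := by
  have hσ2 : σ ^ 2 = 1 := by rcases hσ with rfl | rfl <;> norm_num
  rw [oneMode, if_pos rfl, mul_pow, hσ2, mul_pow, Real.sq_sqrt (by positivity)]
  field_simp
  ring

/-- Multiplying each row of the derivative by C_{γγγγ} and inserting `oneMode_self_sq` turns the
rows into exactly the quantities of `hdiag` and the matrix entries of `detD`. -/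
theorem isNondegenerateZero_oneMode (μ γ q : ℕ) (σ : ℝ) (hσ : σ = 1 ∨ σ = -1)
    (hC : 0 < fourierC μ μ γ γ γ γ)
    (hdiag : ∀ m : ℕ, 2 * γ + 1 ≤ m → freq μ μ m ^ 2 * fourierC μ μ γ γ γ γ
      - 2 * freq μ μ γ ^ 2 * fourierC μ μ γ γ m m ≠ 0)
    (hdet : ∀ n : ℕ, n < γ → detD μ μ γ n ≠ 0) :
    IsNondegenerateZero (resonantOp μ μ) (q + 2) q (oneMode μ μ γ σ) := by
  obtain ⟨N, hN, hd⟩ := exists_resonantMap μ q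
  set ξ := oneMode μ μ γ σ
  have hξ : ∀ m, m ≠ γ → ξ m = 0 := fun m hm => if_neg hm
  have hsq : 3 * fourierC μ μ γ γ γ γ * ξ γ ^ 2 = 8 * freq μ μ γ ^ 2 :=
    oneMode_self_sq μ γ σ hσ hC
  let x : SeqSpace (q + 2) := SeqSpace.mk ξ (oneMode_mem μ γ (q + 2) σ)
  have hxs : x.seq = ξ := rfl
  refine ⟨N, x, hN, rfl, SeqSpace.ext fun m => ?_, (hd x).1, ?_⟩
  · rw [hN, resonantOp, averagedNonlinearity_eq, SeqSpace.seq_zero, hxs]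
    obtain rfl | hmγ := eq_or_ne m γ
    · rw [trilin_oneMode_self μ m hξ]
      linear_combination -(ξ m / 8) * hsq
    · obtain hm | hm := lt_or_ge (2 * γ) m
      · rw [trilin_oneMode_of_lt μ γ hξ _ hm, hξ m hmγ]
        ring
      · rw [trilin_oneMode_of_add μ γ hξ _ (Nat.sub_add_cancel hm) (by omega), hξ m hmγ,
          hξ (2 * γ - m) (by omega)]
        ring
  · refine (LinearMap.ker_eq_bot').mpr fun h hh => ?_
    -- The three partial derivatives coincide by symmetry of the kernel, whence the factor 3.
    have row : ∀ m, freq μ μ m ^ 2 * h.seq m - 3 * trilin (meanKernel μ m) ξ ξ h.seq = 0 := by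
      intro m
      have e := (hd x).2 h m
      have e0 : (fderiv ℝ N x h).seq m = 0 := congrFun (congrArg SeqSpace.seq hh) m
      rw [hxs, trilin_swap12 (meanKernel_swap12 μ m) h.seq ξ ξ,
        trilin_swap23 (meanKernel_swap23 μ m) ξ h.seq ξ, e0] at e
      linear_combination -e
    have pair : ∀ n, n < γ → h.seq n = 0 ∧ h.seq (2 * γ - n) = 0 := by
      intro n hn
      have r1 := row n
      have r2 := row (2 * γ - n)
      have hD := hdet n hn
      rw [trilin_oneMode_of_add μ γ hξ _ (Nat.sub_add_cancel (by omega : n ≤ 2 * γ))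
        (by omega)] at r1
      rw [trilin_oneMode_of_add μ γ hξ _ (by omega : n + (2 * γ - n) = 2 * γ) (by omega),
        fourierC_swap34 μ γ γ n] at r2
      rw [detD, fourierC_swap23 μ γ (2 * γ - n) γ n] at hD
      have s1 : (freq μ μ n ^ 2 * fourierC μ μ γ γ γ γ
          - 2 * freq μ μ γ ^ 2 * fourierC μ μ γ γ n n) * h.seq n -
          freq μ μ γ ^ 2 * fourierC μ μ γ γ (2 * γ - n) n * h.seq (2 * γ - n) = 0 := by
        linear_combination fourierC μ μ γ γ γ γ * r1 + (fourierC μ μ γ γ n n / 4 * h.seq n +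
          fourierC μ μ γ γ (2 * γ - n) n / 8 * h.seq (2 * γ - n)) * hsq
      have s2 : (freq μ μ (2 * γ - n) ^ 2 * fourierC μ μ γ γ γ γ
          - 2 * freq μ μ γ ^ 2 * fourierC μ μ γ γ (2 * γ - n) (2 * γ - n)) * h.seq (2 * γ - n) -
          freq μ μ γ ^ 2 * fourierC μ μ γ γ (2 * γ - n) n * h.seq n = 0 := by
        linear_combination fourierC μ μ γ γ γ γ * r2 +
          (fourierC μ μ γ γ (2 * γ - n) (2 * γ - n) / 4 * h.seq (2 * γ - n) +
          fourierC μ μ γ γ (2 * γ - n) n / 8 * h.seq n) * hsq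
      constructor
      -- Cramer's rule for the block on {n, 2γ-n}.
      · refine (mul_eq_zero.mp ?_).resolve_left hD
        linear_combination (freq μ μ (2 * γ - n) ^ 2 * fourierC μ μ γ γ γ γ
          - 2 * freq μ μ γ ^ 2 * fourierC μ μ γ γ (2 * γ - n) (2 * γ - n)) * s1 +
          freq μ μ γ ^ 2 * fourierC μ μ γ γ (2 * γ - n) n * s2
      · refine (mul_eq_zero.mp ?_).resolve_left hD
        linear_combination (freq μ μ n ^ 2 * fourierC μ μ γ γ γ γ
          - 2 * freq μ μ γ ^ 2 * fourierC μ μ γ γ n n) * s2 +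
          freq μ μ γ ^ 2 * fourierC μ μ γ γ (2 * γ - n) n * s1
    refine SeqSpace.ext fun m => ?_
    rw [SeqSpace.seq_zero]
    obtain hm | rfl | hm := lt_trichotomy m γ
    · exact (pair m hm).1
    -- The row at γ is ω_γ² - 9/8 C ξ² = -2ω_γ², never zero.
    · have r := row m
      rw [trilin_oneMode_self μ m hξ] at r
      have hf := freq_pos μ m
      refine (mul_eq_zero.mp ?_).resolve_left (by positivity : freq μ μ m ^ 2 ≠ 0)
      linear_combination -(1 / 2) * r - 3 / 16 * h.seq m * hsq
    · obtain hm2 | hm2 := lt_or_ge (2 * γ) m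
      · have r := row m
        rw [trilin_oneMode_of_lt μ γ hξ _ hm2] at r
        refine (mul_eq_zero.mp ?_).resolve_left (hdiag m hm2)
        linear_combination fourierC μ μ γ γ γ γ * r + fourierC μ μ γ γ m m / 4 * h.seq m * hsq
      · have e := (pair (2 * γ - m) (by omega)).2
        rwa [Nat.sub_sub_self hm2] at e

theorem fourierC_diag_nonneg (μ γ m : ℕ) : 0 ≤ fourierC μ μ γ γ m m := by
  refine intervalIntegral.integral_nonneg (by positivity) fun x hx => ?_
  refine mul_nonneg ?_ (sin_two_mul_nonneg hx)
  rw [mul_assoc (_ * _)]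
  exact mul_nonneg (mul_self_nonneg _) (mul_self_nonneg _)

theorem diag_condition (γ μ m : ℕ) (hγ : γ ≤ 5) (hm : 2 * γ + 1 ≤ m) :
    0 < freq μ μ m ^ 2 * fourierC μ μ γ γ γ γ - 2 * freq μ μ γ ^ 2 * fourierC μ μ γ γ m m := by
  interval_cases γ
  · exact diag_condition_zero μ m hm
  · exact diag_condition_one μ m hm
  · exact diag_condition_two μ m hm
  · exact diag_condition_three μ m hm
  · exact diag_condition_four μ m hm
  · exact diag_condition_five μ m hm

/-- The strict diagonal inequality at m = 2γ+1 already forces positivity, because C_{γγmm} ≥ 0. -/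
theorem fourierC_self_pos (γ μ : ℕ) (hγ : γ ≤ 5) : 0 < fourierC μ μ γ γ γ γ := by
  have h := diag_condition γ μ _ hγ le_rfl
  have h0 := mul_nonneg (by positivity : 0 ≤ 2 * freq μ μ γ ^ 2)
    (fourierC_diag_nonneg μ γ (2 * γ + 1))
  exact pos_of_mul_pos_right (by linarith) (sq_nonneg (freq μ μ (2 * γ + 1)))

end HopfCubicWave

theorem mainTheorem4 :
    ∃ μ₀ : ℕ, ∀ γ μ : ℕ, γ ≤ 5 → (μ ≤ 5 ∨ μ₀ ≤ μ) →
      (∀ m : ℕ, 2 * γ + 1 ≤ m →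
        HopfCubicWave.freq μ μ m ^ 2 * HopfCubicWave.fourierC μ μ γ γ γ γ
          - 2 * HopfCubicWave.freq μ μ γ ^ 2 * HopfCubicWave.fourierC μ μ γ γ m m ≠ 0) ∧
      (∀ n : ℕ, n < γ → HopfCubicWave.detD μ μ γ n ≠ 0) ∧
      (∀ s : ℕ, 2 ≤ s →
        (∀ u : HopfCubicWave.SeqSpace (s + 3),
          HopfCubicWave.ResonantOpConverges μ μ u.seq) ∧
        (∀ σ : ℝ, (σ = 1 ∨ σ = -1) →
          HopfCubicWave.IsNondegenerateZero (HopfCubicWave.resonantOp μ μ) (s + 3) (s + 1)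
            (HopfCubicWave.oneMode μ μ γ σ))) := by
  obtain ⟨μ₀, hdet⟩ := HopfCubicWave.exists_detD_ne_zero
  refine ⟨μ₀, fun γ μ hγ hμ => ?_⟩
  have hdiag := fun m hm => (HopfCubicWave.diag_condition γ μ m hγ hm).ne'
  refine ⟨hdiag, hdet γ μ hγ hμ, fun s _ =>
    -- With q = s + 1 the general mapping property from l²_{q+2} to l²_q is the required one.
    ⟨fun u => HopfCubicWave.resonantOpConverges (q := s + 1) μ u, fun σ hσ => ?_⟩⟩
  exact HopfCubicWave.isNondegenerateZero_oneMode μ γ (s + 1) σ hσ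
    (HopfCubicWave.fourierC_self_pos γ μ hγ) hdiag (hdet γ μ hγ hμ)
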